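/- **Setting.** Let $d\ge 2$ and let $V(x)=v(|x|)$ on $\mathbb R^d$, where $v\in C^1(0,+\infty)$, $v'(r)>0$ for all $r\ge R_0$ (some $R_0>0$), and either $v\in C^0([0,+\infty))$, or there is $s\in(0,2)$ with $v(r)\approx -r^{-s}$ as $r\to 0^+$. Here $a\approx b$ means $\frac1C\le \frac ab\le C$ near the limit point for some constant $C>0$. Assume in addition one of the following. * Case A: there is $m>1$ such that $v(r)\approx r^m$ and $v'(r)\approx r^{m-1}$ as $r\to+\infty$. * Case B: there is $m\in(-2,0)$ such that $v(r)\approx -r^m$ and $v'(r)\approx r^{m-1}$ as $r\to+\infty$. Let $H_V=-\Delta+V$ be the self-adjoint operator in $L^2(\mathbb R^d)$ (real or complex) obtained by Friedrichs extension from the form $\int \nabla\varphi\cdot\overline{\nabla\psi}+\int V\varphi\overline{\psi}$ on $C_0^\infty(\mathbb R^d\setminus\{0\})$. **Proposition 3.6.** Let $\lambda$ be an eigenvalue of $H_V$ with $\lambda<\liminf_{r\to+\infty}v(r)$. Then there is an integer $p_\lambda\ge 0$ such that every eigenfunction $u_\lambda$ of $H_V$ for $\lambda$ has a representative that is continuous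 on $\mathbb R^d\setminus\{0\}$, and for this representative the following holds: for every $\tau\le\lambda$ and every hypersphere $S=\{|x|=r\}$, $r>0$, contained in the level set $V^{-1}(\tau)$, there is a polynomial $P$ in $d$ variables of degree at most $p_\lambda$ with $u_\lambda=P$ on $S$. Moreover the set $\{\ell\in\mathbb N : \ell\ge1,\ \inf_{r>0}\big(v(r)+\frac{\ell(\ell+d-2)}{r^2}\big)<\lambda\}$ is finite, and $p_\lambda$ can be chosen so that $$p_\lambda\le \max\Big\{\ell\ge 1 : \inf_{r>0}\Big(v(r)+\frac{\ell(\ell+d-2)}{r^2}\Big)<\lambda\Big\},$$ where the maximum of the empty set is $0$. -/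

import Mathlib

open Set Filter Topology MeasureTheory
open scoped ContDiff ComplexConjugate

noncomputable section

/-- `a ≈ b` along the filter `l`: the quotients `a / b` and `b / a` are bounded (and positive),
i.e. `1 / C ≤ a / b ≤ C` near the limit point, for some constant `C > 0`. -/
def Comparable (l : Filter ℝ) (a b : ℝ → ℝ) : Prop :=
  ∃ C : ℝ, 0 < C ∧ ∀ᶠ r in l, 1 / C ≤ a r / b r ∧ a r / b r ≤ C

/-- The assumptions on the radial profile common to both cases: `v` is `C¹` on `(0, ∞)`, `v' > 0`
far away, and at the origin `v` is either continuous or comparable to `-r ^ (-s)`, `0 < s < 2`. -/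
structure IsAdmissibleProfile (v : ℝ → ℝ) : Prop where
  contDiffOn : ContDiffOn ℝ 1 v (Ioi 0)
  deriv_pos : ∃ R₀ : ℝ, 0 < R₀ ∧ ∀ r, R₀ ≤ r → 0 < deriv v r
  origin : ContinuousOn v (Ici 0) ∨
    ∃ s : ℝ, 0 < s ∧ s < 2 ∧ Comparable (𝓝[>] 0) v (fun r => -r ^ (-s))

/-- Case A: the profile grows like `r ^ m` with `m > 1`. -/
def IsCaseA (v : ℝ → ℝ) : Prop :=
  IsAdmissibleProfile v ∧ ∃ m : ℝ, 1 < m ∧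
    Comparable atTop v (fun r => r ^ m) ∧
    Comparable atTop (deriv v) (fun r => r ^ (m - 1))

/-- Case B: the profile tends to `0` from below like `-r ^ m` with `-2 < m < 0`. -/
def IsCaseB (v : ℝ → ℝ) : Prop :=
  IsAdmissibleProfile v ∧ ∃ m : ℝ, -2 < m ∧ m < 0 ∧
    Comparable atTop v (fun r => -r ^ m) ∧
    Comparable atTop (deriv v) (fun r => r ^ (m - 1))

/-- The radial potential `V(x) = v(|x|)` on `ℝ^d`. -/
def radialPotential {d : ℕ} (v : ℝ → ℝ) (x : EuclideanSpace ℝ (Fin d)) : ℝ := v ‖x‖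

section Schroedinger

variable {𝕜 : Type*} [RCLike 𝕜] {d : ℕ}

/-- The space `C_0^∞(ℝ^d ∖ {0})`. -/
structure IsCoreFunction (φ : EuclideanSpace ℝ (Fin d) → 𝕜) : Prop where
  smooth : ContDiff ℝ ∞ φ
  compact : HasCompactSupport φ
  away : (0 : EuclideanSpace ℝ (Fin d)) ∉ tsupport φ

/-- The partial derivative `∂ᵢ φ`. -/
def partialDeriv (i : Fin d) (φ : EuclideanSpace ℝ (Fin d) → 𝕜)
    (x : EuclideanSpace ℝ (Fin d)) : 𝕜 :=
  fderiv ℝ φ x (EuclideanSpace.single i 1)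

/-- The sesquilinear form `a(φ, ψ) = ∫ ∇φ · conj ∇ψ + ∫ V φ conj ψ` (used on `C_0^∞(ℝ^d ∖ {0})`). -/
def schroedingerForm (V : EuclideanSpace ℝ (Fin d) → ℝ)
    (φ ψ : EuclideanSpace ℝ (Fin d) → 𝕜) : 𝕜 :=
  (∫ x, ∑ i, partialDeriv i φ x * conj (partialDeriv i ψ x)) +
    ∫ x, (V x : 𝕜) * φ x * conj (ψ x)

/-- The sequence `φ` of functions of `C_0^∞(ℝ^d ∖ {0})` converges to `u` in the completion for the
form norm: it converges to `u` in `L²` and it is Cauchy for the quadratic form `a(φ, φ)`.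
The functions `u ∈ L²` that admit such a sequence are those of the (closed) form domain. -/
structure FormConverges (V : EuclideanSpace ℝ (Fin d) → ℝ)
    (φ : ℕ → EuclideanSpace ℝ (Fin d) → 𝕜) (u : EuclideanSpace ℝ (Fin d) → 𝕜) : Prop where
  core : ∀ n, IsCoreFunction (φ n)
  tendsto_L2 : Tendsto (fun n => eLpNorm (φ n - u) 2 volume) atTop (𝓝 0)
  cauchy : Tendsto
    (fun p : ℕ × ℕ => schroedingerForm V (φ p.1 - φ p.2) (φ p.1 - φ p.2)) atTop (𝓝 0)

/-- The graph of the Friedrichs extension `H_V` of `-Δ + V` on `C_0^∞(ℝ^d ∖ {0})`, i.e. of the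
self-adjoint operator of the closure `ā` of the form `a`: `u` is in the domain and `H_V u = f` iff
`u` is in the form domain and `ā(u, ψ) = ⟨f, ψ⟩` for all `ψ` in the form core, where
`ā(u, ψ) = lim a(φₙ, ψ)` along a sequence `φₙ` converging to `u` in the form sense. -/
def FriedrichsGraph (V : EuclideanSpace ℝ (Fin d) → ℝ)
    (u f : EuclideanSpace ℝ (Fin d) → 𝕜) : Prop :=
  MemLp u 2 volume ∧ MemLp f 2 volume ∧
    ∃ φ : ℕ → EuclideanSpace ℝ (Fin d) → 𝕜, FormConverges V φ u ∧
      ∀ ψ : EuclideanSpace ℝ (Fin d) → 𝕜, IsCoreFunction ψ →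
        Tendsto (fun n => schroedingerForm V (φ n) ψ) atTop (𝓝 (∫ x, f x * conj (ψ x)))

/-- `u` is an eigenfunction of `H_V` for the real number `μ`: `u ≠ 0` in `L²` and `H_V u = μ u`. -/
def IsEigenfunction (V : EuclideanSpace ℝ (Fin d) → ℝ) (μ : ℝ)
    (u : EuclideanSpace ℝ (Fin d) → 𝕜) : Prop :=
  ¬ u =ᵐ[volume] 0 ∧ FriedrichsGraph V u (fun x => (μ : 𝕜) * u x)

end Schroedinger

/-- The set of all `ℓ ≥ 1` with `inf_{r > 0} (v(r) + ℓ (ℓ + d - 2) / r²) < μ`. -/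
def angularSet (d : ℕ) (v : ℝ → ℝ) (μ : ℝ) : Set ℕ :=
  {ℓ | 1 ≤ ℓ ∧
    (⨅ r ∈ Ioi (0 : ℝ), ((v r + (ℓ : ℝ) * ((ℓ : ℝ) + (d : ℝ) - 2) / r ^ 2 : ℝ) : EReal)) < (μ : EReal)}

end

/-! The angular momentum barrier removes all spherical harmonics of high degree from an
eigenfunction `u`, so that on each sphere only finitely many polynomials survive. No ordinary
differential equation is solved and no elliptic regularity is needed: everything happens on a
sequence `φ m` of core functions that converges to `u` in the form sense.

For a homogeneous harmonic polynomial `h` of degree `n`, let `f(r) = ∫ φ(rθ) h(θ) dσ(θ)`. If `h` has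
norm one on the unit sphere, the component of `φ` along `h` is `r ^ (-n) f(r) h(x)`. The form
against a function `G(|x|) h(x)` sees `φ` only through `f` (`schroedingerForm_harmMul`), and the
energy of the component is `∫ r ^ (d-1) (|f'|² + (v + n(n+d-2)/r²) |f|²) dr`
(`re_schroedingerForm_harmProj`). If the effective potential is everywhere at least `lam`, the
energy shifted by `lam` dominates `∫ r ^ (d-1) |f'|²`. The weak eigenvalue equation makes this
shifted energy tend to `0` along `φ m`. A one-dimensional weighted Sobolev inequality then forces `f
→ 0` at every radius (`tendsto_sphMean_zero`).

Let `L` be the supremum of the angular set, and let `e j` be polynomials of degree at most `L` that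
are orthonormal on the unit sphere and span there. The spherical means of `φ m` against `e j`
converge locally uniformly on `(0, ∞)` to continuous functions `f j`, and the representative is
`w(x) = ∑ f j(|x|) e j(x/|x|)`. It has the same harmonic coefficients as the limit of `φ m`: in
degrees up to `L` by expansion in the `e j`, in higher degrees because both sides vanish. Products
of radial bumps and harmonic polynomials detect functions off the origin, by Stone–Weierstrass and
the decomposition of polynomials into powers of `|x|²` times harmonic ones; hence `u = w` almost
everywhere. On a sphere of radius `r` the numbers `f j(r)` are constants, which leaves a polynomial
of degree at most `L`.

Two analytic facts support this. The potential is bounded below by `-K(1 + r ^ (-s))` with `s < 2`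
(`IsAdmissibleProfile.exists_lower_bound`), and such a singularity has relative form bound `0`, so
form convergence controls gradients (`gradSq_le_form`). The same lower bound, with `v > lam` near
infinity, makes the angular set finite. -/

noncomputable section

/-- The Euclidean space `ℝ^d`. -/
abbrev Euc (d : ℕ) := EuclideanSpace ℝ (Fin d)

/-- The surface measure of the unit sphere of `ℝ^d`. -/
abbrev surfaceMeasure (d : ℕ) : Measure (Metric.sphere (0 : Euc d) 1) :=
  (volume : Measure (Euc d)).toSphere

variable {𝕜 : Type*} [RCLike 𝕜] {d : ℕ}

/-! ### Radial bumps -/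

/-- Smooth functions on `(0, ∞)` that vanish near `0` and near `∞`. -/
structure IsRadialBump (G : ℝ → 𝕜) : Prop where
  smooth : ContDiffOn ℝ ∞ G (Ioi 0)
  vanish : ∃ a b : ℝ, 0 < a ∧ ∀ r, 0 < r → r < a ∨ b < r → G r = 0

namespace IsRadialBump

variable {G H : ℝ → 𝕜}

lemma contDiffAt (hG : IsRadialBump G) {r : ℝ} (hr : 0 < r) : ContDiffAt ℝ ∞ G r :=
  hG.smooth.contDiffAt (Ioi_mem_nhds hr)

lemma differentiableAt (hG : IsRadialBump G) {r : ℝ} (hr : 0 < r) : DifferentiableAt ℝ G r :=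
  (hG.contDiffAt hr).differentiableAt (by simp)

lemma hasDerivAt (hG : IsRadialBump G) {r : ℝ} (hr : 0 < r) : HasDerivAt G (deriv G r) r :=
  (hG.differentiableAt hr).hasDerivAt

lemma continuousOn (hG : IsRadialBump G) : ContinuousOn G (Ioi 0) := hG.smooth.continuousOn

lemma mul_left (hG : IsRadialBump G) {c : ℝ → 𝕜} (hc : ContDiffOn ℝ ∞ c (Ioi 0)) :
    IsRadialBump (fun r => c r * G r) := by
  obtain ⟨a, b, ha, h⟩ := hG.vanish
  exact ⟨hc.mul hG.smooth, a, b, ha, fun r hr h' => by simp [h r hr h']⟩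

lemma ofReal_mul (hG : IsRadialBump G) {c : ℝ → ℝ} (hc : ContDiffOn ℝ ∞ c (Ioi 0)) :
    IsRadialBump (fun r => (c r : 𝕜) * G r) :=
  hG.mul_left ((RCLike.ofRealCLM (K := 𝕜)).contDiff.comp_contDiffOn hc)

lemma mul (hG : IsRadialBump G) (hH : IsRadialBump H) : IsRadialBump (fun r => G r * H r) :=
  hH.mul_left hG.smooth

lemma conjugate (hG : IsRadialBump G) : IsRadialBump (fun r => conj (G r)) := by
  obtain ⟨a, b, ha, h⟩ := hG.vanish
  exact ⟨(RCLike.conjCLE (K := 𝕜)).contDiff.comp_contDiffOn hG.smooth, a, b, ha,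
    fun r hr h' => by simp [h r hr h']⟩

lemma normSq (hG : IsRadialBump G) : IsRadialBump (fun r => ‖G r‖ ^ 2) := by
  obtain ⟨a, b, ha, h⟩ := hG.vanish
  exact ⟨hG.smooth.norm_sq ℝ, a, b, ha, fun r hr h' => by simp [h r hr h']⟩

lemma deriv (hG : IsRadialBump G) : IsRadialBump (deriv G) := by
  obtain ⟨a, b, ha, h⟩ := hG.vanish
  refine ⟨((contDiffOn_infty_iff_deriv_of_isOpen isOpen_Ioi).1 hG.smooth).2, a, b, ha,
    fun r hr h' => ?_⟩
  have : G =ᶠ[𝓝 r] fun _ => 0 := by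
    have : {x : ℝ | x < a ∨ b < x} ∈ 𝓝 r :=
      ((isOpen_Iio (a := a)).union (isOpen_Ioi (a := b))).mem_nhds h'
    filter_upwards [this, Ioi_mem_nhds hr] with x hx hx0 using h x hx0 hx
  rw [this.deriv_eq, deriv_const]

/-- The bump lives on a compact interval inside `(0, ∞)`, so the factor `c` may be singular at the
origin, as the potential is. -/
lemma integrableOn_mul (hG : IsRadialBump G) {c : ℝ → 𝕜} (hc : ContinuousOn c (Ioi 0)) :
    IntegrableOn (fun r => c r * G r) (Ioi 0) := by
  obtain ⟨a, b, ha, h⟩ := hG.vanish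
  have h1 : IntegrableOn (fun r => c r * G r) (Icc a b) :=
    ((hc.mul hG.continuousOn).mono fun x hx => lt_of_lt_of_le ha hx.1).integrableOn_compact
      isCompact_Icc
  refine h1.of_forall_sdiff_eq_zero measurableSet_Ioi fun r hr => ?_
  rw [h r hr.1, mul_zero]
  by_contra! h'
  exact hr.2 h'

lemma integrableOn (hG : IsRadialBump G) : IntegrableOn G (Ioi 0) := by
  simpa using hG.integrableOn_mul (c := fun _ => 1) continuousOn_const

lemma integral_Ioi_deriv (hG : IsRadialBump G) {x : ℝ} (hx : 0 < x) :
    ∫ r in Ioi x, _root_.deriv G r = - G x := by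
  obtain ⟨a, b, ha, h⟩ := hG.vanish
  have ht : Tendsto G atTop (𝓝 0) := by
    refine tendsto_const_nhds.congr' ?_
    filter_upwards [eventually_gt_atTop b, eventually_gt_atTop 0] with r hr hr0
    exact (h r hr0 (Or.inr hr)).symm
  rw [integral_Ioi_of_hasDerivAt_of_tendsto' (fun y hy => hG.hasDerivAt (lt_of_lt_of_le hx hy))
    (hG.deriv.integrableOn.mono_set (Ioi_subset_Ioi hx.le)) ht, zero_sub]

lemma integral_deriv (hG : IsRadialBump G) : ∫ r in Ioi (0 : ℝ), _root_.deriv G r = 0 := by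
  obtain ⟨a, b, ha, h⟩ := hG.vanish
  obtain ⟨a', b', ha', h'⟩ := hG.deriv.vanish
  -- Nothing is known about `G` at `0` itself, so the half line is cut at a point below both
  -- cutoffs, where `G` vanishes and to the left of which its derivative does.
  set c := min a a' / 2
  have hm : 0 < min a a' := lt_min ha ha'
  have hc : 0 < c := half_pos hm
  have hca : c < min a a' := half_lt_self hm
  rw [← Ioc_union_Ioi_eq_Ioi hc.le, setIntegral_union (Ioc_disjoint_Ioi le_rfl) measurableSet_Ioi
    (hG.deriv.integrableOn.mono_set Ioc_subset_Ioi_self)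
    (hG.deriv.integrableOn.mono_set (Ioi_subset_Ioi hc.le)), hG.integral_Ioi_deriv hc,
    h c hc (Or.inl (hca.trans_le (min_le_left _ _))), setIntegral_eq_zero_of_forall_eq_zero]
  · simp
  · intro r hr
    exact h' r hr.1 (Or.inl (hr.2.trans_lt (hca.trans_le (min_le_right _ _))))

end IsRadialBump

/-! ### Core functions -/

/-- Vanishing off an annulus replaces the support conditions: this form passes directly to radial
profiles and spherical means. -/
lemma isCoreFunction_iff {φ : Euc d → 𝕜} : IsCoreFunction φ ↔ ContDiff ℝ ∞ φ ∧
    ∃ a b : ℝ, 0 < a ∧ ∀ x, ‖x‖ < a ∨ b < ‖x‖ → φ x = 0 := by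
  constructor
  · intro h
    obtain ⟨b, hb⟩ := h.compact.isCompact.isBounded.exists_norm_le
    have h0 : (tsupport φ)ᶜ ∈ 𝓝 (0 : Euc d) := (isClosed_tsupport φ).isOpen_compl.mem_nhds h.away
    obtain ⟨a, ha, hab⟩ := Metric.mem_nhds_iff.1 h0
    refine ⟨h.smooth, a, b, ha, fun x hx => ?_⟩
    rcases hx with hx | hx
    · exact image_eq_zero_of_notMem_tsupport (hab (by simpa using hx))
    · exact image_eq_zero_of_notMem_tsupport fun h' => (hb x h').not_gt hx
  · rintro ⟨hs, a, b, ha, h⟩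
    refine ⟨hs, HasCompactSupport.intro (isCompact_closedBall (0 : Euc d) b) fun x hx =>
      h x (Or.inr (by simpa using hx)), ?_⟩
    rw [notMem_tsupport_iff_eventuallyEq]
    filter_upwards [Metric.ball_mem_nhds (0 : Euc d) ha] with x hx
    exact h x (Or.inl (by simpa using hx))

lemma contDiffOn_of_core_mul {c φ : Euc d → 𝕜} (hc : ContDiffOn ℝ ∞ c {0}ᶜ)
    (hφ : IsCoreFunction φ) : ContDiff ℝ ∞ (fun x => c x * φ x) := by
  obtain ⟨hs, a, b, ha, h⟩ := isCoreFunction_iff.1 hφ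
  rw [contDiff_iff_contDiffAt]
  intro x
  by_cases hx : x = 0
  · subst hx
    have : (fun x => c x * φ x) =ᶠ[𝓝 0] fun _ => 0 := by
      filter_upwards [Metric.ball_mem_nhds (0 : Euc d) ha] with x hx
      rw [h x (Or.inl (by simpa using hx)), mul_zero]
    exact contDiffAt_const.congr_of_eventuallyEq this
  · exact (hc.contDiffAt (isOpen_compl_singleton.mem_nhds hx)).mul hs.contDiffAt

namespace IsCoreFunction

variable {φ ψ : Euc d → 𝕜}

lemma mul_left {c : Euc d → 𝕜} (hφ : IsCoreFunction φ) (hc : ContDiffOn ℝ ∞ c {0}ᶜ) :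
    IsCoreFunction (fun x => c x * φ x) := by
  obtain ⟨hs, a, b, ha, h⟩ := isCoreFunction_iff.1 hφ
  exact isCoreFunction_iff.2 ⟨contDiffOn_of_core_mul hc hφ, a, b, ha,
    fun x hx => by rw [h x hx, mul_zero]⟩

lemma conjugate (hφ : IsCoreFunction φ) : IsCoreFunction (fun x => conj (φ x)) := by
  obtain ⟨hs, a, b, ha, h⟩ := isCoreFunction_iff.1 hφ
  exact isCoreFunction_iff.2 ⟨(RCLike.conjCLE (K := 𝕜)).contDiff.comp hs, a, b, ha,
    fun x hx => by rw [h x hx, map_zero]⟩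

lemma normSq (hφ : IsCoreFunction φ) : IsCoreFunction (fun x => ‖φ x‖ ^ 2) := by
  obtain ⟨hs, a, b, ha, h⟩ := isCoreFunction_iff.1 hφ
  exact isCoreFunction_iff.2 ⟨hs.norm_sq ℝ, a, b, ha,
    fun x hx => by rw [h x hx]; simp⟩

lemma sub (hφ : IsCoreFunction φ) (hψ : IsCoreFunction ψ) : IsCoreFunction (φ - ψ) := by
  obtain ⟨hs, a, b, ha, h⟩ := isCoreFunction_iff.1 hφ
  obtain ⟨hs', a', b', ha', h'⟩ := isCoreFunction_iff.1 hψ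
  refine isCoreFunction_iff.2 ⟨hs.sub hs', min a a', max b b', lt_min ha ha', fun x hx => ?_⟩
  rw [lt_min_iff, max_lt_iff] at hx
  simp only [Pi.sub_apply]
  rw [h x (by tauto), h' x (by tauto), sub_zero]

lemma continuous (hφ : IsCoreFunction φ) : Continuous φ := hφ.smooth.continuous

lemma differentiable (hφ : IsCoreFunction φ) : Differentiable ℝ φ :=
  hφ.smooth.differentiable (by simp)

lemma partialDeriv (hφ : IsCoreFunction φ) (i : Fin d) : IsCoreFunction (partialDeriv i φ) := by
  refine ⟨(hφ.smooth.fderiv_right (m := ∞) (by simp)).clm_apply contDiff_const, ?_, ?_⟩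
  · refine hφ.compact.mono' fun x hx => support_fderiv_subset ℝ fun h => hx ?_
    simp [_root_.partialDeriv, h]
  · have hsub : Function.support (_root_.partialDeriv i φ) ⊆ Function.support (fderiv ℝ φ) :=
      fun x hx h' => hx (by simp [_root_.partialDeriv, h'])
    exact fun h => hφ.away (tsupport_fderiv_subset ℝ (closure_mono hsub h))

lemma integrable_mul (hφ : IsCoreFunction φ) {c : Euc d → 𝕜} (hc : ContinuousOn c {0}ᶜ) :
    Integrable (fun x => c x * φ x) := by
  obtain ⟨hs, a, b, ha, h⟩ := isCoreFunction_iff.1 hφ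
  refine Continuous.integrable_of_hasCompactSupport ?_
    (HasCompactSupport.intro (isCompact_closedBall (0 : Euc d) b) fun x hx => by
      rw [h x (Or.inr (by simpa using hx)), mul_zero])
  rw [continuous_iff_continuousAt]
  intro x
  by_cases hx : x = 0
  · subst hx
    have : (fun x => c x * φ x) =ᶠ[𝓝 0] fun _ => 0 := by
      filter_upwards [Metric.ball_mem_nhds (0 : Euc d) ha] with x hx
      rw [h x (Or.inl (by simpa using hx)), mul_zero]
    exact continuousAt_const.congr this.symm
  · exact (hc.continuousAt (isOpen_compl_singleton.mem_nhds hx)).mul hφ.continuous.continuousAt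

lemma integrable (hφ : IsCoreFunction φ) : Integrable φ :=
  hφ.continuous.integrable_of_hasCompactSupport hφ.compact

end IsCoreFunction

/-! ### Radial functions away from the origin -/

lemma contDiffOn_norm_compl_zero : ContDiffOn ℝ ∞ (fun x : Euc d => ‖x‖) {0}ᶜ :=
  fun _ hx => (contDiffAt_norm ℝ hx).contDiffWithinAt

lemma continuousOn_radial {v : ℝ → ℝ} (hv : ContinuousOn v (Ioi 0)) :
    ContinuousOn (fun x : Euc d => v ‖x‖) {0}ᶜ :=
  hv.comp continuous_norm.continuousOn fun _ hx => norm_pos_iff.2 hx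

lemma contDiffOn_radial {F : Type*} [NormedAddCommGroup F] [NormedSpace ℝ F] {v : ℝ → F}
    (hv : ContDiffOn ℝ ∞ v (Ioi 0)) :
    ContDiffOn ℝ ∞ (fun x : Euc d => v ‖x‖) {0}ᶜ :=
  hv.comp contDiffOn_norm_compl_zero fun _ hx => norm_pos_iff.2 hx

/-- The radial function `x ↦ G |x|`, set to be `0` at the origin. -/
def radialExt (G : ℝ → 𝕜) (x : Euc d) : 𝕜 := if x = 0 then 0 else G ‖x‖

lemma radialExt_of_ne {G : ℝ → 𝕜} {x : Euc d} (hx : x ≠ 0) : radialExt G x = G ‖x‖ := if_neg hx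

lemma radialExt_eventuallyEq {G : ℝ → 𝕜} {x : Euc d} (hx : x ≠ 0) :
    radialExt G =ᶠ[𝓝 x] fun y => G ‖y‖ := by
  filter_upwards [isOpen_compl_singleton.mem_nhds hx] with y hy using radialExt_of_ne hy

lemma IsRadialBump.isCoreFunction {G : ℝ → 𝕜} (hG : IsRadialBump G) :
    IsCoreFunction (radialExt G : Euc d → 𝕜) := by
  obtain ⟨a, b, ha, h⟩ := hG.vanish
  have hv : ∀ x : Euc d, ‖x‖ < a ∨ b < ‖x‖ → radialExt G x = 0 := by
    intro x hx
    by_cases h0 : x = 0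
    · simp [radialExt, h0]
    · rw [radialExt_of_ne h0, h _ (norm_pos_iff.2 h0) hx]
  refine isCoreFunction_iff.2 ⟨?_, a, b, ha, hv⟩
  rw [contDiff_iff_contDiffAt]
  intro x
  by_cases hx : x = 0
  · subst hx
    have : (radialExt G : Euc d → 𝕜) =ᶠ[𝓝 0] fun _ => 0 := by
      filter_upwards [Metric.ball_mem_nhds (0 : Euc d) ha] with x hx
      exact hv x (Or.inl (by simpa using hx))
    exact contDiffAt_const.congr_of_eventuallyEq this
  · exact ((contDiffOn_radial hG.smooth).contDiffAt
      (isOpen_compl_singleton.mem_nhds hx)).congr_of_eventuallyEq (radialExt_eventuallyEq hx)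

/-! ### Spherical means -/

/-- The weighted integral `∫ φ(r θ) q(θ) dσ(θ)` over the unit sphere. -/
def sphMean (φ : Euc d → 𝕜) (q : Euc d → ℝ) (r : ℝ) : 𝕜 :=
  ∫ θ : Metric.sphere (0 : Euc d) 1, φ (r • (θ : Euc d)) * (q θ : 𝕜) ∂(surfaceMeasure d)

lemma integrable_sphere {F : Type*} [NormedAddCommGroup F]
    {g : Metric.sphere (0 : Euc d) 1 → F} (hg : Continuous g) :
    Integrable g (surfaceMeasure d) :=
  hg.integrable_of_hasCompactSupport (HasCompactSupport.of_compactSpace g)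

lemma integrable_sphMean_integrand {φ : Euc d → 𝕜} {q : Euc d → ℝ} (hφ : Continuous φ)
    (hq : Continuous q) (r : ℝ) :
    Integrable (fun θ : Metric.sphere (0 : Euc d) 1 => φ (r • (θ : Euc d)) * (q θ : 𝕜))
      (surfaceMeasure d) :=
  integrable_sphere (by fun_prop)

lemma continuous_coord (i : Fin d) : Continuous fun x : Euc d => x i := by fun_prop

lemma euc_eq_sum (x : Euc d) : x = ∑ i, x i • EuclideanSpace.single i (1 : ℝ) := by
  ext j
  simp [Finset.sum_apply, Pi.single_apply]

lemma fderiv_apply_eq_sum (φ : Euc d → 𝕜) (x y : Euc d) :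
    fderiv ℝ φ x y = ∑ i, (y i : 𝕜) * partialDeriv i φ x := by
  conv_lhs => rw [euc_eq_sum y]
  simp [partialDeriv, map_sum, RCLike.real_smul_eq_coe_mul]

/-- The radial derivative of `φ(rθ)` is `∇φ(rθ) · θ`, and compactness of the sphere permits
differentiation under the integral. The coordinate of `θ` joins the weight, so the derivative is
again a sum of spherical means; this is why general weights `q` are allowed. -/
lemma hasDerivAt_sphMean {φ : Euc d → 𝕜} (hφ : ContDiff ℝ 1 φ) {q : Euc d → ℝ}
    (hq : Continuous q) (r : ℝ) :
    HasDerivAt (sphMean φ q) (∑ i, sphMean (partialDeriv i φ) (fun x => x i * q x) r) r := by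
  have hφ' : Continuous (fderiv ℝ φ) := hφ.continuous_fderiv (by simp)
  let F' : ℝ → Metric.sphere (0 : Euc d) 1 → 𝕜 := fun t θ =>
    fderiv ℝ φ (t • (θ : Euc d)) θ * (q θ : 𝕜)
  have hF'c : Continuous fun p : ℝ × Metric.sphere (0 : Euc d) 1 => F' p.1 p.2 := by
    have h1 : Continuous fun p : ℝ × Metric.sphere (0 : Euc d) 1 =>
      fderiv ℝ φ (p.1 • (p.2 : Euc d)) (p.2 : Euc d) := by
      apply Continuous.clm_apply <;> fun_prop
    exact h1.mul (by fun_prop)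
  obtain ⟨C, hC⟩ := ((isCompact_Icc (a := r - 1) (b := r + 1)).prod
    (isCompact_univ (X := Metric.sphere (0 : Euc d) 1))).exists_bound_of_continuousOn
    hF'c.continuousOn
  have key := hasDerivAt_integral_of_dominated_loc_of_deriv_le (μ := surfaceMeasure d)
    (F := fun (t : ℝ) (θ : Metric.sphere (0 : Euc d) 1) => φ (t • (θ : Euc d)) * (q θ : 𝕜))
    (F' := F') (x₀ := r) (s := Icc (r - 1) (r + 1)) (bound := fun _ => C)
    (Icc_mem_nhds (by linarith) (by linarith))
    (Eventually.of_forall fun t =>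
      (integrable_sphMean_integrand hφ.continuous hq t).aestronglyMeasurable)
    (integrable_sphMean_integrand hφ.continuous hq r)
    (integrable_sphere (hF'c.comp (by fun_prop : Continuous fun θ => (r, θ)))).aestronglyMeasurable
    (Eventually.of_forall fun θ t ht => hC (t, θ) ⟨ht, mem_univ _⟩)
    (integrable_const C)
    (Eventually.of_forall fun θ t ht => by
      have h1 : HasDerivAt (fun t : ℝ => t • (θ : Euc d)) (θ : Euc d) t := by
        simpa using (hasDerivAt_id t).smul_const (θ : Euc d)
      have h2 := ((hφ.differentiable (by simp)) (t • (θ : Euc d))).hasFDerivAt.comp_hasDerivAt t h1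
      exact h2.mul_const (q θ : 𝕜))
  suffices hsum : ∑ i, sphMean (partialDeriv i φ) (fun x => x i * q x) r =
      ∫ θ, F' r θ ∂(surfaceMeasure d) by
    rw [hsum]
    exact key.2
  simp only [F', sphMean]
  rw [← integral_finsetSum]
  · refine integral_congr_ae (Eventually.of_forall fun θ => ?_)
    simp only [fderiv_apply_eq_sum, Finset.sum_mul, RCLike.ofReal_mul]
    exact Finset.sum_congr rfl fun i _ => by ring
  · intro i _
    have h3 : Continuous (partialDeriv i φ) := by
      unfold partialDeriv
      exact hφ'.clm_apply continuous_const
    exact integrable_sphMean_integrand h3 ((continuous_coord i).mul hq) r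

lemma deriv_sphMean {φ : Euc d → 𝕜} (hφ : ContDiff ℝ 1 φ) {q : Euc d → ℝ}
    (hq : Continuous q) :
    deriv (sphMean φ q) = fun r => ∑ i, sphMean (partialDeriv i φ) (fun x => x i * q x) r :=
  funext fun r => (hasDerivAt_sphMean hφ hq r).deriv

lemma contDiff_partialDeriv {φ : Euc d → 𝕜} (hφ : ContDiff ℝ ∞ φ) (i : Fin d) :
    ContDiff ℝ ∞ (partialDeriv i φ) :=
  (hφ.fderiv_right (m := ∞) (by simp)).clm_apply contDiff_const

/-- Spherical means with continuous weights are closed under differentiation, hence an induction on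
the order in which both the function and the weight vary. -/
lemma contDiff_sphMean {φ : Euc d → 𝕜} (hφ : ContDiff ℝ ∞ φ) {q : Euc d → ℝ}
    (hq : Continuous q) : ContDiff ℝ ∞ (sphMean φ q) := by
  rw [contDiff_infty]
  intro n
  have hd : ∀ {φ : Euc d → 𝕜} (_ : ContDiff ℝ ∞ φ) {q : Euc d → ℝ} (_ : Continuous q),
      Differentiable ℝ (sphMean φ q) := fun hφ _ hq r =>
    (hasDerivAt_sphMean (hφ.of_le (by exact_mod_cast le_top)) hq r).differentiableAt
  induction n generalizing φ q with
  | zero => exact contDiff_zero.2 (hd hφ hq).continuous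
  | succ n ih =>
    rw [Nat.cast_add, Nat.cast_one, contDiff_succ_iff_deriv]
    refine ⟨hd hφ hq, by simp, ?_⟩
    rw [deriv_sphMean (hφ.of_le (by exact_mod_cast le_top)) hq]
    exact ContDiff.sum fun i _ => ih (contDiff_partialDeriv hφ i) ((continuous_coord i).mul hq)

lemma norm_smul_sphere {r : ℝ} (hr : 0 < r) (θ : Metric.sphere (0 : Euc d) 1) :
    ‖r • (θ : Euc d)‖ = r := by
  rw [norm_smul, Real.norm_of_nonneg hr.le, norm_eq_of_mem_sphere θ, mul_one]

lemma smul_sphere_ne_zero {r : ℝ} (hr : 0 < r) (θ : Metric.sphere (0 : Euc d) 1) :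
    r • (θ : Euc d) ≠ 0 := by
  rw [← norm_pos_iff, norm_smul_sphere hr]; exact hr

lemma IsCoreFunction.isRadialBump_sphMean {φ : Euc d → 𝕜} (hφ : IsCoreFunction φ)
    {q : Euc d → ℝ} (hq : Continuous q) : IsRadialBump (sphMean φ q) := by
  obtain ⟨hs, a, b, ha, h⟩ := isCoreFunction_iff.1 hφ
  refine ⟨(contDiff_sphMean hs hq).contDiffOn, a, b, ha, fun r hr hr' => ?_⟩
  simp only [sphMean]
  rw [integral_eq_zero_of_ae]
  refine Eventually.of_forall fun θ => ?_
  simp only [Pi.zero_apply]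
  rw [h _ (by rwa [norm_smul_sphere hr]), zero_mul]

lemma IsCoreFunction.deriv_sphMean {φ : Euc d → 𝕜} (hφ : IsCoreFunction φ)
    {q : Euc d → ℝ} (hq : Continuous q) (r : ℝ) :
    deriv (sphMean φ q) r = ∑ i, sphMean (_root_.partialDeriv i φ) (fun x => x i * q x) r := by
  rw [_root_.deriv_sphMean (hφ.smooth.of_le (by exact_mod_cast le_top)) hq]

lemma sphMean_sub {φ ψ : Euc d → 𝕜} (hφ : Continuous φ) (hψ : Continuous ψ) {q : Euc d → ℝ}
    (hq : Continuous q) (r : ℝ) : sphMean (φ - ψ) q r = sphMean φ q r - sphMean ψ q r := by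
  simp only [sphMean]
  rw [← integral_sub (integrable_sphMean_integrand hφ hq r)
    (integrable_sphMean_integrand hψ hq r)]
  simp only [Pi.sub_apply, sub_mul]

/-- Integration in polar coordinates. -/
lemma integral_polar {F : Type*} [NormedAddCommGroup F] [NormedSpace ℝ F]
    {f : Euc d → F} (hf : Integrable f) (hd : 1 ≤ d) :
    ∫ x, f x = ∫ r in Ioi (0 : ℝ),
      r ^ (d - 1) • ∫ θ : Metric.sphere (0 : Euc d) 1, f (r • (θ : Euc d)) ∂(surfaceMeasure d) := by
  have : Nonempty (Fin d) := ⟨⟨0, hd⟩⟩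
  have hmp := (volume : Measure (Euc d)).measurePreserving_homeomorphUnitSphereProd
  have hemb := (homeomorphUnitSphereProd (Euc d)).measurableEmbedding
  have hsymm : ∀ x : ({0}ᶜ : Set (Euc d)), f x =
      (fun p : Metric.sphere (0 : Euc d) 1 × Ioi (0 : ℝ) => f (p.2.1 • (p.1 : Euc d)))
        (homeomorphUnitSphereProd (Euc d) x) := by
    intro x
    have hx : ‖(x : Euc d)‖ ≠ 0 := norm_ne_zero_iff.2 x.2
    simp [smul_smul, hx]
  have hint : Integrable (fun x : ({0}ᶜ : Set (Euc d)) => f x)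
      ((volume : Measure (Euc d)).comap (↑)) := by
    exact (integrableOn_iff_comap_subtypeVal (measurableSet_singleton (0 : Euc d)).compl).1 hf.integrableOn
  have hint2 : Integrable (fun p : Metric.sphere (0 : Euc d) 1 × Ioi (0 : ℝ) =>
      f (p.2.1 • (p.1 : Euc d)))
      ((surfaceMeasure d).prod (Measure.volumeIoiPow (Module.finrank ℝ (Euc d) - 1))) := by
    rw [← hmp.integrable_comp_emb hemb]
    exact hint.congr (Eventually.of_forall hsymm)
  calc ∫ x, f x = ∫ x : ({0}ᶜ : Set (Euc d)), f x
        ∂((volume : Measure (Euc d)).comap (↑)) := by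
        rw [integral_subtype_comap (measurableSet_singleton _).compl f, restrict_compl_singleton]
    _ = ∫ p : Metric.sphere (0 : Euc d) 1 × Ioi (0 : ℝ), f (p.2.1 • (p.1 : Euc d))
        ∂((surfaceMeasure d).prod (Measure.volumeIoiPow (Module.finrank ℝ (Euc d) - 1))) := by
        rw [← hmp.integral_comp hemb]
        exact integral_congr_ae (Eventually.of_forall hsymm)
    _ = ∫ r : Ioi (0 : ℝ), (∫ θ : Metric.sphere (0 : Euc d) 1, f (r.1 • (θ : Euc d))
          ∂(surfaceMeasure d)) ∂(Measure.volumeIoiPow (d - 1)) := by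
        rw [integral_prod_symm _ hint2]
        simp
    _ = _ := by
        simp only [Measure.volumeIoiPow, ENNReal.ofReal]
        rw [integral_withDensity_eq_integral_smul,
          integral_subtype_comap measurableSet_Ioi fun r : ℝ => Real.toNNReal (r ^ (d - 1)) •
            ∫ θ : Metric.sphere (0 : Euc d) 1, f (r • (θ : Euc d)) ∂(surfaceMeasure d)]
        · refine setIntegral_congr_fun measurableSet_Ioi fun r hr => ?_
          simp only [NNReal.smul_def, Real.coe_toNNReal _ (pow_nonneg (mem_Ioi.1 hr).le _)]
        · exact (measurable_subtype_coe.pow_const _).real_toNNReal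

/-! ### Polynomial functions -/

/-- The function on `ℝ^d` defined by a real polynomial. -/
def polyFun (p : MvPolynomial (Fin d) ℝ) (x : Euc d) : ℝ := MvPolynomial.eval (fun i => x i) p

lemma polyFun_C (a : ℝ) : polyFun (MvPolynomial.C a : MvPolynomial (Fin d) ℝ) = fun _ => a := by
  ext; simp [polyFun]

lemma polyFun_add (p q : MvPolynomial (Fin d) ℝ) :
    polyFun (p + q) = fun x => polyFun p x + polyFun q x := by
  ext; simp [polyFun]

lemma polyFun_mul (p q : MvPolynomial (Fin d) ℝ) :
    polyFun (p * q) = fun x => polyFun p x * polyFun q x := by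
  ext; simp [polyFun]

lemma polyFun_X (j : Fin d) : polyFun (MvPolynomial.X j) = fun x : Euc d => x j := by
  ext; simp [polyFun]

lemma contDiff_coord (j : Fin d) : ContDiff ℝ ∞ fun x : Euc d => x j :=
  (EuclideanSpace.proj j : Euc d →L[ℝ] ℝ).contDiff

lemma contDiff_polyFun (p : MvPolynomial (Fin d) ℝ) : ContDiff ℝ ∞ (polyFun p) := by
  induction p using MvPolynomial.induction_on with
  | C a => rw [polyFun_C]; exact contDiff_const
  | add p q hp hq => rw [polyFun_add]; exact hp.add hq
  | mul_X p j hp =>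
    rw [polyFun_mul, polyFun_X]
    exact hp.mul (contDiff_coord j)

lemma continuous_polyFun (p : MvPolynomial (Fin d) ℝ) : Continuous (polyFun p) :=
  (contDiff_polyFun p).continuous

lemma differentiable_polyFun (p : MvPolynomial (Fin d) ℝ) : Differentiable ℝ (polyFun p) :=
  (contDiff_polyFun p).differentiable (by simp)

lemma fderiv_polyFun (p : MvPolynomial (Fin d) ℝ) (x : Euc d) (i : Fin d) :
    fderiv ℝ (polyFun p) x (EuclideanSpace.single i 1) = polyFun (MvPolynomial.pderiv i p) x := by
  induction p using MvPolynomial.induction_on with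
  | C a => rw [polyFun_C]; simp [polyFun]
  | add p q hp hq =>
    rw [polyFun_add, fderiv_fun_add (differentiable_polyFun p x) (differentiable_polyFun q x),
      map_add, polyFun_add]
    simp [hp, hq]
  | mul_X p j hp =>
    have hj : fderiv ℝ (fun x : Euc d => x j) x = EuclideanSpace.proj j :=
      (EuclideanSpace.proj j : Euc d →L[ℝ] ℝ).fderiv
    rw [polyFun_mul, polyFun_X, fderiv_fun_mul (differentiable_polyFun p x)
      ((contDiff_coord j).differentiable (by simp) x), hj, Derivation.leibniz, polyFun_add]
    simp only [add_apply, smul_apply, smul_eq_mul,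
      polyFun_mul, polyFun_X, hp, MvPolynomial.pderiv_X]
    by_cases hij : i = j
    · subst hij; simp [polyFun]
    · simp [polyFun, Ne.symm hij]

lemma polyFun_smul {p : MvPolynomial (Fin d) ℝ} {n : ℕ} (hp : p.IsHomogeneous n) (r : ℝ)
    (x : Euc d) : polyFun p (r • x) = r ^ n * polyFun p x := by
  simp only [polyFun, PiLp.smul_apply, smul_eq_mul]
  rw [MvPolynomial.eval_eq, MvPolynomial.eval_eq, Finset.mul_sum]
  refine Finset.sum_congr rfl fun m hm => ?_
  have h : m.degree = n := by
    rw [Finsupp.degree_eq_weight_one]; exact hp (MvPolynomial.mem_support_iff.1 hm)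
  simp_rw [mul_pow, Finset.prod_mul_distrib, Finset.prod_pow_eq_pow_sum]
  rw [← h, Finsupp.degree_apply]
  ring

lemma polyFun_euler {p : MvPolynomial (Fin d) ℝ} {n : ℕ} (hp : p.IsHomogeneous n) (x : Euc d) :
    ∑ i, x i * polyFun (MvPolynomial.pderiv i p) x = n * polyFun p x := by
  have := congrArg (fun q => polyFun q x) hp.sum_X_mul_pderiv
  simpa [polyFun] using this

/-- The Laplacian on polynomials. -/
def polyLaplacian : MvPolynomial (Fin d) ℝ →ₗ[ℝ] MvPolynomial (Fin d) ℝ :=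
  ∑ i, (MvPolynomial.pderiv i).toLinearMap ∘ₗ (MvPolynomial.pderiv i).toLinearMap

lemma polyLaplacian_apply (p : MvPolynomial (Fin d) ℝ) :
    polyLaplacian p = ∑ i, MvPolynomial.pderiv i (MvPolynomial.pderiv i p) := by
  simp [polyLaplacian]

/-- Homogeneous harmonic polynomials of degree `n`. -/
structure IsHarmonicPoly (n : ℕ) (h : MvPolynomial (Fin d) ℝ) : Prop where
  homogeneous : h.IsHomogeneous n
  laplacian_eq_zero : polyLaplacian h = 0

/-! ### Pairing with radial multiples of harmonic polynomials -/

lemma partialDeriv_mul {φ ψ : Euc d → 𝕜} {x : Euc d} (hφ : DifferentiableAt ℝ φ x)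
    (hψ : DifferentiableAt ℝ ψ x) (i : Fin d) :
    partialDeriv i (fun y => φ y * ψ y) x =
      φ x * partialDeriv i ψ x + partialDeriv i φ x * ψ x := by
  simp only [partialDeriv]
  rw [fderiv_fun_mul hφ hψ]
  simp [mul_comm]

lemma partialDeriv_polyFun (p : MvPolynomial (Fin d) ℝ) (x : Euc d) (i : Fin d) :
    partialDeriv i (fun y => (polyFun p y : 𝕜)) x = polyFun (MvPolynomial.pderiv i p) x := by
  simp only [partialDeriv]
  have h := ((RCLike.ofRealCLM (K := 𝕜)).hasFDerivAt (x := polyFun p x)).comp x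
    (differentiable_polyFun p x).hasFDerivAt
  rw [show (fun y => (polyFun p y : 𝕜)) = (RCLike.ofRealCLM (K := 𝕜)) ∘ polyFun p from rfl,
    h.fderiv]
  simp [fderiv_polyFun]

lemma contDiff_ofReal_polyFun (p : MvPolynomial (Fin d) ℝ) :
    ContDiff ℝ ∞ (fun x => (polyFun p x : 𝕜)) :=
  (RCLike.ofRealCLM (K := 𝕜)).contDiff.comp (contDiff_polyFun p)

lemma hasFDerivAt_norm_of_ne {x : Euc d} (hx : x ≠ 0) :
    HasFDerivAt (fun y : Euc d => ‖y‖) (‖x‖⁻¹ • innerSL ℝ x) x := by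
  have h := (hasStrictFDerivAt_norm_sq x).hasFDerivAt.sqrt (by simpa using hx)
  simp only [Real.sqrt_sq (norm_nonneg _)] at h
  refine h.congr_fderiv ?_
  rw [← Nat.cast_smul_eq_nsmul ℝ, smul_smul]
  congr 1
  field_simp
  simp

/-- Off the origin this is the chain rule with `∇|x| = x/|x|`; at the origin both sides vanish, the
left one because the extension is zero nearby. -/
lemma partialDeriv_radialExt {G : ℝ → 𝕜} (hG : IsRadialBump G) (i : Fin d) (x : Euc d) :
    partialDeriv i (radialExt G) x =
      (x i : 𝕜) * radialExt (fun r => ((r⁻¹ : ℝ) : 𝕜) * deriv G r) x := by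
  by_cases hx : x = 0
  · subst hx
    obtain ⟨hs, a, b, ha, h⟩ := isCoreFunction_iff.1 (hG.isCoreFunction.partialDeriv (d := d) i)
    rw [h 0 (Or.inl (by simpa using ha))]
    simp
  · rw [radialExt_of_ne hx]
    have hn := hasFDerivAt_norm_of_ne hx
    have h2 := (hG.hasDerivAt (norm_pos_iff.2 hx)).hasFDerivAt.comp x hn
    rw [partialDeriv, (radialExt_eventuallyEq hx).fderiv_eq,
      show (fun y : Euc d => G ‖y‖) = G ∘ (fun y => ‖y‖) from rfl, h2.fderiv]
    have hin : inner ℝ x (EuclideanSpace.single i (1 : ℝ)) = x i := by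
      simp [EuclideanSpace.inner_single_right]
    simp [RCLike.real_smul_eq_coe_mul, hin]
    ring

lemma contDiffOn_inv_Ioi : ContDiffOn ℝ ∞ (fun r : ℝ => r⁻¹) (Ioi 0) :=
  contDiffOn_id.inv fun _ hx => (mem_Ioi.1 hx).ne'

lemma IsRadialBump.deriv_div {G : ℝ → 𝕜} (hG : IsRadialBump G) :
    IsRadialBump (fun r => ((r⁻¹ : ℝ) : 𝕜) * _root_.deriv G r) :=
  hG.deriv.ofReal_mul contDiffOn_inv_Ioi

lemma IsCoreFunction.mul_polyFun {φ : Euc d → 𝕜} (hφ : IsCoreFunction φ)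
    (p : MvPolynomial (Fin d) ℝ) : IsCoreFunction (fun x => φ x * (polyFun p x : 𝕜)) := by
  simpa only [mul_comm] using hφ.mul_left (contDiff_ofReal_polyFun (𝕜 := 𝕜) p).contDiffOn

/-- Integration by parts against the gradient of a harmonic polynomial. -/
lemma integral_gradient_harmonic {φ : Euc d → 𝕜} (hφ : ContDiff ℝ ∞ φ) {G : ℝ → 𝕜}
    (hG : IsRadialBump G) {n : ℕ} {h : MvPolynomial (Fin d) ℝ} (hh : IsHarmonicPoly n h) :
    ∫ x, ∑ i, partialDeriv i φ x * (radialExt G x * (polyFun (MvPolynomial.pderiv i h) x : 𝕜)) =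
      - ∫ x, φ x * (radialExt (fun r => ((r⁻¹ : ℝ) : 𝕜) * deriv G r) x *
        (n * (polyFun h x : 𝕜))) := by
  set R : ℝ → 𝕜 := fun r => ((r⁻¹ : ℝ) : 𝕜) * deriv G r
  have hg : ∀ i, IsCoreFunction
      (fun x => radialExt G x * (polyFun (MvPolynomial.pderiv i h) x : 𝕜)) :=
    fun i => hG.isCoreFunction.mul_polyFun _
  have hφi : ∀ i, Continuous (partialDeriv i φ) := fun i => (contDiff_partialDeriv hφ i).continuous
  have hint : ∀ i, Integrable (fun x => partialDeriv i φ x *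
      (radialExt G x * (polyFun (MvPolynomial.pderiv i h) x : 𝕜))) :=
    fun i => (hg i).integrable_mul (hφi i).continuousOn
  have hint2 : ∀ i, Integrable (fun x => φ x * partialDeriv i
      (fun x => radialExt G x * (polyFun (MvPolynomial.pderiv i h) x : 𝕜)) x) :=
    fun i => ((hg i).partialDeriv i).integrable_mul hφ.continuous.continuousOn
  rw [integral_finsetSum _ fun i _ => hint i]
  have step : ∀ i, ∫ x, partialDeriv i φ x *
      (radialExt G x * (polyFun (MvPolynomial.pderiv i h) x : 𝕜)) =
      - ∫ x, φ x * partialDeriv i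
        (fun x => radialExt G x * (polyFun (MvPolynomial.pderiv i h) x : 𝕜)) x := by
    intro i
    rw [eq_neg_iff_add_eq_zero, add_comm, ← eq_neg_iff_add_eq_zero]
    exact integral_mul_fderiv_eq_neg_fderiv_mul_of_integrable (hint i) (hint2 i)
      ((hg i).integrable_mul hφ.continuous.continuousOn)
      (fun x _ => hφ.differentiable (by simp) x) (fun x _ => (hg i).differentiable x)
  simp_rw [step]
  rw [Finset.sum_neg_distrib, ← integral_finsetSum _ fun i _ => hint2 i]
  congr 1
  refine integral_congr_ae (Eventually.of_forall fun x => ?_)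
  simp only
  rw [← Finset.mul_sum]
  congr 1
  -- Summed over `i`, this gives `div(G∇h) = G Δh + (G'/r) x·∇h`: the first term vanishes by
  -- harmonicity, the second is `n (G'/r) h` by Euler's identity.
  have hterm : ∀ i, partialDeriv i
      (fun x => radialExt G x * (polyFun (MvPolynomial.pderiv i h) x : 𝕜)) x =
      radialExt G x * ((polyFun (MvPolynomial.pderiv i (MvPolynomial.pderiv i h)) x : ℝ) : 𝕜) +
      radialExt R x * ((x i * polyFun (MvPolynomial.pderiv i h) x : ℝ) : 𝕜) := by
    intro i
    rw [partialDeriv_mul (hG.isCoreFunction.differentiable x)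
      ((contDiff_ofReal_polyFun _).differentiable (by simp) x), partialDeriv_polyFun,
      partialDeriv_radialExt hG]
    simp only [R, RCLike.ofReal_mul]
    ring
  have hlap : ∑ i, polyFun (MvPolynomial.pderiv i (MvPolynomial.pderiv i h)) x = 0 := by
    have := congrArg (fun q => polyFun q x) hh.laplacian_eq_zero
    rw [polyLaplacian_apply] at this
    simpa [polyFun] using this
  simp_rw [hterm]
  rw [Finset.sum_add_distrib, ← Finset.mul_sum, ← Finset.mul_sum, ← RCLike.ofReal_sum,
    ← RCLike.ofReal_sum, hlap, polyFun_euler hh.homogeneous]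
  simp

/-- Polar coordinates for the product of a radial function, a function and a homogeneous
polynomial. -/
lemma integral_radial_mul_polyFun (hd : 1 ≤ d) {R : ℝ → 𝕜} {χ : Euc d → 𝕜} {n : ℕ}
    {h : MvPolynomial (Fin d) ℝ} (hh : h.IsHomogeneous n)
    (hint : Integrable fun x => R ‖x‖ * (χ x * (polyFun h x : 𝕜))) :
    ∫ x, R ‖x‖ * (χ x * (polyFun h x : 𝕜)) =
      ∫ r in Ioi (0 : ℝ), ((r ^ (d - 1 + n) : ℝ) : 𝕜) * (R r * sphMean χ (polyFun h) r) := by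
  rw [integral_polar hint hd]
  refine setIntegral_congr_fun measurableSet_Ioi fun r hr => ?_
  simp only [norm_smul_sphere (mem_Ioi.1 hr), polyFun_smul hh, sphMean]
  rw [RCLike.real_smul_eq_coe_mul, ← integral_const_mul, ← integral_const_mul,
    ← integral_const_mul]
  refine integral_congr_ae (Eventually.of_forall fun θ => ?_)
  simp only
  push_cast
  ring

/-- The function `x ↦ G |x| h(x)`. -/
def harmMul (G : ℝ → 𝕜) (h : MvPolynomial (Fin d) ℝ) (x : Euc d) : 𝕜 :=
  radialExt G x * (polyFun h x : 𝕜)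

lemma IsRadialBump.isCoreFunction_harmMul {G : ℝ → 𝕜} (hG : IsRadialBump G)
    (h : MvPolynomial (Fin d) ℝ) : IsCoreFunction (harmMul G h) :=
  hG.isCoreFunction.mul_polyFun h

/-- The radial coefficient `r ^ (-n) ∫ φ(r θ) h(θ) dσ(θ)`. -/
def radCoeff (n : ℕ) (h : MvPolynomial (Fin d) ℝ) (φ : Euc d → 𝕜) (r : ℝ) : 𝕜 :=
  ((r⁻¹ ^ n : ℝ) : 𝕜) * sphMean φ (polyFun h) r

lemma IsCoreFunction.isRadialBump_radCoeff {φ : Euc d → 𝕜} (hφ : IsCoreFunction φ) (n : ℕ)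
    (h : MvPolynomial (Fin d) ℝ) : IsRadialBump (radCoeff n h φ) :=
  (hφ.isRadialBump_sphMean (continuous_polyFun h)).ofReal_mul (contDiffOn_inv_Ioi.pow n)

lemma IsRadialBump.deriv_conjugate (G : ℝ → 𝕜) (r : ℝ) :
    _root_.deriv (fun t => conj (G t)) r = conj (_root_.deriv G r) :=
  deriv.star

lemma conj_radialExt (G : ℝ → 𝕜) (x : Euc d) :
    conj (radialExt G x) = radialExt (fun t => conj (G t)) x := by
  simp only [radialExt]
  split_ifs <;> simp

/-- Conjugation of `d/dr` by `r ^ (-n)` produces `d/dr - n/r`, the operator that the gradient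
pairing yields on spherical means. -/
lemma deriv_radCoeff {φ : Euc d → 𝕜} (hφ : IsCoreFunction φ) (n : ℕ)
    (h : MvPolynomial (Fin d) ℝ) {r : ℝ} (hr : 0 < r) :
    deriv (radCoeff n h φ) r = ((r⁻¹ ^ n : ℝ) : 𝕜) *
      (deriv (sphMean φ (polyFun h)) r - ((n * r⁻¹ : ℝ) : 𝕜) * sphMean φ (polyFun h) r) := by
  have h1 : HasDerivAt (fun t : ℝ => t⁻¹ ^ n) (-(n * r⁻¹ * r⁻¹ ^ n)) r := by
    have := (hasDerivAt_inv hr.ne').pow n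
    refine this.congr_deriv ?_
    rcases n with _ | n
    · simp
    · simp only [Nat.add_sub_cancel, pow_succ]
      field_simp
  have h2 := (RCLike.ofRealCLM (K := 𝕜)).hasFDerivAt.comp_hasDerivAt r h1
  have h3 := (hφ.isRadialBump_sphMean (continuous_polyFun h)).hasDerivAt hr
  have h4 : HasDerivAt (radCoeff n h φ) _ r := h2.mul h3
  rw [h4.deriv]
  simp only [RCLike.ofRealCLM_apply]
  push_cast
  simp only [Function.comp_apply]
  push_cast
  ring

/-- The gradient pairing with `G(|x|) h(x)`, `h` harmonic, is a one-dimensional pairing. -/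
lemma integral_gradient_harmMul (hd : 1 ≤ d) {φ : Euc d → 𝕜} (hφ : IsCoreFunction φ) {G : ℝ → 𝕜}
    (hG : IsRadialBump G) {n : ℕ} {h : MvPolynomial (Fin d) ℝ} (hh : IsHarmonicPoly n h) :
    ∫ x, ∑ i, partialDeriv i φ x * conj (partialDeriv i (harmMul G h) x) =
      ∫ r in Ioi (0 : ℝ), ((r ^ (d - 1 + 2 * n) : ℝ) : 𝕜) *
        (deriv (radCoeff n h φ) r * conj (deriv G r)) := by
  have hG' := hG.conjugate
  set R : ℝ → 𝕜 := fun r => ((r⁻¹ : ℝ) : 𝕜) * deriv (fun t => conj (G t)) r with hR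
  have hR0 : ∀ x : Euc d, radialExt R x = R ‖x‖ := by
    intro x
    by_cases hx : x = 0
    · simp [radialExt, hx, hR]
    · exact radialExt_of_ne hx
  have hRb : IsRadialBump R := hG'.deriv_div
  have hRc : IsCoreFunction (radialExt R : Euc d → 𝕜) := hRb.isCoreFunction
  have hpt : ∀ x, ∑ i, partialDeriv i φ x * conj (partialDeriv i (harmMul G h) x) =
      radialExt R x * ((∑ i, (x i : 𝕜) * partialDeriv i φ x) * (polyFun h x : 𝕜)) +
      ∑ i, partialDeriv i φ x * (radialExt (fun t => conj (G t)) x *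
        (polyFun (MvPolynomial.pderiv i h) x : 𝕜)) := by
    intro x
    rw [Finset.sum_mul, Finset.mul_sum, ← Finset.sum_add_distrib]
    refine Finset.sum_congr rfl fun i _ => ?_
    have : partialDeriv i (harmMul G h) x = radialExt G x *
        (polyFun (MvPolynomial.pderiv i h) x : 𝕜) + (x i : 𝕜) *
        radialExt (fun r => ((r⁻¹ : ℝ) : 𝕜) * deriv G r) x * (polyFun h x : 𝕜) := by
      unfold harmMul
      rw [partialDeriv_mul (hG.isCoreFunction.differentiable x)
        ((contDiff_ofReal_polyFun _).differentiable (by simp) x), partialDeriv_polyFun,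
        partialDeriv_radialExt hG]
    rw [this]
    simp only [map_add, map_mul, conj_radialExt, RCLike.conj_ofReal, hR,
      IsRadialBump.deriv_conjugate]
    ring
  have hχ : Continuous fun x : Euc d => ∑ i, (x i : 𝕜) * partialDeriv i φ x :=
    continuous_finsetSum _ fun i _ => (RCLike.continuous_ofReal.comp (continuous_coord i)).mul
      (hφ.partialDeriv i).continuous
  have hpc : Continuous fun x => (polyFun h x : 𝕜) := (contDiff_ofReal_polyFun h).continuous
  have hi1 : Integrable fun x => radialExt R x *
      ((∑ i, (x i : 𝕜) * partialDeriv i φ x) * (polyFun h x : 𝕜)) := by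
    refine (hRc.integrable_mul (hχ.mul hpc).continuousOn).congr (Eventually.of_forall fun x => ?_)
    simp only [Pi.mul_apply]
    ring
  have hi2 : Integrable fun x => ∑ i, partialDeriv i φ x * (radialExt (fun t => conj (G t)) x *
        (polyFun (MvPolynomial.pderiv i h) x : 𝕜)) :=
    integrable_finsetSum _ fun i _ => (hG'.isCoreFunction.mul_polyFun _).integrable_mul
      (hφ.partialDeriv i).continuous.continuousOn
  have hi3 : Integrable fun x => φ x * (radialExt R x * (n * (polyFun h x : 𝕜))) := by
    have := hRc.integrable_mul (c := fun x => φ x * (n * (polyFun h x : 𝕜)))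
      (hφ.continuous.mul (continuous_const.mul hpc)).continuousOn
    refine this.congr (Eventually.of_forall fun x => ?_)
    simp only
    ring
  simp_rw [hpt]
  rw [integral_add hi1 hi2, integral_gradient_harmonic hφ.smooth hG' hh, ← sub_eq_add_neg,
    ← integral_sub hi1 hi3]
  have hcomb : ∀ x, radialExt R x * ((∑ i, (x i : 𝕜) * partialDeriv i φ x) * (polyFun h x : 𝕜)) -
      φ x * (radialExt R x * (n * (polyFun h x : 𝕜))) =
      R ‖x‖ * (((∑ i, (x i : 𝕜) * partialDeriv i φ x) - n * φ x) * (polyFun h x : 𝕜)) := by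
    intro x
    rw [hR0]
    ring
  have hi4 := hi1.sub hi3
  simp only [Pi.sub_def, hcomb] at hi4 ⊢
  rw [integral_radial_mul_polyFun hd hh.homogeneous hi4]
  refine setIntegral_congr_fun measurableSet_Ioi fun r hr => ?_
  have hr : 0 < r := hr
  -- On spherical means the Euler field `x·∇` acts as `r d/dr`, so `x·∇ - n` becomes `r ^ (n+1)`
  -- times the derivative of the radial coefficient.
  have hs : sphMean (fun x : Euc d => (∑ i, (x i : 𝕜) * partialDeriv i φ x) - n * φ x)
      (polyFun h) r = (r : 𝕜) * deriv (sphMean φ (polyFun h)) r -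
        n * sphMean φ (polyFun h) r := by
    have hint : ∀ i, Integrable (fun θ : Metric.sphere (0 : Euc d) 1 =>
        partialDeriv i φ (r • (θ : Euc d)) * (((θ : Euc d) i * polyFun h θ : ℝ) : 𝕜))
        (surfaceMeasure d) := fun i =>
      integrable_sphMean_integrand (hφ.partialDeriv i).continuous
        ((continuous_coord i).mul (continuous_polyFun h)) r
    rw [hφ.deriv_sphMean (continuous_polyFun h)]
    simp only [sphMean]
    rw [← integral_finsetSum _ fun i _ => hint i, ← integral_const_mul, ← integral_const_mul,
      ← integral_sub ((integrable_finsetSum _ fun i _ => hint i).const_mul _)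
        ((integrable_sphMean_integrand hφ.continuous (continuous_polyFun h) r).const_mul _)]
    refine integral_congr_ae (Eventually.of_forall fun θ => ?_)
    simp only [PiLp.smul_apply, smul_eq_mul, sub_mul, Finset.sum_mul, Finset.mul_sum]
    congr 1
    · refine Finset.sum_congr rfl fun i _ => ?_
      push_cast
      ring
    · ring
  simp only [hs, hR, deriv_radCoeff hφ n h hr, IsRadialBump.deriv_conjugate]
  have hr' : (r : 𝕜) ≠ 0 := by exact_mod_cast hr.ne'
  push_cast
  rw [pow_add, pow_add _ _ (2 * n), two_mul, pow_add, inv_pow]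
  field_simp

lemma integral_potential_harmMul (hd : 1 ≤ d) {v : ℝ → ℝ} (hv : ContinuousOn v (Ioi 0))
    {φ : Euc d → 𝕜} (hφ : IsCoreFunction φ) {G : ℝ → 𝕜}
    (hG : IsRadialBump G) {n : ℕ} {h : MvPolynomial (Fin d) ℝ} (hh : h.IsHomogeneous n) :
    ∫ x, (radialPotential v x : 𝕜) * φ x * conj (harmMul G h x) =
      ∫ r in Ioi (0 : ℝ), ((r ^ (d - 1 + 2 * n) : ℝ) : 𝕜) *
        ((v r : 𝕜) * (radCoeff n h φ r * conj (G r))) := by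
  set R : ℝ → 𝕜 := fun r => if r = 0 then 0 else (v r : 𝕜) * conj (G r) with hR
  have hpt : ∀ x, (radialPotential v x : 𝕜) * φ x * conj (harmMul G h x) =
      R ‖x‖ * (φ x * (polyFun h x : 𝕜)) := by
    intro x
    simp only [harmMul, radialExt, hR, radialPotential, norm_eq_zero, map_mul, RCLike.conj_ofReal]
    split_ifs with h0
    · simp
    · ring
  have hint : Integrable fun x => (radialPotential v x : 𝕜) * φ x * conj (harmMul G h x) := by
    have := (hG.isCoreFunction_harmMul h).conjugate.integrable_mul
      (c := fun x => (v ‖x‖ : 𝕜) * φ x)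
      ((RCLike.continuous_ofReal.comp_continuousOn (continuousOn_radial hv)).mul
        hφ.continuous.continuousOn)
    exact this
  simp_rw [hpt] at hint ⊢
  rw [integral_radial_mul_polyFun hd hh hint]
  refine setIntegral_congr_fun measurableSet_Ioi fun r hr => ?_
  have hr : 0 < r := hr
  have hr' : (r : 𝕜) ≠ 0 := by exact_mod_cast hr.ne'
  simp only [hR, hr.ne', if_false, radCoeff]
  push_cast
  rw [pow_add, pow_add _ _ (2 * n), two_mul, pow_add, inv_pow]
  field_simp

lemma schroedingerForm_harmMul (hd : 1 ≤ d) {v : ℝ → ℝ} (hv : ContinuousOn v (Ioi 0))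
    {φ : Euc d → 𝕜} (hφ : IsCoreFunction φ) {G : ℝ → 𝕜}
    (hG : IsRadialBump G) {n : ℕ} {h : MvPolynomial (Fin d) ℝ} (hh : IsHarmonicPoly n h) :
    schroedingerForm (radialPotential v) φ (harmMul G h) =
      (∫ r in Ioi (0 : ℝ), ((r ^ (d - 1 + 2 * n) : ℝ) : 𝕜) *
        (deriv (radCoeff n h φ) r * conj (deriv G r))) +
      ∫ r in Ioi (0 : ℝ), ((r ^ (d - 1 + 2 * n) : ℝ) : 𝕜) *
        ((v r : 𝕜) * (radCoeff n h φ r * conj (G r))) := by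
  rw [schroedingerForm, integral_gradient_harmMul hd hφ hG hh,
    integral_potential_harmMul hd hv hφ hG hh.homogeneous]

lemma sphMean_harmMul {G : ℝ → 𝕜} {m : ℕ} {h : MvPolynomial (Fin d) ℝ} (hh : h.IsHomogeneous m)
    (q : Euc d → ℝ) {r : ℝ} (hr : 0 < r) :
    sphMean (harmMul G h) q r = G r * ((r ^ m : ℝ) : 𝕜) *
      ((∫ θ : Metric.sphere (0 : Euc d) 1, polyFun h θ * q θ ∂(surfaceMeasure d) : ℝ) : 𝕜) := by
  rw [← integral_ofReal, ← integral_const_mul]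
  refine integral_congr_ae (Eventually.of_forall fun θ => ?_)
  simp only [harmMul, radialExt_of_ne (smul_sphere_ne_zero hr θ), norm_smul_sphere hr,
    polyFun_smul hh]
  push_cast
  ring

/-- The component of `φ` along the normalized harmonic polynomial `h`. -/
def harmProj (n : ℕ) (h : MvPolynomial (Fin d) ℝ) (φ : Euc d → 𝕜) : Euc d → 𝕜 :=
  harmMul (radCoeff n h φ) h

lemma IsCoreFunction.harmProj {φ : Euc d → 𝕜} (hφ : IsCoreFunction φ) (n : ℕ)
    (h : MvPolynomial (Fin d) ℝ) : IsCoreFunction (harmProj n h φ) :=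
  (hφ.isRadialBump_radCoeff n h).isCoreFunction_harmMul h

lemma radCoeff_harmProj {n : ℕ} {h : MvPolynomial (Fin d) ℝ} (hh : h.IsHomogeneous n)
    (h1 : ∫ θ : Metric.sphere (0 : Euc d) 1, polyFun h θ * polyFun h θ ∂(surfaceMeasure d) = 1)
    (φ : Euc d → 𝕜) : EqOn (radCoeff n h (harmProj n h φ)) (radCoeff n h φ) (Ioi 0) := by
  intro r hr
  have hr : 0 < r := hr
  have hr' : (r : 𝕜) ≠ 0 := by exact_mod_cast hr.ne'
  simp only [radCoeff, harmProj, sphMean_harmMul hh _ hr, h1]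
  push_cast
  rw [inv_pow]
  field_simp

/-- The form against `G(|x|) h(x)` depends on `φ` only through its radial coefficient, and the
projection preserves that coefficient when `h` is normalized. Thus the projection is symmetric for
the form. -/
lemma schroedingerForm_harmProj_left (hd : 1 ≤ d) {v : ℝ → ℝ} (hv : ContinuousOn v (Ioi 0))
    {φ : Euc d → 𝕜} (hφ : IsCoreFunction φ) {G : ℝ → 𝕜}
    (hG : IsRadialBump G) {n : ℕ} {h : MvPolynomial (Fin d) ℝ} (hh : IsHarmonicPoly n h)
    (h1 : ∫ θ : Metric.sphere (0 : Euc d) 1, polyFun h θ * polyFun h θ ∂(surfaceMeasure d) = 1) :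
    schroedingerForm (radialPotential v) (harmProj n h φ) (harmMul G h) =
      schroedingerForm (radialPotential v) φ (harmMul G h) := by
  have hE := radCoeff_harmProj hh.homogeneous h1 φ
  rw [schroedingerForm_harmMul hd hv (hφ.harmProj n h) hG hh, schroedingerForm_harmMul hd hv hφ hG hh]
  congr 1
  · refine setIntegral_congr_fun measurableSet_Ioi fun r hr => ?_
    have : deriv (radCoeff n h (harmProj n h φ)) r = deriv (radCoeff n h φ) r :=
      (hE.eventuallyEq_of_mem (Ioi_mem_nhds hr)).deriv_eq
    simp only [this]
  · refine setIntegral_congr_fun measurableSet_Ioi fun r hr => ?_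
    simp only [hE hr]

/-! ### Orthogonality of harmonic polynomials of different degrees -/

/-- A bump centred at `2` and supported in `[1, 3]`, where `r ^ k ≥ 1`, so the weighted integral is
at least the plain one. -/
lemma exists_isRadialBump_integral_pos (k : ℕ) :
    ∃ G : ℝ → ℝ, IsRadialBump G ∧ 0 < ∫ r in Ioi (0 : ℝ), r ^ k * G r := by
  let f : ContDiffBump (2 : ℝ) := ⟨1 / 2, 1, by norm_num, by norm_num⟩
  have hz : ∀ r : ℝ, r < 1 ∨ 3 < r → f r = 0 := by
    intro r hr
    apply f.zero_of_le_dist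
    rw [Real.dist_eq]
    rcases hr with hr | hr
    · rw [abs_of_neg (by linarith)]
      change (1 : ℝ) ≤ _
      linarith
    · rw [abs_of_pos (by linarith)]
      change (1 : ℝ) ≤ _
      linarith
  have hb : IsRadialBump (f : ℝ → ℝ) :=
    ⟨f.contDiff.contDiffOn, 1, 3, one_pos, fun r _ hr => hz r hr⟩
  refine ⟨f, hb, lt_of_lt_of_le (f.integral_pos (μ := volume)) ?_⟩
  rw [← setIntegral_eq_integral_of_forall_compl_eq_zero (s := Ioi 0)
    (fun r hr => hz r (Or.inl (by linarith [not_lt.1 (mem_Ioi.not.1 hr)])))]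
  refine setIntegral_mono_on hb.integrableOn
    (hb.integrableOn_mul (continuous_pow k).continuousOn) measurableSet_Ioi fun r _ => ?_
  by_cases hr : 1 ≤ r
  · exact le_mul_of_one_le_left f.nonneg (one_le_pow₀ hr)
  · simp [hz r (Or.inl (not_le.1 hr))]

/-- Green's identity with a radial cutoff: `∫ G ∇g·∇h` is integrated by parts in both orders, which
brings out the degrees `n` and `m` in front of the same integral. That integral therefore vanishes;
in polar coordinates it is a nonzero multiple of the spherical inner product. -/
lemma IsHarmonicPoly.integral_mul_eq_zero (hd : 2 ≤ d) {n m : ℕ} (hnm : n ≠ m)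
    {h g : MvPolynomial (Fin d) ℝ} (hh : IsHarmonicPoly n h) (hg : IsHarmonicPoly m g) :
    ∫ θ : Metric.sphere (0 : Euc d) 1, polyFun h θ * polyFun g θ ∂(surfaceMeasure d) = 0 := by
  -- Since `n ≠ m`, one degree is positive; with `d ≥ 2` the exponent is at least `2`.
  obtain ⟨k, hk⟩ : ∃ k, d - 1 + n + m = k + 2 := ⟨d - 1 + n + m - 2, by omega⟩
  obtain ⟨G, hG, hpos⟩ := exists_isRadialBump_integral_pos k
  have e1 := integral_gradient_harmonic (𝕜 := ℝ) (contDiff_polyFun g) hG hh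
  have e2 := integral_gradient_harmonic (𝕜 := ℝ) (contDiff_polyFun h) hG hg
  simp only [partialDeriv, fderiv_polyFun, RCLike.ofReal_real_eq_id, id_eq] at e1 e2
  set R : ℝ → ℝ := fun r => r⁻¹ * deriv G r with hR
  have hR0 : ∀ x : Euc d, radialExt R x = R ‖x‖ := by
    intro x
    by_cases hx : x = 0
    · simp [radialExt, hx, hR]
    · exact radialExt_of_ne hx
  have hRb : IsRadialBump R := hG.deriv_div
  have e3 : (n : ℝ) * ∫ x : Euc d, R ‖x‖ * (polyFun h x * polyFun g x) =
      m * ∫ x : Euc d, R ‖x‖ * (polyFun h x * polyFun g x) := by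
    rw [← integral_const_mul, ← integral_const_mul]
    have : ∀ x : Euc d, ∑ i, polyFun (MvPolynomial.pderiv i g) x *
        (radialExt G x * polyFun (MvPolynomial.pderiv i h) x) =
        ∑ i, polyFun (MvPolynomial.pderiv i h) x *
        (radialExt G x * polyFun (MvPolynomial.pderiv i g) x) :=
      fun x => Finset.sum_congr rfl fun i _ => by ring
    simp_rw [this] at e1
    rw [e1, neg_inj] at e2
    simp only [hR0] at e2
    calc _ = ∫ x : Euc d, polyFun g x * (R ‖x‖ * (n * polyFun h x)) :=
          integral_congr_ae (Eventually.of_forall fun x => by simp only; ring)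
      _ = ∫ x : Euc d, polyFun h x * (R ‖x‖ * (m * polyFun g x)) := e2
      _ = _ := integral_congr_ae (Eventually.of_forall fun x => by simp only; ring)
  have e4 : ∫ x : Euc d, R ‖x‖ * (polyFun h x * polyFun g x) = 0 := by
    have : ((n : ℝ) - m) * ∫ x : Euc d, R ‖x‖ * (polyFun h x * polyFun g x) = 0 := by
      rw [sub_mul, e3, sub_self]
    refine (mul_eq_zero.1 this).resolve_left ?_
    exact sub_ne_zero.2 (by exact_mod_cast hnm)
  have hint : Integrable fun x : Euc d => R ‖x‖ * (polyFun h x * ((polyFun g x : ℝ) : ℝ)) := by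
    have := (hRb.isCoreFunction (d := d)).integrable_mul
      ((continuous_polyFun h).mul (continuous_polyFun g)).continuousOn
    refine this.congr (Eventually.of_forall fun x => ?_)
    simp only [hR0, Pi.mul_apply]
    ring
  have e5 := integral_radial_mul_polyFun (𝕜 := ℝ) (by omega) hg.homogeneous hint
  simp only [RCLike.ofReal_real_eq_id, id_eq] at e5
  rw [e4] at e5
  set κ := ∫ θ : Metric.sphere (0 : Euc d) 1, polyFun h θ * polyFun g θ ∂(surfaceMeasure d) with hκ
  -- The weight is `r ^ (k+1) G'`: up to an exact derivative it equals `-(k+1) r ^ k G`, whose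
  -- integral is nonzero by the choice of `G`.
  have e6 : ∀ r ∈ Ioi (0 : ℝ), r ^ (d - 1 + m) * (R r * sphMean (polyFun h) (polyFun g) r) =
      κ * (deriv (fun r => r ^ (k + 1) * G r) r - (k + 1) * (r ^ k * G r)) := by
    intro r hr
    have hr : 0 < r := hr
    have hs : sphMean (polyFun h) (polyFun g) r = r ^ n * κ := by
      rw [hκ, ← integral_const_mul]
      refine integral_congr_ae (Eventually.of_forall fun θ => ?_)
      simp only [polyFun_smul hh.homogeneous, RCLike.ofReal_real_eq_id, id_eq]
      ring
    have hder := ((hasDerivAt_pow (k + 1) r).mul (hG.hasDerivAt hr)).deriv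
    rw [show (fun r => r ^ (k + 1) * G r) = (fun r : ℝ => r ^ (k + 1)) * G from rfl, hder, hs]
    have : r ^ (d - 1 + m) * r ^ n = r ^ (k + 1) * r := by
      rw [← pow_add, ← pow_succ]
      congr 1
      omega
    calc _ = (r ^ (d - 1 + m) * r ^ n) * r⁻¹ * deriv G r * κ := by simp only [hR]; ring
      _ = _ := by
        rw [this]
        simp only [Nat.add_sub_cancel]
        push_cast
        field_simp
        ring
  have hb1 : IsRadialBump (fun r : ℝ => r ^ (k + 1) * G r) :=
    hG.mul_left (contDiff_id.pow _).contDiffOn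
  have hb0 : IsRadialBump (fun r : ℝ => r ^ k * G r) := hG.mul_left (contDiff_id.pow _).contDiffOn
  rw [setIntegral_congr_fun measurableSet_Ioi e6, integral_const_mul,
    integral_sub hb1.deriv.integrableOn (hb0.integrableOn.const_mul _), hb1.integral_deriv,
    integral_const_mul] at e5
  have hk1 : (0 : ℝ) < k + 1 := by positivity
  rcases mul_eq_zero.1 e5.symm with h0 | h0
  · exact h0
  · nlinarith [mul_pos hk1 hpos]

/-! ### The form on core functions -/

/-- The squared `L²` norm. -/
def l2Sq (φ : Euc d → 𝕜) : ℝ := ∫ x, ‖φ x‖ ^ 2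

/-- The squared `L²` norm of the gradient. -/
def gradSq (φ : Euc d → 𝕜) : ℝ := ∫ x, ∑ i, ‖partialDeriv i φ x‖ ^ 2

lemma l2Sq_nonneg (φ : Euc d → 𝕜) : 0 ≤ l2Sq φ := integral_nonneg fun _ => by positivity

lemma gradSq_nonneg (φ : Euc d → 𝕜) : 0 ≤ gradSq φ := integral_nonneg fun _ => by positivity

section Form

variable {φ ψ χ : Euc d → 𝕜} {v : ℝ → ℝ}

lemma IsCoreFunction.integrable_gradient_mul (hφ : IsCoreFunction φ) (hψ : IsCoreFunction ψ) :
    Integrable fun x =>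
      ∑ i, _root_.partialDeriv i φ x * conj (_root_.partialDeriv i ψ x) :=
  integrable_finsetSum _ fun i _ => (hψ.partialDeriv i).conjugate.integrable_mul
    (hφ.partialDeriv i).continuous.continuousOn

lemma IsCoreFunction.integrable_potential_mul (hφ : IsCoreFunction φ) (hψ : IsCoreFunction ψ)
    (hv : ContinuousOn v (Ioi 0)) :
    Integrable fun x => (radialPotential v x : 𝕜) * φ x * conj (ψ x) :=
  hψ.conjugate.integrable_mul (c := fun x => (v ‖x‖ : 𝕜) * φ x)
    ((RCLike.continuous_ofReal.comp_continuousOn (continuousOn_radial hv)).mul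
      hφ.continuous.continuousOn)

lemma partialDeriv_sub (hφ : IsCoreFunction φ) (hψ : IsCoreFunction ψ) (i : Fin d) (x : Euc d) :
    partialDeriv i (φ - ψ) x = partialDeriv i φ x - partialDeriv i ψ x := by
  simp only [partialDeriv]
  rw [fderiv_sub (hφ.differentiable x) (hψ.differentiable x)]
  rfl

lemma schroedingerForm_sub_left (hφ : IsCoreFunction φ) (hψ : IsCoreFunction ψ)
    (hχ : IsCoreFunction χ) (hv : ContinuousOn v (Ioi 0)) :
    schroedingerForm (radialPotential v) (φ - ψ) χ =
      schroedingerForm (radialPotential v) φ χ - schroedingerForm (radialPotential v) ψ χ := by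
  simp only [schroedingerForm]
  rw [add_sub_add_comm, ← integral_sub (hφ.integrable_gradient_mul hχ)
    (hψ.integrable_gradient_mul hχ), ← integral_sub (hφ.integrable_potential_mul hχ hv)
    (hψ.integrable_potential_mul hχ hv)]
  simp only [partialDeriv_sub hφ hψ, sub_mul, Finset.sum_sub_distrib, Pi.sub_apply, mul_sub]

lemma schroedingerForm_conj_symm (V : Euc d → ℝ) (φ ψ : Euc d → 𝕜) :
    conj (schroedingerForm V φ ψ) = schroedingerForm V ψ φ := by
  simp only [schroedingerForm, map_add, ← integral_conj, map_sum, map_mul, RCLike.conj_ofReal,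
    RCLike.conj_conj]
  congr 1
  · simp only [mul_comm]
  · refine integral_congr_ae (Eventually.of_forall fun x => ?_)
    simp only
    ring

lemma schroedingerForm_sub_right (hφ : IsCoreFunction φ) (hψ : IsCoreFunction ψ)
    (hχ : IsCoreFunction χ) (hv : ContinuousOn v (Ioi 0)) :
    schroedingerForm (radialPotential v) χ (φ - ψ) =
      schroedingerForm (radialPotential v) χ φ - schroedingerForm (radialPotential v) χ ψ := by
  rw [← schroedingerForm_conj_symm, schroedingerForm_sub_left hφ hψ hχ hv, map_sub,
    schroedingerForm_conj_symm, schroedingerForm_conj_symm]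

lemma re_schroedingerForm_sub (hφ : IsCoreFunction φ) (hψ : IsCoreFunction ψ)
    (hv : ContinuousOn v (Ioi 0)) :
    RCLike.re (schroedingerForm (radialPotential v) (φ - ψ) (φ - ψ)) =
      RCLike.re (schroedingerForm (radialPotential v) φ φ) +
      RCLike.re (schroedingerForm (radialPotential v) ψ ψ) -
      2 * RCLike.re (schroedingerForm (radialPotential v) φ ψ) := by
  rw [schroedingerForm_sub_left hφ hψ (hφ.sub hψ) hv, schroedingerForm_sub_right hφ hψ hφ hv,
    schroedingerForm_sub_right hφ hψ hψ hv, ← schroedingerForm_conj_symm _ φ ψ]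
  simp only [map_sub, RCLike.conj_re]
  ring

lemma re_schroedingerForm_self (hφ : IsCoreFunction φ) (hv : ContinuousOn v (Ioi 0)) :
    RCLike.re (schroedingerForm (radialPotential v) φ φ) =
      gradSq φ + ∫ x, v ‖x‖ * ‖φ x‖ ^ 2 := by
  rw [schroedingerForm, map_add, ← integral_re (hφ.integrable_gradient_mul hφ),
    ← integral_re (hφ.integrable_potential_mul hφ hv), gradSq]
  congr 1
  · refine integral_congr_ae (Eventually.of_forall fun x => ?_)
    simp only [map_sum, RCLike.mul_conj]
    exact Finset.sum_congr rfl fun i _ => by norm_cast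
  · refine integral_congr_ae (Eventually.of_forall fun x => ?_)
    simp only [mul_assoc, RCLike.mul_conj, radialPotential]
    norm_cast

/-- Moving the eigenvalue into the potential turns the eigenvalue equation into the vanishing of a
form; other shifts make the form nonnegative. -/
lemma schroedingerForm_sub_const (hφ : IsCoreFunction φ) (hψ : IsCoreFunction ψ)
    (hv : ContinuousOn v (Ioi 0)) (c : ℝ) :
    schroedingerForm (radialPotential fun r => v r - c) φ ψ =
      schroedingerForm (radialPotential v) φ ψ - (c : 𝕜) * ∫ x, φ x * conj (ψ x) := by
  have hi : Integrable fun x => (c : 𝕜) * (φ x * conj (ψ x)) :=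
    (hψ.conjugate.integrable_mul hφ.continuous.continuousOn).const_mul _
  simp only [schroedingerForm]
  rw [← integral_const_mul, add_sub_assoc, ← integral_sub (hφ.integrable_potential_mul hψ hv) hi]
  congr 1
  refine integral_congr_ae (Eventually.of_forall fun x => ?_)
  simp only [radialPotential]
  push_cast
  ring

lemma re_schroedingerForm_sub_const (hφ : IsCoreFunction φ)
    (hv : ContinuousOn v (Ioi 0)) (c : ℝ) :
    RCLike.re (schroedingerForm (radialPotential fun r => v r - c) φ φ) =
      RCLike.re (schroedingerForm (radialPotential v) φ φ) - c * l2Sq φ := by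
  have hi : Integrable fun x => c * ‖φ x‖ ^ 2 := hφ.normSq.integrable.const_mul _
  have hi2 : Integrable fun x => v ‖x‖ * ‖φ x‖ ^ 2 :=
    hφ.normSq.integrable_mul (continuousOn_radial hv)
  rw [re_schroedingerForm_self hφ hv, re_schroedingerForm_self hφ (v := fun r => v r - c) (hv.sub continuousOn_const),
    l2Sq, ← integral_const_mul, add_sub_assoc, ← integral_sub hi2 hi]
  simp only [sub_mul]

end Form

/-! ### Spherical means and `L²` norms -/

/-- Cauchy–Schwarz on the unit sphere. The constant is `∫ q² + 1`, so that it is positive even if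
`q` vanishes on the sphere. -/
lemma norm_sphMean_sq_le {q : Euc d → ℝ} (hq : Continuous q) : ∃ C : ℝ, 0 < C ∧
    ∀ (χ : Euc d → 𝕜) (_ : Continuous χ) (r : ℝ), ‖sphMean χ q r‖ ^ 2 ≤
      C * ∫ θ : Metric.sphere (0 : Euc d) 1, ‖χ (r • (θ : Euc d))‖ ^ 2 ∂(surfaceMeasure d) := by
  refine ⟨(∫ θ : Metric.sphere (0 : Euc d) 1, q θ ^ 2 ∂(surfaceMeasure d)) + 1, ?_, ?_⟩
  · have : 0 ≤ ∫ θ : Metric.sphere (0 : Euc d) 1, q θ ^ 2 ∂(surfaceMeasure d) :=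
      integral_nonneg fun _ => by positivity
    linarith
  intro χ hχ r
  set A := ∫ θ : Metric.sphere (0 : Euc d) 1, ‖χ (r • (θ : Euc d))‖ ^ 2 ∂(surfaceMeasure d)
  set B := ∫ θ : Metric.sphere (0 : Euc d) 1, q θ ^ 2 ∂(surfaceMeasure d)
  have hiA : Integrable (fun θ : Metric.sphere (0 : Euc d) 1 => ‖χ (r • (θ : Euc d))‖ ^ 2)
      (surfaceMeasure d) := integrable_sphere (by fun_prop)
  have hiB : Integrable (fun θ : Metric.sphere (0 : Euc d) 1 => q θ ^ 2)
      (surfaceMeasure d) := integrable_sphere (by fun_prop)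
  have hA : 0 ≤ A := integral_nonneg fun _ => by positivity
  have hB : 0 ≤ B := integral_nonneg fun _ => by positivity
  set m := ∫ θ : Metric.sphere (0 : Euc d) 1, ‖χ (r • (θ : Euc d))‖ * |q θ| ∂(surfaceMeasure d)
  have hm0 : 0 ≤ m := integral_nonneg fun _ => by positivity
  have h1 : ‖sphMean χ q r‖ ≤ m := by
    refine (norm_integral_le_integral_norm _).trans_eq ?_
    refine integral_congr_ae (Eventually.of_forall fun θ => ?_)
    simp [norm_mul]
  -- The quadratic in `t` is the integral of `(|χ| - t|q|)²`, so its discriminant is at most zero.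
  have h2 : ∀ t : ℝ, 0 ≤ B * (t * t) + (-2 * m) * t + A := by
    intro t
    have him : Integrable (fun θ : Metric.sphere (0 : Euc d) 1 =>
      ‖χ (r • (θ : Euc d))‖ * |q θ|) (surfaceMeasure d) := integrable_sphere (by fun_prop)
    have : B * (t * t) + (-2 * m) * t + A = ∫ θ : Metric.sphere (0 : Euc d) 1,
        (‖χ (r • (θ : Euc d))‖ - t * |q θ|) ^ 2 ∂(surfaceMeasure d) := by
      have : ∀ θ : Metric.sphere (0 : Euc d) 1, (‖χ (r • (θ : Euc d))‖ - t * |q θ|) ^ 2 =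
          (t * t) * q θ ^ 2 + (-2 * t) * (‖χ (r • (θ : Euc d))‖ * |q θ|) +
          ‖χ (r • (θ : Euc d))‖ ^ 2 := by
        intro θ
        rw [← sq_abs (q θ)]
        ring
      simp_rw [this]
      rw [integral_add (by exact (hiB.const_mul (t * t)).add (him.const_mul (-2 * t))) hiA,
        integral_add (hiB.const_mul _) (him.const_mul _), integral_const_mul, integral_const_mul]
      ring
    rw [this]
    exact integral_nonneg fun _ => by positivity
  have h3 := discrim_le_zero h2
  rw [discrim] at h3
  calc ‖sphMean χ q r‖ ^ 2 ≤ m ^ 2 := by gcongr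
    _ ≤ B * A := by nlinarith
    _ ≤ (B + 1) * A := by nlinarith

lemma l2Sq_eq_polar (hd : 1 ≤ d) {χ : Euc d → 𝕜} (hχ : IsCoreFunction χ) :
    l2Sq χ = ∫ r in Ioi (0 : ℝ), r ^ (d - 1) *
      ∫ θ : Metric.sphere (0 : Euc d) 1, ‖χ (r • (θ : Euc d))‖ ^ 2 ∂(surfaceMeasure d) := by
  rw [l2Sq, integral_polar hχ.normSq.integrable hd]
  rfl

lemma IsCoreFunction.isRadialBump_normSq {χ : Euc d → 𝕜} (hχ : IsCoreFunction χ) :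
    IsRadialBump (fun r : ℝ =>
      ∫ θ : Metric.sphere (0 : Euc d) 1, ‖χ (r • (θ : Euc d))‖ ^ 2 ∂(surfaceMeasure d)) := by
  have := hχ.normSq.isRadialBump_sphMean (q := fun _ => 1) continuous_const
  have e : sphMean (𝕜 := ℝ) (fun x => ‖χ x‖ ^ 2) (fun _ => 1) = fun r : ℝ =>
      ∫ θ : Metric.sphere (0 : Euc d) 1, ‖χ (r • (θ : Euc d))‖ ^ 2 ∂(surfaceMeasure d) := by
    ext r
    simp [sphMean]
  rwa [e] at this

lemma integral_norm_sphMean_sq_le (hd : 1 ≤ d) {q : Euc d → ℝ} (hq : Continuous q) :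
    ∃ C : ℝ, 0 < C ∧ ∀ χ : Euc d → 𝕜, IsCoreFunction χ →
      ∫ r in Ioi (0 : ℝ), r ^ (d - 1) * ‖sphMean χ q r‖ ^ 2 ≤ C * l2Sq χ := by
  obtain ⟨C, hC0, hC⟩ := norm_sphMean_sq_le (𝕜 := 𝕜) hq
  refine ⟨C, hC0, fun χ hχ => ?_⟩
  rw [l2Sq_eq_polar hd hχ, ← integral_const_mul]
  have hpow : ContinuousOn (fun r : ℝ => r ^ (d - 1)) (Ioi 0) := (continuous_pow _).continuousOn
  refine setIntegral_mono_on ((hχ.isRadialBump_sphMean hq).normSq.integrableOn_mul hpow)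
    ((hχ.isRadialBump_normSq.integrableOn_mul hpow).const_mul C) measurableSet_Ioi fun r hr => ?_
  have hr : 0 < r := hr
  calc _ ≤ r ^ (d - 1) * (C * _) := by gcongr; exact hC χ hχ.continuous r
    _ = _ := by ring

lemma gradSq_eq_sum {φ : Euc d → 𝕜} (hφ : IsCoreFunction φ) :
    gradSq φ = ∑ i, l2Sq (partialDeriv i φ) :=
  integral_finsetSum _ fun i _ => (hφ.partialDeriv i).normSq.integrable

/-- The derivative is a sum of `d` spherical means of partial derivatives, so the previous bound
applies termwise after Cauchy–Schwarz on the sum, which costs the factor `d`. -/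
lemma integral_norm_deriv_sphMean_sq_le (hd : 1 ≤ d) {q : Euc d → ℝ} (hq : Continuous q) :
    ∃ C : ℝ, 0 < C ∧ ∀ φ : Euc d → 𝕜, IsCoreFunction φ →
      ∫ r in Ioi (0 : ℝ), r ^ (d - 1) * ‖deriv (sphMean φ q) r‖ ^ 2 ≤ C * gradSq φ := by
  have hqi : ∀ i, Continuous fun x : Euc d => x i * q x := fun i => (continuous_coord i).mul hq
  choose C hC0 hC using fun i => integral_norm_sphMean_sq_le (𝕜 := 𝕜) hd (hqi i)
  refine ⟨d * (∑ i, C i + 1), ?_, fun φ hφ => ?_⟩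
  · have : 0 ≤ ∑ i, C i := Finset.sum_nonneg fun i _ => (hC0 i).le
    have : (0 : ℝ) < d := by exact_mod_cast hd
    positivity
  have hpow : ContinuousOn (fun r : ℝ => r ^ (d - 1)) (Ioi 0) := (continuous_pow _).continuousOn
  have hint : ∀ i, IntegrableOn (fun r : ℝ => r ^ (d - 1) *
      ‖sphMean (partialDeriv i φ) (fun x => x i * q x) r‖ ^ 2) (Ioi 0) := fun i =>
    ((hφ.partialDeriv i).isRadialBump_sphMean (hqi i)).normSq.integrableOn_mul hpow
  calc _ ≤ ∫ r in Ioi (0 : ℝ), d * ∑ i, r ^ (d - 1) *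
        ‖sphMean (partialDeriv i φ) (fun x => x i * q x) r‖ ^ 2 := by
        refine setIntegral_mono_on
          ((hφ.isRadialBump_sphMean hq).deriv.normSq.integrableOn_mul hpow)
          ((integrable_finsetSum _ fun i _ => hint i).const_mul _) measurableSet_Ioi fun r hr => ?_
        have hr : 0 < r := hr
        rw [hφ.deriv_sphMean hq, ← Finset.mul_sum, mul_left_comm]
        gcongr
        calc _ ≤ (∑ i, ‖sphMean (partialDeriv i φ) (fun x => x i * q x) r‖) ^ 2 := by
              gcongr; exact norm_sum_le _ _
          _ ≤ _ := by
              simpa using sq_sum_le_card_mul_sum_sq (s := Finset.univ)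
                (f := fun i => ‖sphMean (partialDeriv i φ) (fun x => x i * q x) r‖)
    _ = d * ∑ i, ∫ r in Ioi (0 : ℝ), r ^ (d - 1) *
        ‖sphMean (partialDeriv i φ) (fun x => x i * q x) r‖ ^ 2 := by
        rw [integral_const_mul, integral_finsetSum _ fun i _ => hint i]
    _ ≤ d * ∑ i, (∑ j, C j + 1) * l2Sq (partialDeriv i φ) := by
        gcongr with i
        refine (hC i _ (hφ.partialDeriv i)).trans ?_
        have := Finset.single_le_sum (f := C) (fun j _ => (hC0 j).le) (Finset.mem_univ i)
        exact mul_le_mul_of_nonneg_right (by linarith) (l2Sq_nonneg _)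
    _ = _ := by rw [← Finset.mul_sum, gradSq_eq_sum hφ, mul_assoc]

/-- A weighted Sobolev inequality on the half line. -/
lemma IsRadialBump.pow_mul_norm_sq_le {g : ℝ → 𝕜} (hg : IsRadialBump g) (k : ℕ) {x ε : ℝ}
    (hx : 0 < x) (hε : 0 < ε) : x ^ k * ‖g x‖ ^ 2 ≤
      ε * (∫ r in Ioi (0 : ℝ), r ^ k * ‖g r‖ ^ 2) +
        ε⁻¹ * ∫ r in Ioi (0 : ℝ), r ^ k * ‖_root_.deriv g r‖ ^ 2 := by
  have hpow : ContDiffOn ℝ ∞ (fun r : ℝ => r ^ k) (Ioi 0) := (contDiff_id.pow _).contDiffOn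
  have hH : IsRadialBump (fun r : ℝ => r ^ k * ‖g r‖ ^ 2) := hg.normSq.mul_left hpow
  have hH' : IsRadialBump (fun r : ℝ => r ^ k * ‖_root_.deriv g r‖ ^ 2) :=
    hg.deriv.normSq.mul_left hpow
  have e := hH.integral_Ioi_deriv hx
  have hx0 : Ioi x ⊆ Ioi 0 := Ioi_subset_Ioi hx.le
  have hRi : IntegrableOn (fun r : ℝ => ε * (r ^ k * ‖g r‖ ^ 2) +
      ε⁻¹ * (r ^ k * ‖_root_.deriv g r‖ ^ 2)) (Ioi 0) :=
    (hH.integrableOn.const_mul ε).add (hH'.integrableOn.const_mul ε⁻¹)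
  calc x ^ k * ‖g x‖ ^ 2 = ∫ r in Ioi x, -_root_.deriv (fun r : ℝ => r ^ k * ‖g r‖ ^ 2) r := by
        rw [integral_neg, e, neg_neg]
    _ ≤ ∫ r in Ioi x, (ε * (r ^ k * ‖g r‖ ^ 2) + ε⁻¹ * (r ^ k * ‖_root_.deriv g r‖ ^ 2)) := by
        refine setIntegral_mono_on (hH.deriv.integrableOn.mono_set hx0).neg
          (hRi.mono_set hx0) measurableSet_Ioi fun r hr => ?_
        have hr : 0 < r := hx.trans hr
        have h1 := ((hasDerivAt_pow k r).mul ((hg.hasDerivAt hr).norm_sq)).deriv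
        rw [show (fun r : ℝ => r ^ k * ‖g r‖ ^ 2) =
          (fun r : ℝ => r ^ k) * (fun r => ‖g r‖ ^ 2) from rfl, h1]
        have h2 : -(2 * inner ℝ (g r) (_root_.deriv g r)) ≤
            ε * ‖g r‖ ^ 2 + ε⁻¹ * ‖_root_.deriv g r‖ ^ 2 := by
          have h3 := abs_real_inner_le_norm (g r) (_root_.deriv g r)
          have h4 : 2 * (‖g r‖ * ‖_root_.deriv g r‖) ≤
              ε * ‖g r‖ ^ 2 + ε⁻¹ * ‖_root_.deriv g r‖ ^ 2 := by
            have h5 : 0 ≤ ε⁻¹ * (ε * ‖g r‖ - ‖_root_.deriv g r‖) ^ 2 := by positivity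
            have h6 : ε⁻¹ * (ε * ‖g r‖ - ‖_root_.deriv g r‖) ^ 2 = ε * ‖g r‖ ^ 2 +
              ε⁻¹ * ‖_root_.deriv g r‖ ^ 2 - 2 * (‖g r‖ * ‖_root_.deriv g r‖) := by
              field_simp
              ring
            linarith
          linarith [neg_abs_le (inner ℝ (g r) (_root_.deriv g r))]
        -- Differentiating the weight contributes `-k r ^ (k-1) |g|²`, which has the favourable sign
        -- and is dropped.
        have h7 : 0 ≤ (k : ℝ) * r ^ (k - 1) * ‖g r‖ ^ 2 := by positivity
        have h8 := mul_le_mul_of_nonneg_left h2 (pow_nonneg hr.le k)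
        nlinarith
    _ ≤ ∫ r in Ioi 0, (ε * (r ^ k * ‖g r‖ ^ 2) + ε⁻¹ * (r ^ k * ‖_root_.deriv g r‖ ^ 2)) := by
        refine setIntegral_mono_set hRi ?_ hx0.eventuallyLE
        filter_upwards [ae_restrict_mem measurableSet_Ioi] with r hr
        have hr : 0 < r := hr
        simp only [Pi.zero_apply]
        positivity
    _ = _ := by
        rw [integral_add (hH.integrableOn.const_mul ε) (hH'.integrableOn.const_mul ε⁻¹),
          integral_const_mul, integral_const_mul]

/-! ### Relative form bound of the potential -/

/-- Since `t ^ (2-2s) = t ^ (2-s) t ^ (-s)` and `s < 2`, the first factor is small near `0`; the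
threshold `t₀` is where it equals `η δ`. Beyond `t₀` the exponent `2 - 2s ≤ 0` keeps the left side
bounded, which is where `s ≥ 1` enters. -/
lemma exists_rpow_two_sub_le {s : ℝ} (hs1 : 1 ≤ s) (hs2 : s < 2) {δ η : ℝ} (hδ : 0 < δ)
    (hη : 0 < η) : ∃ C : ℝ, 0 < C ∧ ∀ t : ℝ, 0 < t →
      δ⁻¹ * t ^ (2 - 2 * s) ≤ η * t ^ (-s) + C := by
  set t₀ : ℝ := (η * δ) ^ (1 / (2 - s)) with ht₀
  have hpos : 0 < t₀ := by positivity
  have hs : 0 < 2 - s := by linarith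
  refine ⟨δ⁻¹ * t₀ ^ (2 - 2 * s), by positivity, fun t ht => ?_⟩
  rcases le_total t t₀ with h | h
  · have h1 : t ^ (2 - s) ≤ η * δ := by
      calc t ^ (2 - s) ≤ t₀ ^ (2 - s) := Real.rpow_le_rpow ht.le h hs.le
        _ = η * δ := by
          rw [ht₀, ← Real.rpow_mul (by positivity), one_div_mul_cancel hs.ne', Real.rpow_one]
    have h2 : t ^ (2 - 2 * s) = t ^ (2 - s) * t ^ (-s) := by
      rw [← Real.rpow_add ht]
      congr 1
      ring
    have h3 : δ⁻¹ * t ^ (2 - 2 * s) ≤ η * t ^ (-s) := by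
      rw [h2, ← mul_assoc]
      refine mul_le_mul_of_nonneg_right ?_ (by positivity)
      calc δ⁻¹ * t ^ (2 - s) ≤ δ⁻¹ * (η * δ) := by gcongr
        _ = η := by field_simp
    have : 0 < δ⁻¹ * t₀ ^ (2 - 2 * s) := by positivity
    linarith
  · have h1 : t ^ (2 - 2 * s) ≤ t₀ ^ (2 - 2 * s) :=
      Real.rpow_le_rpow_of_nonpos hpos h (by linarith)
    have h2 : 0 ≤ η * t ^ (-s) := by positivity
    have h3 := mul_le_mul_of_nonneg_left h1 (inv_nonneg.2 hδ.le)
    linarith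

/-- The divergence theorem for the vector field `x |x| ^ (-s) g`. -/
lemma integral_rpow_norm_mul (hd : 1 ≤ d) {g : Euc d → ℝ} (hg : IsCoreFunction g) (s : ℝ) :
    (d - s) * ∫ x, ‖x‖ ^ (-s) * g x =
      - ∫ x, ‖x‖ ^ (-s) * ∑ i, x i * partialDeriv i g x := by
  have hpow : ∀ k : ℝ, ContDiffOn ℝ ∞ (fun r : ℝ => r ^ k) (Ioi 0) := fun k =>
    fun r hr => (Real.contDiffAt_rpow_const_of_ne (mem_Ioi.1 hr).ne').contDiffWithinAt
  have hpowc : ContinuousOn (fun x : Euc d => ‖x‖ ^ (-s)) {0}ᶜ :=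
    continuousOn_radial (hpow (-s)).continuousOn
  have hi1 : Integrable fun x => ‖x‖ ^ (-s) * g x := hg.integrable_mul hpowc
  have hi2 : Integrable fun x => ‖x‖ ^ (-s) * ∑ i, x i * partialDeriv i g x := by
    simp_rw [Finset.mul_sum, ← mul_assoc]
    exact integrable_finsetSum _ fun i _ =>
      (hg.partialDeriv i).integrable_mul (hpowc.mul (continuous_coord i).continuousOn)
  set M := sphMean (𝕜 := ℝ) g (fun _ => 1)
  have hM : IsRadialBump M := hg.isRadialBump_sphMean continuous_const
  rw [integral_polar hi1 hd, integral_polar hi2 hd, ← integral_const_mul, ← integral_neg,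
    ← sub_eq_zero]
  -- In polar coordinates the identity says that the derivative of `r ^ (d-s) M(r)` integrates to
  -- zero.
  have hB : IsRadialBump (fun r : ℝ => r ^ ((d : ℝ) - s) * M r) := hM.mul_left (hpow _)
  have e1 : ∀ r ∈ Ioi (0 : ℝ), (d - s) * (r ^ (d - 1) • ∫ θ : Metric.sphere (0 : Euc d) 1,
      ‖r • (θ : Euc d)‖ ^ (-s) * g (r • (θ : Euc d)) ∂(surfaceMeasure d)) =
      (d - s) * r ^ ((d : ℝ) - s - 1) * M r := by
    intro r hr
    have hr : 0 < r := hr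
    simp only [norm_smul_sphere hr, smul_eq_mul]
    rw [integral_const_mul]
    have : r ^ ((d : ℝ) - s - 1) = r ^ (d - 1) * r ^ (-s) := by
      rw [← Real.rpow_natCast, ← Real.rpow_add hr, Nat.cast_sub hd]
      congr 1
      push_cast
      ring
    rw [this]
    simp only [M, sphMean, RCLike.ofReal_one, mul_one]
    ring
  have e2 : ∀ r ∈ Ioi (0 : ℝ), (-(r ^ (d - 1) • ∫ θ : Metric.sphere (0 : Euc d) 1,
      ‖r • (θ : Euc d)‖ ^ (-s) * ∑ i, (r • (θ : Euc d)) i * partialDeriv i g (r • (θ : Euc d))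
        ∂(surfaceMeasure d)) : ℝ) = - (r ^ ((d : ℝ) - s) * deriv M r) := by
    intro r hr
    have hr : 0 < r := hr
    simp only [norm_smul_sphere hr, smul_eq_mul, PiLp.smul_apply]
    rw [integral_const_mul]
    have : r ^ ((d : ℝ) - s) = r ^ (d - 1) * r ^ (-s) * r := by
      rw [← Real.rpow_natCast, ← Real.rpow_add hr, Nat.cast_sub hd,
        ← Real.rpow_add_one hr.ne']
      congr 1
      push_cast
      ring
    have hint : ∀ i, Integrable (fun θ : Metric.sphere (0 : Euc d) 1 =>
        partialDeriv i g (r • (θ : Euc d)) * (((θ : Euc d) i * 1 : ℝ) : ℝ))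
        (surfaceMeasure d) := fun i =>
      integrable_sphMean_integrand (𝕜 := ℝ) (hg.partialDeriv i).continuous
        ((continuous_coord i).mul continuous_const) r
    have hMd : deriv M r = ∫ θ : Metric.sphere (0 : Euc d) 1, ∑ i,
        partialDeriv i g (r • (θ : Euc d)) * ((θ : Euc d) i * 1) ∂(surfaceMeasure d) := by
      rw [integral_finsetSum _ fun i _ => hint i]
      exact hg.deriv_sphMean continuous_const r
    rw [this, hMd, mul_assoc, mul_assoc, ← integral_const_mul r]
    congr 3
    refine integral_congr_ae (Eventually.of_forall fun θ => ?_)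
    simp only [Finset.mul_sum]
    exact Finset.sum_congr rfl fun i _ => by ring
  have i1 : IntegrableOn (fun r => (d - s) * r ^ ((d : ℝ) - s - 1) * M r) (Ioi 0) :=
    hM.integrableOn_mul (continuousOn_const.mul (hpow _).continuousOn)
  have i2 : IntegrableOn (fun r => -(r ^ ((d : ℝ) - s) * deriv M r)) (Ioi 0) :=
    (hM.deriv.mul_left (hpow _)).integrableOn.neg
  rw [setIntegral_congr_fun measurableSet_Ioi e1, setIntegral_congr_fun measurableSet_Ioi e2,
    ← integral_sub i1 i2]
  refine Eq.trans (setIntegral_congr_fun measurableSet_Ioi fun r hr => ?_) hB.integral_deriv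
  have hr : 0 < r := hr
  have := ((Real.hasDerivAt_rpow_const (p := (d : ℝ) - s) (Or.inl hr.ne')).mul
    (hM.hasDerivAt hr)).deriv
  rw [show (fun r : ℝ => r ^ ((d : ℝ) - s) * M r) =
    (fun r : ℝ => r ^ ((d : ℝ) - s)) * M from rfl, this]
  ring

/-- `∂ᵢ|φ|² = 2 Re(φ conj ∂ᵢφ)`, followed by Cauchy–Schwarz in the value and then in the index `i`.
-/
lemma sum_coord_mul_partialDeriv_normSq_le {φ : Euc d → 𝕜} (hφ : IsCoreFunction φ) (x : Euc d) :
    |∑ i, x i * partialDeriv i (fun y => ‖φ y‖ ^ 2) x| ≤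
      2 * ‖x‖ * ‖φ x‖ * √(∑ i, ‖partialDeriv i φ x‖ ^ 2) := by
  have h1 : ∀ i, partialDeriv i (fun y => ‖φ y‖ ^ 2) x =
      2 * inner ℝ (φ x) (partialDeriv i φ x) := by
    intro i
    simp only [partialDeriv]
    rw [(hφ.differentiable x).hasFDerivAt.norm_sq.fderiv]
    simp
  have h2 : |∑ i, x i * partialDeriv i (fun y => ‖φ y‖ ^ 2) x| ≤
      2 * ‖φ x‖ * ∑ i, |x i| * ‖partialDeriv i φ x‖ := by
    rw [Finset.mul_sum]
    refine (Finset.abs_sum_le_sum_abs _ _).trans (Finset.sum_le_sum fun i _ => ?_)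
    rw [h1, abs_mul, abs_mul, abs_two]
    have := abs_real_inner_le_norm (φ x) (partialDeriv i φ x)
    calc |x i| * (2 * |inner ℝ (φ x) (partialDeriv i φ x)|)
        ≤ |x i| * (2 * (‖φ x‖ * ‖partialDeriv i φ x‖)) := by gcongr
      _ = _ := by ring
  refine h2.trans ?_
  have h3 : ∑ i, |x i| * ‖partialDeriv i φ x‖ ≤
      ‖x‖ * √(∑ i, ‖partialDeriv i φ x‖ ^ 2) := by
    have := Real.sum_mul_le_sqrt_mul_sqrt Finset.univ (fun i => |x i|)
      (fun i => ‖partialDeriv i φ x‖)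
    rwa [EuclideanSpace.norm_eq]
  calc _ ≤ 2 * ‖φ x‖ * (‖x‖ * √(∑ i, ‖partialDeriv i φ x‖ ^ 2)) := by gcongr
    _ = _ := by ring

/-- A potential with a singularity weaker than `|x| ^ (-2)` has relative form bound `0`. -/
lemma integral_rpow_mul_normSq_le (hd : 2 ≤ d) {s : ℝ} (hs1 : 1 ≤ s) (hs2 : s < 2)
    {ε : ℝ} (hε : 0 < ε) : ∃ C : ℝ, 0 < C ∧ ∀ φ : Euc d → 𝕜, IsCoreFunction φ →
      ∫ x, ‖x‖ ^ (-s) * ‖φ x‖ ^ 2 ≤ ε * gradSq φ + C * l2Sq φ := by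
  have hds : 0 < (d : ℝ) - s := by
    have : (2 : ℝ) ≤ d := by exact_mod_cast hd
    linarith
  -- The divergence identity has `(d-s) = 2η` on the left, positive because `s < 2 ≤ d`. One `η`
  -- absorbs the weighted term that reappears on the right, the other remains.
  set η := ((d : ℝ) - s) / 2 with hη
  have hη0 : 0 < η := by positivity
  obtain ⟨C, hC0, hC⟩ := exists_rpow_two_sub_le hs1 hs2 (δ := ε * η) (by positivity) hη0
  refine ⟨C / η, by positivity, fun φ hφ => ?_⟩
  have key := integral_rpow_norm_mul (by omega) hφ.normSq s
  have hpow : ContinuousOn (fun x : Euc d => ‖x‖ ^ (-s)) {0}ᶜ :=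
    continuousOn_radial (v := fun r => r ^ (-s)) fun r hr =>
      (Real.continuousAt_rpow_const _ _ (Or.inl (mem_Ioi.1 hr).ne')).continuousWithinAt
  have hi1 : Integrable fun x => ‖x‖ ^ (-s) * ‖φ x‖ ^ 2 := hφ.normSq.integrable_mul hpow
  have hi2 : Integrable fun x => ‖x‖ ^ (-s) * ∑ i, x i *
      partialDeriv i (fun y => ‖φ y‖ ^ 2) x := by
    simp_rw [Finset.mul_sum, ← mul_assoc]
    exact integrable_finsetSum _ fun i _ =>
      (hφ.normSq.partialDeriv i).integrable_mul (hpow.mul (continuous_coord i).continuousOn)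
  have hi3 : Integrable fun x => ∑ i, ‖partialDeriv i φ x‖ ^ 2 :=
    integrable_finsetSum _ fun i _ => (hφ.partialDeriv i).normSq.integrable
  have hi4 : Integrable fun x => η * (‖x‖ ^ (-s) * ‖φ x‖ ^ 2) + C * ‖φ x‖ ^ 2 :=
    (hi1.const_mul _).add (hφ.normSq.integrable.const_mul _)
  have hle : - ∫ x, ‖x‖ ^ (-s) * ∑ i, x i * partialDeriv i (fun y => ‖φ y‖ ^ 2) x ≤
      ε * η * gradSq φ + (η * (∫ x, ‖x‖ ^ (-s) * ‖φ x‖ ^ 2) + C * l2Sq φ) := by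
    rw [gradSq, l2Sq, ← integral_const_mul, ← integral_const_mul, ← integral_const_mul,
      ← integral_neg, ← integral_add (hi1.const_mul _) (hφ.normSq.integrable.const_mul _),
      ← integral_add (hi3.const_mul _) hi4]
    refine integral_mono_ae hi2.neg ((hi3.const_mul _).add hi4) ?_
    have : Nonempty (Fin d) := ⟨⟨0, by omega⟩⟩
    filter_upwards [compl_mem_ae_iff.2 (measure_singleton (0 : Euc d))] with x hx
    have ht : 0 < ‖x‖ := norm_pos_iff.2 hx
    set T := ∑ i, ‖partialDeriv i φ x‖ ^ 2
    have hT : 0 ≤ T := Finset.sum_nonneg fun _ _ => by positivity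
    have h1 := sum_coord_mul_partialDeriv_normSq_le hφ x
    have h2 : -(‖x‖ ^ (-s) * ∑ i, x i * partialDeriv i (fun y => ‖φ y‖ ^ 2) x) ≤
        2 * (‖x‖ ^ (1 - s) * ‖φ x‖) * √T := by
      have h3 : ‖x‖ ^ (1 - s) = ‖x‖ ^ (-s) * ‖x‖ := by
        rw [← Real.rpow_add_one ht.ne']
        congr 1
        ring
      rw [h3, ← mul_neg]
      calc _ ≤ ‖x‖ ^ (-s) * (2 * ‖x‖ * ‖φ x‖ * √T) := by
            gcongr
            exact (neg_le_abs _).trans h1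
        _ = _ := by ring
    have h4 : 2 * (‖x‖ ^ (1 - s) * ‖φ x‖) * √T ≤
        ε * η * T + (ε * η)⁻¹ * (‖x‖ ^ (2 - 2 * s) * ‖φ x‖ ^ 2) := by
      have h5 : ‖x‖ ^ (2 - 2 * s) = (‖x‖ ^ (1 - s)) ^ 2 := by
        rw [← Real.rpow_natCast, ← Real.rpow_mul ht.le]
        congr 1
        push_cast
        ring
      set p := ‖x‖ ^ (1 - s) * ‖φ x‖
      have h6 : 0 ≤ (ε * η)⁻¹ * (ε * η * √T - p) ^ 2 := by positivity
      have h7 : (ε * η)⁻¹ * (ε * η * √T - p) ^ 2 =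
          ε * η * √T ^ 2 + (ε * η)⁻¹ * p ^ 2 - 2 * p * √T := by
        field_simp
        ring
      rw [Real.sq_sqrt hT] at h7
      rw [h5, ← mul_pow]
      linarith
    have h8 : (ε * η)⁻¹ * (‖x‖ ^ (2 - 2 * s) * ‖φ x‖ ^ 2) ≤
        η * (‖x‖ ^ (-s) * ‖φ x‖ ^ 2) + C * ‖φ x‖ ^ 2 := by
      have := mul_le_mul_of_nonneg_right (hC ‖x‖ ht) (sq_nonneg ‖φ x‖)
      linarith
    linarith
  have h9 : η * ∫ x, ‖x‖ ^ (-s) * ‖φ x‖ ^ 2 ≤ ε * η * gradSq φ + C * l2Sq φ := by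
    have : (d : ℝ) - s = 2 * η := by rw [hη]; ring
    rw [this] at key
    linarith
  rw [← mul_le_mul_iff_right₀ hη0]
  calc _ ≤ _ := h9
    _ = _ := by field_simp

/-- The form domain norm controls the gradient. -/
lemma gradSq_le_form (hd : 2 ≤ d) {v : ℝ → ℝ} (hv : ContinuousOn v (Ioi 0)) {s K : ℝ}
    (hs1 : 1 ≤ s) (hs2 : s < 2) (hK : 0 < K) (hvK : ∀ r, 0 < r → -(K * (1 + r ^ (-s))) ≤ v r) :
    ∃ C : ℝ, 0 < C ∧ ∀ φ : Euc d → 𝕜, IsCoreFunction φ →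
      gradSq φ ≤ 2 * RCLike.re (schroedingerForm (radialPotential v) φ φ) + C * l2Sq φ := by
  -- With `ε = (2K)⁻¹` the negative part of the potential costs half of the gradient term, whence
  -- the factor `2` in the conclusion.
  obtain ⟨C, hC0, hC⟩ := integral_rpow_mul_normSq_le (𝕜 := 𝕜) hd hs1 hs2
    (ε := (2 * K)⁻¹) (by positivity)
  refine ⟨2 * K * (1 + C), by positivity, fun φ hφ => ?_⟩
  have hpow : ContinuousOn (fun x : Euc d => ‖x‖ ^ (-s)) {0}ᶜ :=
    continuousOn_radial (v := fun r => r ^ (-s)) fun r hr =>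
      (Real.continuousAt_rpow_const _ _ (Or.inl (mem_Ioi.1 hr).ne')).continuousWithinAt
  have hi1 : Integrable fun x => ‖x‖ ^ (-s) * ‖φ x‖ ^ 2 := hφ.normSq.integrable_mul hpow
  have hi2 : Integrable fun x => v ‖x‖ * ‖φ x‖ ^ 2 :=
    hφ.normSq.integrable_mul (continuousOn_radial hv)
  have h1 : -(K * (l2Sq φ + ∫ x, ‖x‖ ^ (-s) * ‖φ x‖ ^ 2)) ≤ ∫ x, v ‖x‖ * ‖φ x‖ ^ 2 := by
    rw [l2Sq, ← integral_add hφ.normSq.integrable hi1, ← integral_const_mul, ← integral_neg]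
    refine integral_mono_ae ((hφ.normSq.integrable.add hi1).const_mul K).neg hi2 ?_
    have : Nonempty (Fin d) := ⟨⟨0, by omega⟩⟩
    filter_upwards [compl_mem_ae_iff.2 (measure_singleton (0 : Euc d))] with x hx
    have := mul_le_mul_of_nonneg_right (hvK ‖x‖ (norm_pos_iff.2 hx)) (sq_nonneg ‖φ x‖)
    linarith
  have h2 := mul_le_mul_of_nonneg_left (hC φ hφ) hK.le
  have h3 : K * ((2 * K)⁻¹ * gradSq φ + C * l2Sq φ) = gradSq φ / 2 + K * C * l2Sq φ := by
    field_simp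
  rw [re_schroedingerForm_self hφ hv]
  linarith

/-! ### Energy of a harmonic component -/

/-- With `F = r ^ (-n) f` one has `r ^ (2n) |F'|² = |f' - n f/r|²`. Its cross term `-n r ^ (d-2)
(|f|²)'` is an exact derivative plus `n(d-2) r ^ (d-3) |f|²`; together with the square `n²/r²` this
gives the centrifugal coefficient `n(n+d-2)`. -/
lemma re_schroedingerForm_harmProj (hd : 2 ≤ d) {v : ℝ → ℝ} (hv : ContinuousOn v (Ioi 0))
    {φ : Euc d → 𝕜} (hφ : IsCoreFunction φ) {n : ℕ} {h : MvPolynomial (Fin d) ℝ}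
    (hh : IsHarmonicPoly n h) :
    RCLike.re (schroedingerForm (radialPotential v) φ (harmProj n h φ)) =
      (∫ r in Ioi (0 : ℝ), r ^ (d - 1) * ‖deriv (sphMean φ (polyFun h)) r‖ ^ 2) +
      ∫ r in Ioi (0 : ℝ), (r ^ (d - 1) * (v r + n * (n + d - 2) / r ^ 2)) *
        ‖sphMean φ (polyFun h) r‖ ^ 2 := by
  obtain ⟨k, rfl⟩ : ∃ k, d = k + 2 := ⟨d - 2, by omega⟩
  simp only [show k + 2 - 1 = k + 1 by omega]
  set F := radCoeff n h φ with hF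
  set f := sphMean φ (polyFun h) with hf
  have hFb : IsRadialBump F := hφ.isRadialBump_radCoeff n h
  have hfb : IsRadialBump f := hφ.isRadialBump_sphMean (continuous_polyFun h)
  have hpow : ∀ j : ℕ, ContDiffOn ℝ ∞ (fun r : ℝ => r ^ j) (Ioi 0) :=
    fun j => (contDiff_id.pow _).contDiffOn
  have hi1 : IntegrableOn (fun r : ℝ => ((r ^ (k + 1 + 2 * n) : ℝ) : 𝕜) *
      (deriv F r * conj (deriv F r))) (Ioi 0) :=
    ((hFb.deriv.mul hFb.deriv.conjugate).ofReal_mul (hpow _)).integrableOn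
  have hi2 : IntegrableOn (fun r : ℝ => ((r ^ (k + 1 + 2 * n) : ℝ) : 𝕜) *
      ((v r : 𝕜) * (F r * conj (F r)))) (Ioi 0) := by
    have := (hFb.mul hFb.conjugate).integrableOn_mul
      (c := fun r => ((r ^ (k + 1 + 2 * n) : ℝ) : 𝕜) * (v r : 𝕜))
      ((RCLike.continuous_ofReal.comp (continuous_pow _)).continuousOn.mul
        (RCLike.continuous_ofReal.comp_continuousOn hv))
    simpa only [mul_assoc] using this
  have hB : IsRadialBump (fun r : ℝ => r ^ k * ‖f r‖ ^ 2) := hfb.normSq.mul_left (hpow k)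
  have hinvc : ContinuousOn (fun r : ℝ => ((n : ℝ) * (n + (k + 2 : ℕ) - 2) / r ^ 2)) (Ioi 0) :=
    continuousOn_const.div (continuous_pow 2).continuousOn
      fun r hr => pow_ne_zero _ (mem_Ioi.1 hr).ne'
  have hi3 : IntegrableOn (fun r : ℝ => r ^ (k + 1) * ‖deriv f r‖ ^ 2) (Ioi 0) :=
    (hfb.deriv.normSq.mul_left (hpow _)).integrableOn
  have hi4 : IntegrableOn (fun r : ℝ => (r ^ (k + 1) * (v r + n * (n + (k + 2 : ℕ) - 2) / r ^ 2)) *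
      ‖f r‖ ^ 2) (Ioi 0) :=
    hfb.normSq.integrableOn_mul ((hpow _).continuousOn.mul (hv.add hinvc))
  have hform := schroedingerForm_harmMul (by omega) hv hφ hFb hh
  rw [harmProj, ← hF, hform]
  simp only [show k + 2 - 1 = k + 1 by omega]
  rw [← integral_add hi1 hi2, ← integral_re (by exact hi1.add hi2), ← integral_add hi3 hi4]
  have hi5 : IntegrableOn (fun r : ℝ => n * deriv (fun r : ℝ => r ^ k * ‖f r‖ ^ 2) r) (Ioi 0) :=
    hB.deriv.integrableOn.const_mul _
  have hi6 : IntegrableOn (fun r : ℝ => r ^ (k + 1) * ‖deriv f r‖ ^ 2 +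
      (r ^ (k + 1) * (v r + n * (n + (k + 2 : ℕ) - 2) / r ^ 2)) * ‖f r‖ ^ 2) (Ioi 0) := hi3.add hi4
  have hfin : ∀ r ∈ Ioi (0 : ℝ), RCLike.re (((r ^ (k + 1 + 2 * n) : ℝ) : 𝕜) *
      (deriv F r * conj (deriv F r)) + ((r ^ (k + 1 + 2 * n) : ℝ) : 𝕜) *
      ((v r : 𝕜) * (F r * conj (F r)))) =
      (r ^ (k + 1) * ‖deriv f r‖ ^ 2 +
        (r ^ (k + 1) * (v r + n * (n + (k + 2 : ℕ) - 2) / r ^ 2)) * ‖f r‖ ^ 2) -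
        n * deriv (fun r : ℝ => r ^ k * ‖f r‖ ^ 2) r := by
    intro r hr
    have hr : 0 < r := hr
    have h1 := ((hasDerivAt_pow k r).mul ((hfb.hasDerivAt hr).norm_sq)).deriv
    rw [show (fun r : ℝ => r ^ k * ‖f r‖ ^ 2) =
      (fun r : ℝ => r ^ k) * (fun r => ‖f r‖ ^ 2) from rfl, h1]
    have e1 : RCLike.re (((r ^ (k + 1 + 2 * n) : ℝ) : 𝕜) *
        (deriv F r * conj (deriv F r)) + ((r ^ (k + 1 + 2 * n) : ℝ) : 𝕜) *
        ((v r : 𝕜) * (F r * conj (F r)))) =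
        r ^ (k + 1 + 2 * n) * (‖deriv F r‖ ^ 2 + v r * ‖F r‖ ^ 2) := by
      rw [RCLike.mul_conj, RCLike.mul_conj, mul_add]
      norm_cast
    have e2 : r ^ (2 * n) * ‖F r‖ ^ 2 = ‖f r‖ ^ 2 := by
      simp only [hF, radCoeff, ← hf, norm_mul, RCLike.norm_ofReal, mul_pow, sq_abs]
      rw [← mul_assoc, inv_pow, pow_mul', inv_pow]
      field_simp
    have e3 : r ^ (2 * n) * ‖deriv F r‖ ^ 2 =
        ‖deriv f r‖ ^ 2 - 2 * (n * r⁻¹) * inner ℝ (f r) (deriv f r) + (n * r⁻¹) ^ 2 * ‖f r‖ ^ 2 := by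
      have e4 : ‖deriv f r - ((n * r⁻¹ : ℝ) : 𝕜) * f r‖ ^ 2 =
          ‖deriv f r‖ ^ 2 - 2 * (n * r⁻¹) * inner ℝ (f r) (deriv f r) +
          (n * r⁻¹) ^ 2 * ‖f r‖ ^ 2 := by
        rw [← RCLike.real_smul_eq_coe_mul, @norm_sub_sq_real, norm_smul, inner_smul_right, mul_pow,
          real_inner_comm, Real.norm_eq_abs, sq_abs]
        ring
      rw [← e4, hF, deriv_radCoeff hφ n h hr, ← hf]
      simp only [norm_mul, RCLike.norm_ofReal, mul_pow, sq_abs]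
      rw [← mul_assoc, inv_pow, pow_mul', inv_pow]
      field_simp
    rw [e1, pow_add, mul_assoc, mul_add, e3, mul_left_comm _ (v r), e2]
    have e5 : (k : ℝ) * r ^ (k - 1) = k * r ^ k / r := by
      rcases k with _ | k
      · simp
      · rw [Nat.add_sub_cancel, pow_succ]
        field_simp
    rw [e5, pow_succ]
    push_cast
    field_simp
    ring
  rw [setIntegral_congr_fun measurableSet_Ioi hfin, integral_sub hi6 hi5, integral_const_mul,
    hB.integral_deriv, mul_zero, sub_zero]

lemma le_re_schroedingerForm_harmProj (hd : 2 ≤ d) {v : ℝ → ℝ} (hv : ContinuousOn v (Ioi 0))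
    {φ : Euc d → 𝕜} (hφ : IsCoreFunction φ) {n : ℕ} {h : MvPolynomial (Fin d) ℝ}
    (hh : IsHarmonicPoly n h)
    (hpos : ∀ r, 0 < r → 0 ≤ v r + n * ((n : ℝ) + d - 2) / r ^ 2) :
    ∫ r in Ioi (0 : ℝ), r ^ (d - 1) * ‖deriv (sphMean φ (polyFun h)) r‖ ^ 2 ≤
      RCLike.re (schroedingerForm (radialPotential v) φ (harmProj n h φ)) := by
  rw [re_schroedingerForm_harmProj hd hv hφ hh]
  refine le_add_of_nonneg_right (setIntegral_nonneg measurableSet_Ioi fun r hr => ?_)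
  have := hpos r hr
  have hr : 0 < r := hr
  positivity

lemma harmProj_sub {φ ψ : Euc d → 𝕜} (hφ : Continuous φ) (hψ : Continuous ψ) (n : ℕ)
    (h : MvPolynomial (Fin d) ℝ) : harmProj n h (φ - ψ) = harmProj n h φ - harmProj n h ψ := by
  ext x
  simp only [harmProj, harmMul, radialExt, radCoeff, Pi.sub_apply,
    sphMean_sub hφ hψ (continuous_polyFun h)]
  split_ifs
  · simp
  · ring

/-- If the form is bounded below, projecting on a harmonic component does not increase it. -/
lemma re_schroedingerForm_harmProj_le (hd : 1 ≤ d) {v : ℝ → ℝ} (hv : ContinuousOn v (Ioi 0))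
    (hpos : ∀ χ : Euc d → 𝕜, IsCoreFunction χ →
      0 ≤ RCLike.re (schroedingerForm (radialPotential v) χ χ))
    {φ : Euc d → 𝕜} (hφ : IsCoreFunction φ) {n : ℕ} {h : MvPolynomial (Fin d) ℝ}
    (hh : IsHarmonicPoly n h)
    (h1 : ∫ θ : Metric.sphere (0 : Euc d) 1, polyFun h θ * polyFun h θ ∂(surfaceMeasure d) = 1) :
    RCLike.re (schroedingerForm (radialPotential v) (harmProj n h φ) (harmProj n h φ)) ≤
      RCLike.re (schroedingerForm (radialPotential v) φ φ) := by
  have hP := hφ.harmProj n h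
  have e1 := re_schroedingerForm_sub hφ hP hv
  -- By symmetry of the projection `P`, `a(φ - Pφ, φ - Pφ) = a(φ, φ) - a(Pφ, Pφ)` in real parts, and
  -- the left side is nonnegative.
  have e2 : schroedingerForm (radialPotential v) (harmProj n h φ) (harmProj n h φ) =
      schroedingerForm (radialPotential v) φ (harmProj n h φ) :=
    schroedingerForm_harmProj_left hd hv hφ (hφ.isRadialBump_radCoeff n h) hh h1
  have := hpos _ (hφ.sub hP)
  rw [← e2] at e1
  linarith

/-! ### Sequences converging in the form sense -/

lemma IsCoreFunction.memLp {χ : Euc d → 𝕜} (hχ : IsCoreFunction χ) : MemLp χ 2 volume :=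
  hχ.continuous.memLp_of_hasCompactSupport hχ.compact

lemma l2Sq_eq_eLpNorm {χ : Euc d → 𝕜} (hχ : IsCoreFunction χ) :
    l2Sq χ = (eLpNorm χ 2 volume).toReal ^ 2 := by
  rw [hχ.memLp.eLpNorm_eq_integral_rpow_norm (by simp) (by simp), ENNReal.toReal_ofReal
    (by positivity)]
  simp only [ENNReal.toReal_ofNat, Real.rpow_ofNat]
  have h0 : 0 ≤ ∫ x, ‖χ x‖ ^ 2 := l2Sq_nonneg χ
  rw [← Real.rpow_natCast, ← Real.rpow_mul h0]
  norm_num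
  rfl

lemma tendsto_l2Sq_sub {φ : ℕ → Euc d → 𝕜} (hφ : ∀ n, IsCoreFunction (φ n)) {u : Euc d → 𝕜}
    (hu : MemLp u 2 volume)
    (h : Tendsto (fun n => eLpNorm (φ n - u) 2 volume) atTop (𝓝 0)) :
    Tendsto (fun p : ℕ × ℕ => l2Sq (φ p.1 - φ p.2)) atTop (𝓝 0) := by
  have h1 : Tendsto (fun p : ℕ × ℕ => eLpNorm (φ p.1 - u) 2 volume +
      eLpNorm (φ p.2 - u) 2 volume) atTop (𝓝 0) := by
    rw [← prod_atTop_atTop_eq]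
    simpa using (h.comp tendsto_fst).add (h.comp tendsto_snd)
  have h2 : Tendsto (fun p : ℕ × ℕ => eLpNorm (φ p.1 - φ p.2) 2 volume) atTop (𝓝 0) := by
    refine tendsto_of_tendsto_of_tendsto_of_le_of_le tendsto_const_nhds h1 (fun _ => zero_le)
      fun p => ?_
    have : φ p.1 - φ p.2 = (φ p.1 - u) - (φ p.2 - u) := by abel
    simp only
    rw [this]
    exact eLpNorm_sub_le ((hφ _).memLp.sub hu).1 ((hφ _).memLp.sub hu).1 (by norm_num)
  have h3 := ((ENNReal.tendsto_toReal ENNReal.zero_ne_top).comp h2).pow 2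
  simp only [Function.comp_def, ENNReal.toReal_zero, ne_eq, OfNat.ofNat_ne_zero,
    not_false_eq_true, zero_pow] at h3
  refine h3.congr fun p => ?_
  rw [l2Sq_eq_eLpNorm ((hφ _).sub (hφ _))]

lemma tendsto_integral_mul_of_eLpNorm {φ : ℕ → Euc d → 𝕜} (hφ : ∀ n, MemLp (φ n) 2 volume)
    {u : Euc d → 𝕜} (hu : MemLp u 2 volume)
    (h : Tendsto (fun n => eLpNorm (φ n - u) 2 volume) atTop (𝓝 0)) {ψ : Euc d → 𝕜}
    (hψ : MemLp ψ 2 volume) :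
    Tendsto (fun n => ∫ x, φ n x * ψ x) atTop (𝓝 (∫ x, u x * ψ x)) := by
  refine tendsto_integral_of_L1' _ (hu.integrable_mul hψ).aestronglyMeasurable
    (Eventually.of_forall fun n => (hφ n).integrable_mul hψ) ?_
  have h1 : Tendsto (fun n => eLpNorm (φ n - u) 2 volume * eLpNorm ψ 2 volume) atTop (𝓝 0) := by
    simpa using ENNReal.Tendsto.mul_const h (Or.inr hψ.eLpNorm_ne_top)
  refine tendsto_of_tendsto_of_tendsto_of_le_of_le tendsto_const_nhds h1 (fun _ => zero_le)
    fun n => ?_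
  have e : (fun x => φ n x * ψ x) - u * ψ = (φ n - u) • ψ := by
    ext x
    simp [sub_mul]
  simp only
  rw [e]
  exact eLpNorm_smul_le_mul_eLpNorm hψ.1 ((hφ n).sub hu).1

lemma exists_forall_ge_of_tendsto_prod {f : ℕ × ℕ → ℝ} (h : Tendsto f atTop (𝓝 0)) {ε : ℝ}
    (hε : 0 < ε) : ∃ N, ∀ m ≥ N, ∀ n ≥ N, f (m, n) < ε := by
  obtain ⟨⟨a, b⟩, hab⟩ := eventually_atTop.1 (h.eventually (gt_mem_nhds hε))
  exact ⟨max a b, fun m hm n hn =>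
    hab (m, n) ⟨(le_max_left _ _).trans hm, (le_max_right _ _).trans hn⟩⟩

/-- Spherical means of a sequence bounded in `H¹` converge locally uniformly on `(0, ∞)`. -/
lemma exists_tendstoUniformlyOn_sphMean {φ : ℕ → Euc d → 𝕜} (hφ : ∀ n, IsCoreFunction (φ n))
    (hN : Tendsto (fun p : ℕ × ℕ => l2Sq (φ p.1 - φ p.2)) atTop (𝓝 0))
    (hd : 1 ≤ d)
    (hT : Tendsto (fun p : ℕ × ℕ => gradSq (φ p.1 - φ p.2)) atTop (𝓝 0))
    {q : Euc d → ℝ} (hq : Continuous q) :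
    ∃ g : ℝ → 𝕜, ContinuousOn g (Ioi 0) ∧ ∀ a, 0 < a →
      TendstoUniformlyOn (fun n => sphMean (φ n) q) g atTop (Ici a) := by
  obtain ⟨C₁, hC₁, h₁⟩ := integral_norm_sphMean_sq_le (𝕜 := 𝕜) hd hq
  obtain ⟨C₂, hC₂, h₂⟩ := integral_norm_deriv_sphMean_sq_le (𝕜 := 𝕜) hd hq
  have hδ : Tendsto (fun p : ℕ × ℕ => C₁ * l2Sq (φ p.1 - φ p.2) + C₂ * gradSq (φ p.1 - φ p.2))
      atTop (𝓝 0) := by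
    simpa using (hN.const_mul C₁).add (hT.const_mul C₂)
  -- The Sobolev inequality with parameter `1`, applied to differences. The weight `x ^ (d-1)` is
  -- bounded below on `[a, ∞)`, so the convergence is uniform there.
  have hbd : ∀ m n x, 0 < x → x ^ (d - 1) * ‖sphMean (φ m) q x - sphMean (φ n) q x‖ ^ 2 ≤
      C₁ * l2Sq (φ m - φ n) + C₂ * gradSq (φ m - φ n) := by
    intro m n x hx
    have hc := (hφ m).sub (hφ n)
    have := (hc.isRadialBump_sphMean hq).pow_mul_norm_sq_le (d - 1) hx one_pos
    rw [sphMean_sub (hφ m).continuous (hφ n).continuous hq] at this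
    linarith [h₁ _ hc, h₂ _ hc]
  have hcau : ∀ a, 0 < a → UniformCauchySeqOn (fun n => sphMean (φ n) q) atTop (Ici a) := by
    intro a ha
    rw [Metric.uniformCauchySeqOn_iff]
    intro ε hε
    obtain ⟨N, hN⟩ := exists_forall_ge_of_tendsto_prod hδ
      (show 0 < a ^ (d - 1) * ε ^ 2 by positivity)
    refine ⟨N, fun m hm n hn x hx => ?_⟩
    have hx : a ≤ x := hx
    have h3 := (hbd m n x (ha.trans_le hx)).trans_lt (hN m hm n hn)
    have h4 : a ^ (d - 1) * ‖sphMean (φ m) q x - sphMean (φ n) q x‖ ^ 2 ≤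
        x ^ (d - 1) * ‖sphMean (φ m) q x - sphMean (φ n) q x‖ ^ 2 := by gcongr
    rw [dist_eq_norm]
    refine lt_of_pow_lt_pow_left₀ 2 hε.le (lt_of_mul_lt_mul_left (h4.trans_lt h3) (by positivity))
  -- The value `0` for `x ≤ 0` is a dummy, so that the limit is a function on all of `ℝ`.
  have hlim : ∀ x, ∃ y, 0 < x → Tendsto (fun n => sphMean (φ n) q x) atTop (𝓝 y) := by
    intro x
    by_cases hx : 0 < x
    · obtain ⟨y, hy⟩ := cauchySeq_tendsto_of_complete ((hcau x hx).cauchySeq self_mem_Ici)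
      exact ⟨y, fun _ => hy⟩
    · exact ⟨0, fun h => absurd h hx⟩
  choose g hg using hlim
  have hunif : ∀ a, 0 < a → TendstoUniformlyOn (fun n => sphMean (φ n) q) g atTop (Ici a) :=
    fun a ha => (hcau a ha).tendstoUniformlyOn_of_tendsto fun x hx => hg x (ha.trans_le hx)
  refine ⟨g, fun x hx => ?_, hunif⟩
  have hx : 0 < x := hx
  have hc : ContinuousOn g (Ici (x / 2)) := (hunif (x / 2) (half_pos hx)).continuousOn
    (Frequently.of_forall fun n => ((hφ n).isRadialBump_sphMean hq).continuousOn.mono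
      fun y hy => (half_pos hx).trans_le hy)
  exact (hc.continuousAt (Ici_mem_nhds (half_lt_self hx))).continuousWithinAt

lemma exists_l2Sq_le {φ : ℕ → Euc d → 𝕜} (hφ : ∀ n, IsCoreFunction (φ n))
    (hN : Tendsto (fun p : ℕ × ℕ => l2Sq (φ p.1 - φ p.2)) atTop (𝓝 0)) :
    ∃ B, ∀ n, l2Sq (φ n) ≤ B := by
  obtain ⟨N, hN⟩ := exists_forall_ge_of_tendsto_prod hN one_pos
  have hle : ∀ n, l2Sq (φ n) ≤ 2 * l2Sq (φ n - φ N) + 2 * l2Sq (φ N) := by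
    intro n
    have i1 := ((hφ n).sub (hφ N)).normSq.integrable
    have i2 := (hφ N).normSq.integrable
    rw [l2Sq, l2Sq, l2Sq, ← integral_const_mul, ← integral_const_mul,
      ← integral_add (i1.const_mul 2) (i2.const_mul 2)]
    refine integral_mono (hφ n).normSq.integrable ((i1.const_mul 2).add (i2.const_mul 2))
      fun x => ?_
    have h1 : ‖φ n x‖ ≤ ‖(φ n - φ N) x‖ + ‖φ N x‖ := by
      simpa using norm_add_le ((φ n - φ N) x) (φ N x)
    have h2 : ‖φ n x‖ ^ 2 ≤ (‖(φ n - φ N) x‖ + ‖φ N x‖) ^ 2 := by gcongr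
    simp only
    nlinarith [sq_nonneg (‖(φ n - φ N) x‖ - ‖φ N x‖)]
  set B := ∑ n ∈ Finset.range N, l2Sq (φ n)
  refine ⟨max B (2 * 1 + 2 * l2Sq (φ N)), fun n => ?_⟩
  rcases lt_or_ge n N with h | h
  · exact (Finset.single_le_sum (f := fun n => l2Sq (φ n)) (fun i _ => l2Sq_nonneg _)
      (Finset.mem_range.2 h)).trans (le_max_left _ _)
  · refine (hle n).trans (le_trans ?_ (le_max_right _ _))
    have := hN n h N le_rfl
    linarith

/-- The harmonic components whose effective potential exceeds the eigenvalue vanish. -/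
lemma tendsto_sphMean_zero {φ : ℕ → Euc d → 𝕜} (hφ : ∀ n, IsCoreFunction (φ n))
    (hN : Tendsto (fun p : ℕ × ℕ => l2Sq (φ p.1 - φ p.2)) atTop (𝓝 0))
    (hd : 2 ≤ d) {v : ℝ → ℝ} (hv : ContinuousOn v (Ioi 0)) {lam C : ℝ}
    (hC : ∀ χ : Euc d → 𝕜, IsCoreFunction χ →
      gradSq χ ≤ 2 * RCLike.re (schroedingerForm (radialPotential v) χ χ) + C * l2Sq χ)
    (hQ : Tendsto (fun p : ℕ × ℕ => RCLike.re (schroedingerForm (radialPotential v)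
      (φ p.1 - φ p.2) (φ p.1 - φ p.2))) atTop (𝓝 0))
    (hweak : ∀ ψ : Euc d → 𝕜, IsCoreFunction ψ → Tendsto (fun n =>
      schroedingerForm (radialPotential fun r => v r - lam) (φ n) ψ) atTop (𝓝 0))
    {n : ℕ} {h : MvPolynomial (Fin d) ℝ} (hh : IsHarmonicPoly n h)
    (h1 : ∫ θ : Metric.sphere (0 : Euc d) 1, polyFun h θ * polyFun h θ ∂(surfaceMeasure d) = 1)
    (hpos : ∀ r, 0 < r → lam ≤ v r + n * ((n : ℝ) + d - 2) / r ^ 2) {x : ℝ} (hx : 0 < x) :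
    Tendsto (fun m => sphMean (φ m) (polyFun h) x) atTop (𝓝 0) := by
  have hv1 : ContinuousOn (fun r => v r - lam) (Ioi 0) := hv.sub continuousOn_const
  set a : (Euc d → 𝕜) → (Euc d → 𝕜) → 𝕜 :=
    schroedingerForm (radialPotential fun r => v r - lam) with ha
  set Q : (Euc d → 𝕜) → ℝ := fun χ => RCLike.re (a (harmProj n h χ) (harmProj n h χ)) with hQdef
  have hleft : ∀ χ ψ : Euc d → 𝕜, IsCoreFunction χ → IsCoreFunction ψ →
      a (harmProj n h χ) (harmProj n h ψ) = a χ (harmProj n h ψ) := fun χ ψ hχ hψ =>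
    schroedingerForm_harmProj_left (by omega) hv1 hχ (hψ.isRadialBump_radCoeff n h) hh h1
  have hlow : ∀ χ : Euc d → 𝕜, IsCoreFunction χ →
      ∫ r in Ioi (0 : ℝ), r ^ (d - 1) * ‖deriv (sphMean χ (polyFun h)) r‖ ^ 2 ≤ Q χ := by
    intro χ hχ
    simp only [hQdef]
    rw [hleft χ χ hχ hχ]
    exact le_re_schroedingerForm_harmProj hd hv1 hχ hh fun r hr => by linarith [hpos r hr]
  have hQ0 : ∀ χ : Euc d → 𝕜, IsCoreFunction χ → 0 ≤ Q χ := fun χ hχ =>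
    (setIntegral_nonneg measurableSet_Ioi fun r hr => by
      have hr : 0 < r := hr
      positivity).trans (hlow χ hχ)
  -- The shift by `|C| + |lam|` makes the form nonnegative, so projecting does not increase it; it
  -- also exceeds the shift by `-lam` that appears in `Q`.
  have hup : ∀ χ : Euc d → 𝕜, IsCoreFunction χ →
      Q χ ≤ RCLike.re (schroedingerForm (radialPotential v) χ χ) +
        (|C| + |lam|) * l2Sq χ := by
    intro χ hχ
    set c : ℝ := -(|C| + |lam|)
    have hv2 : ContinuousOn (fun r => v r - c) (Ioi 0) := hv.sub continuousOn_const
    have e1 : ∀ χ : Euc d → 𝕜, IsCoreFunction χ →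
        RCLike.re (schroedingerForm (radialPotential fun r => v r - c) χ χ) =
          RCLike.re (schroedingerForm (radialPotential v) χ χ) - c * l2Sq χ :=
      fun χ hχ => re_schroedingerForm_sub_const hχ hv c
    have e2 := re_schroedingerForm_harmProj_le (𝕜 := 𝕜) (by omega) hv2 (fun χ hχ => by
      rw [e1 χ hχ]
      have k1 := hC χ hχ
      have k2 := gradSq_nonneg χ
      have k3 := l2Sq_nonneg χ
      have k4 := mul_le_mul_of_nonneg_right (le_abs_self C) k3
      have k5 := mul_nonneg (abs_nonneg C) k3
      have k6 := mul_nonneg (abs_nonneg lam) k3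
      simp only [c]
      linarith) hχ hh h1
    have hP := hχ.harmProj n h
    rw [e1 χ hχ, e1 _ hP] at e2
    simp only [hQdef, ha]
    rw [re_schroedingerForm_sub_const hP hv]
    have k3 := l2Sq_nonneg (harmProj n h χ)
    have k4 := mul_le_mul_of_nonneg_right (neg_abs_le lam) k3
    have k5 := mul_nonneg (abs_nonneg C) k3
    simp only [c] at e2
    linarith
  have hQpair : Tendsto (fun p : ℕ × ℕ => Q (φ p.1 - φ p.2)) atTop (𝓝 0) := by
    refine tendsto_of_tendsto_of_tendsto_of_le_of_le tendsto_const_nhds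
      (by simpa using hQ.add (hN.const_mul (|C| + |lam|)))
      (fun p => hQ0 _ ((hφ _).sub (hφ _))) fun p => hup _ ((hφ _).sub (hφ _))
  have hpar : ∀ i j, Q (φ i - φ j) = Q (φ i) + Q (φ j) - 2 * RCLike.re (a (φ i)
      (harmProj n h (φ j))) := by
    intro i j
    simp only [hQdef]
    rw [harmProj_sub (hφ i).continuous (hφ j).continuous, ← hleft _ _ (hφ i) (hφ j)]
    exact re_schroedingerForm_sub ((hφ i).harmProj n h) ((hφ j).harmProj n h) hv1
  -- Expand `Q(φ i - φ m)` and let `i → ∞` with `m` fixed. The projection of `φ m` is an admissible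
  -- test function, so the cross term tends to zero by the weak equation. As `Q(φ i) ≥ 0`, `Q(φ m)`
  -- is controlled by the small quantity `Q(φ i - φ m)`.
  have hQlim : Tendsto (fun m => Q (φ m)) atTop (𝓝 0) := by
    rw [Metric.tendsto_atTop]
    intro ε hε
    obtain ⟨N, hN'⟩ := exists_forall_ge_of_tendsto_prod hQpair (half_pos hε)
    refine ⟨N, fun m hm => ?_⟩
    have h2 : Tendsto (fun i => ε / 2 + 2 * RCLike.re (a (φ i) (harmProj n h (φ m)))) atTop
        (𝓝 (ε / 2 + 2 * 0)) := by
      refine (Tendsto.const_mul 2 ?_).const_add _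
      have := (RCLike.continuous_re.tendsto _).comp (hweak _ ((hφ m).harmProj n h))
      simpa [Function.comp_def] using this
    have h3 : Q (φ m) ≤ ε / 2 + 2 * 0 := by
      refine ge_of_tendsto h2 ?_
      filter_upwards [eventually_ge_atTop N] with i hi
      have k1 := hN' i hi m hm
      simp only [hpar] at k1
      linarith [hQ0 _ (hφ i)]
    rw [Real.dist_eq, sub_zero, abs_of_nonneg (hQ0 _ (hφ m))]
    linarith
  obtain ⟨C₁, hC₁, hb₁⟩ := integral_norm_sphMean_sq_le (𝕜 := 𝕜) (by omega : 1 ≤ d)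
    (continuous_polyFun h)
  obtain ⟨B, hB⟩ := exists_l2Sq_le hφ hN
  have hB0 : 0 ≤ B := (l2Sq_nonneg _).trans (hB 0)
  rw [Metric.tendsto_atTop]
  intro ε hε
  have hη : 0 < x ^ (d - 1) * ε ^ 2 := by positivity
  set η := x ^ (d - 1) * ε ^ 2
  -- The Sobolev parameter is small enough that the bounded `L²` term costs at most `η/2`; the
  -- derivative term is then made smaller than `η/2` by taking `Q(φ m) < tη/2`.
  set t := η / (2 * (C₁ * B + 1)) with ht
  have hden : 0 < 2 * (C₁ * B + 1) := by positivity
  have ht0 : 0 < t := by positivity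
  obtain ⟨N, hN'⟩ := Metric.tendsto_atTop.1 hQlim (t * η / 2) (by positivity)
  refine ⟨N, fun m hm => ?_⟩
  have k1 := hN' m hm
  rw [Real.dist_eq, sub_zero, abs_of_nonneg (hQ0 _ (hφ m))] at k1
  have k2 := ((hφ m).isRadialBump_sphMean (continuous_polyFun h)).pow_mul_norm_sq_le (d - 1) hx ht0
  have k3 : t * (∫ r in Ioi (0 : ℝ), r ^ (d - 1) * ‖sphMean (φ m) (polyFun h) r‖ ^ 2) ≤
      t * (C₁ * B) :=
    mul_le_mul_of_nonneg_left ((hb₁ _ (hφ m)).trans (by gcongr; exact hB m)) ht0.le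
  have k4 : t⁻¹ * (∫ r in Ioi (0 : ℝ), r ^ (d - 1) *
      ‖deriv (sphMean (φ m) (polyFun h)) r‖ ^ 2) < t⁻¹ * (t * η / 2) :=
    mul_lt_mul_of_pos_left ((hlow _ (hφ m)).trans_lt k1) (inv_pos.2 ht0)
  have k5 : t⁻¹ * (t * η / 2) = η / 2 := by field_simp
  have k6 : t * (C₁ * B) ≤ η / 2 := by
    have : t * (2 * (C₁ * B + 1)) = η := by rw [ht]; field_simp
    nlinarith
  rw [dist_zero_right]
  refine lt_of_pow_lt_pow_left₀ 2 hε.le (lt_of_mul_lt_mul_left (a := x ^ (d - 1)) ?_ (by positivity))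
  linarith

/-! ### Decomposition of polynomials into harmonic polynomials -/

/-- The polynomial `|x|²`. -/
def sqNormPoly (d : ℕ) : MvPolynomial (Fin d) ℝ := ∑ i, MvPolynomial.X i ^ 2

lemma polyFun_sqNormPoly (x : Euc d) : polyFun (sqNormPoly d) x = ‖x‖ ^ 2 := by
  simp [polyFun, sqNormPoly, EuclideanSpace.norm_sq_eq]

lemma isHomogeneous_sqNormPoly : (sqNormPoly d).IsHomogeneous 2 :=
  MvPolynomial.IsHomogeneous.sum _ _ _ fun i _ => MvPolynomial.isHomogeneous_X_pow i 2

lemma pderiv_sqNormPoly (i : Fin d) :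
    MvPolynomial.pderiv i (sqNormPoly d) = 2 * MvPolynomial.X i := by
  simp [sqNormPoly, MvPolynomial.pderiv_X, Pi.single_apply]

/-- `Δ(|x|²p) = 2d p + 4 x·∇p + |x|²Δp`, and Euler's identity evaluates the middle term. -/
lemma polyLaplacian_sqNormPoly_mul {n : ℕ} {p : MvPolynomial (Fin d) ℝ} (hp : p.IsHomogeneous n) :
    polyLaplacian (sqNormPoly d * p) = ((2 * d + 4 * n : ℝ)) • p +
      sqNormPoly d * polyLaplacian p := by
  have h1 : ∀ i, MvPolynomial.pderiv i (MvPolynomial.pderiv i (sqNormPoly d * p)) =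
      2 * p + 4 * (MvPolynomial.X i * MvPolynomial.pderiv i p) +
      sqNormPoly d * MvPolynomial.pderiv i (MvPolynomial.pderiv i p) := by
    intro i
    have h2 : MvPolynomial.pderiv i (2 : MvPolynomial (Fin d) ℝ) = 0 := by
      exact_mod_cast MvPolynomial.pderiv_C (R := ℝ) (i := i) (a := 2)
    simp only [Derivation.leibniz, smul_eq_mul, map_add, pderiv_sqNormPoly,
      MvPolynomial.pderiv_X_self, h2]
    ring
  rw [polyLaplacian_apply, Finset.sum_congr rfl fun i _ => h1 i, Finset.sum_add_distrib,
    Finset.sum_add_distrib, ← Finset.mul_sum Finset.univ _ (4 : MvPolynomial (Fin d) ℝ),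
    hp.sum_X_mul_pderiv, ← Finset.mul_sum Finset.univ _ (sqNormPoly d), ← polyLaplacian_apply, MvPolynomial.smul_eq_C_mul]
  simp only [Finset.sum_const, Finset.card_univ, Fintype.card_fin, nsmul_eq_mul, map_add, map_mul,
    map_ofNat, map_natCast]
  ring

lemma IsHomogeneous_sqNormPoly_pow_mul {m : ℕ} {h : MvPolynomial (Fin d) ℝ}
    (hh : h.IsHomogeneous m) (i : ℕ) : (sqNormPoly d ^ i * h).IsHomogeneous (2 * i + m) :=
  (isHomogeneous_sqNormPoly.pow i).mul hh

/-- Each `|x|^(2i) h` is an eigenvector of `p ↦ Δ(|x|²p)`; every induction step adds a positive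
number to the eigenvalue. -/
lemma polyLaplacian_sqNormPoly_pow_mul (hd : 1 ≤ d) {m : ℕ} {h : MvPolynomial (Fin d) ℝ}
    (hh : IsHarmonicPoly m h) (i : ℕ) : ∃ α : ℝ, 0 < α ∧
      polyLaplacian (sqNormPoly d * (sqNormPoly d ^ i * h)) = α • (sqNormPoly d ^ i * h) := by
  have hd' : (0 : ℝ) < d := by exact_mod_cast hd
  induction i with
  | zero =>
    refine ⟨2 * d + 4 * m, by positivity, ?_⟩
    rw [pow_zero, one_mul, polyLaplacian_sqNormPoly_mul hh.homogeneous, hh.laplacian_eq_zero]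
    simp
  | succ i ih =>
    obtain ⟨α, hα, e⟩ := ih
    refine ⟨2 * d + 4 * ((2 * (i + 1) + m : ℕ) : ℝ) + α, by positivity, ?_⟩
    rw [polyLaplacian_sqNormPoly_mul (IsHomogeneous_sqNormPoly_pow_mul hh.homogeneous (i + 1)),
      pow_succ', mul_assoc, e, add_smul (2 * (d : ℝ) + _), mul_smul_comm]

/-- The span of the products of powers of `|x|²` and harmonic polynomials, in degree `k`. -/
def harmonicSpan (d k : ℕ) : Submodule ℝ (MvPolynomial (Fin d) ℝ) :=
  Submodule.span ℝ {p | ∃ i m h, 2 * i + m = k ∧ IsHarmonicPoly m h ∧ p = sqNormPoly d ^ i * h}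

/-- Dividing generators by their positive eigenvalues inverts `q ↦ Δ(|x|²q)` on the span. -/
lemma exists_polyLaplacian_sqNormPoly_mul_eq (hd : 1 ≤ d) {k : ℕ} {p : MvPolynomial (Fin d) ℝ}
    (hp : p ∈ harmonicSpan d k) :
    ∃ q, q.IsHomogeneous k ∧ polyLaplacian (sqNormPoly d * q) = p := by
  induction hp using Submodule.span_induction with
  | mem p hp =>
    obtain ⟨i, m, h, hk, hh, rfl⟩ := hp
    obtain ⟨α, hα, e⟩ := polyLaplacian_sqNormPoly_pow_mul hd hh i
    refine ⟨α⁻¹ • (sqNormPoly d ^ i * h), ?_, ?_⟩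
    · rw [MvPolynomial.smul_eq_C_mul, ← hk]
      exact (IsHomogeneous_sqNormPoly_pow_mul hh.homogeneous i).C_mul _
    · rw [mul_smul_comm, map_smul, e, smul_smul, inv_mul_cancel₀ hα.ne', one_smul]
  | zero => exact ⟨0, MvPolynomial.isHomogeneous_zero _ _ _, by simp⟩
  | add p q _ _ hp hq =>
    obtain ⟨p', hp', e⟩ := hp
    obtain ⟨q', hq', e'⟩ := hq
    exact ⟨p' + q', hp'.add hq', by rw [mul_add, map_add, e, e']⟩
  | smul c p _ hp =>
    obtain ⟨p', hp', e⟩ := hp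
    refine ⟨c • p', ?_, by rw [mul_smul_comm, map_smul, e]⟩
    rw [MvPolynomial.smul_eq_C_mul]
    exact hp'.C_mul c

lemma polyLaplacian_eq_zero_of_lt_two {k : ℕ} (hk : k < 2) {p : MvPolynomial (Fin d) ℝ}
    (hp : p.IsHomogeneous k) : polyLaplacian p = 0 := by
  rw [polyLaplacian_apply]
  refine Finset.sum_eq_zero fun i _ => ?_
  have h1 : (MvPolynomial.pderiv i p).IsHomogeneous 0 := by
    have := hp.pderiv (i := i)
    rwa [show k - 1 = 0 by omega] at this
  rw [MvPolynomial.totalDegree_eq_zero_iff_eq_C.1 (Nat.le_zero.1 h1.totalDegree_le),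
    MvPolynomial.pderiv_C]

lemma sqNormPoly_mul_mem_harmonicSpan {k : ℕ} {p : MvPolynomial (Fin d) ℝ}
    (hp : p ∈ harmonicSpan d k) : sqNormPoly d * p ∈ harmonicSpan d (k + 2) := by
  induction hp using Submodule.span_induction with
  | mem p hp =>
    obtain ⟨i, m, h, hk, hh, rfl⟩ := hp
    exact Submodule.subset_span ⟨i + 1, m, h, by omega, hh, by rw [pow_succ', mul_assoc]⟩
  | zero => simp
  | add p q _ _ hp hq => rw [mul_add]; exact add_mem hp hq
  | smul c p _ hp => rw [mul_smul_comm]; exact Submodule.smul_mem _ _ hp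

/-- By induction `Δp` lies in the span two degrees lower, so some `q` satisfies `Δ(|x|²q) = Δp`.
Then `p - |x|²q` is harmonic, and `q` is handled by induction. -/
lemma mem_harmonicSpan (hd : 1 ≤ d) (k : ℕ) {p : MvPolynomial (Fin d) ℝ}
    (hp : p.IsHomogeneous k) : p ∈ harmonicSpan d k := by
  induction k using Nat.strong_induction_on generalizing p with
  | _ k ih =>
    rcases lt_or_ge k 2 with hk | hk
    · exact Submodule.subset_span ⟨0, k, p, by omega,
        ⟨hp, polyLaplacian_eq_zero_of_lt_two hk hp⟩, by simp⟩
    · obtain ⟨j, rfl⟩ : ∃ j, k = j + 2 := ⟨k - 2, by omega⟩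
      have hL : (polyLaplacian p).IsHomogeneous j := by
        rw [polyLaplacian_apply]
        exact MvPolynomial.IsHomogeneous.sum _ _ _ fun i _ => hp.pderiv.pderiv
      obtain ⟨q, hq, e⟩ := exists_polyLaplacian_sqNormPoly_mul_eq hd (ih j (by omega) hL)
      have hnq : (sqNormPoly d * q).IsHomogeneous (j + 2) := by
        rw [add_comm]
        exact isHomogeneous_sqNormPoly.mul hq
      have h0 : IsHarmonicPoly (j + 2) (p - sqNormPoly d * q) :=
        ⟨hp.sub hnq, by rw [map_sub, e, sub_self]⟩
      rw [← sub_add_cancel p (sqNormPoly d * q)]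
      exact add_mem (Submodule.subset_span ⟨0, j + 2, _, by omega, h0, by simp⟩)
        (sqNormPoly_mul_mem_harmonicSpan (ih j (by omega) hq))

/-! ### Orthogonality to lower degrees on the unit sphere -/

lemma integrable_polyFun_mul (p q : MvPolynomial (Fin d) ℝ) :
    Integrable (fun θ : Metric.sphere (0 : Euc d) 1 => polyFun p θ * polyFun q θ)
      (surfaceMeasure d) :=
  integrable_sphere (((continuous_polyFun p).comp continuous_subtype_val).mul
    ((continuous_polyFun q).comp continuous_subtype_val))

/-- Harmonic polynomials are orthogonal to polynomials of smaller degree on the unit sphere. -/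
lemma IsHarmonicPoly.integral_mul_eq_zero_of_totalDegree_lt (hd : 2 ≤ d) {n : ℕ}
    {h q : MvPolynomial (Fin d) ℝ} (hh : IsHarmonicPoly n h) (hq : q.totalDegree < n) :
    ∫ θ : Metric.sphere (0 : Euc d) 1, polyFun q θ * polyFun h θ ∂(surfaceMeasure d) = 0 := by
  let Z : Submodule ℝ (MvPolynomial (Fin d) ℝ) :=
    { carrier := {p | ∫ θ : Metric.sphere (0 : Euc d) 1, polyFun p θ * polyFun h θ
        ∂(surfaceMeasure d) = 0}
      add_mem' := by
        intro p q hp hq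
        simp only [mem_ofPred] at hp hq ⊢
        simp only [polyFun_add, add_mul]
        rw [integral_add (integrable_polyFun_mul p h) (integrable_polyFun_mul q h), hp, hq,
          add_zero]
      zero_mem' := by simp [polyFun]
      smul_mem' := by
        intro c p hp
        simp only [mem_ofPred] at hp ⊢
        simp only [MvPolynomial.smul_eq_C_mul, polyFun_mul, polyFun_C, mul_assoc]
        rw [integral_const_mul, hp, mul_zero] }
  -- On the unit sphere `|x|² = 1`, so each generator reduces to a harmonic polynomial of degree at
  -- most `k < n`.
  have hspan : ∀ k, k < n → harmonicSpan d k ≤ Z := by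
    intro k hk
    refine Submodule.span_le.2 ?_
    rintro _ ⟨i, m, g, hkm, hg, rfl⟩
    change ∫ θ : Metric.sphere (0 : Euc d) 1, polyFun (sqNormPoly d ^ i * g) θ * polyFun h θ
        ∂(surfaceMeasure d) = 0
    rw [← hg.integral_mul_eq_zero hd (by omega : m ≠ n) hh]
    refine integral_congr_ae (Eventually.of_forall fun θ => ?_)
    have : polyFun (sqNormPoly d ^ i) (θ : Euc d) = 1 := by
      have := polyFun_sqNormPoly (θ : Euc d)
      rw [norm_eq_of_mem_sphere θ, one_pow] at this
      simp only [polyFun, map_pow] at this ⊢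
      rw [this, one_pow]
    simp only [polyFun_mul, this, one_mul]
  change q ∈ Z
  rw [← q.sum_homogeneousComponent]
  exact Submodule.sum_mem _ fun k hk => hspan k (by have := Finset.mem_range.1 hk; omega)
    (mem_harmonicSpan (by omega) k (MvPolynomial.homogeneousComponent_isHomogeneous k q))

/-! ### Orthonormal polynomials on the sphere -/

/-- Polynomials as continuous functions on the unit sphere. -/
def sphereRestriction (d : ℕ) :
    MvPolynomial (Fin d) ℝ →ₐ[ℝ] C(Metric.sphere (0 : Euc d) 1, ℝ) :=
  MvPolynomial.aeval fun i => ⟨fun θ => (θ : Euc d) i, by fun_prop⟩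

lemma sphereRestriction_apply (p : MvPolynomial (Fin d) ℝ) (θ : Metric.sphere (0 : Euc d) 1) :
    sphereRestriction d p θ = polyFun p θ := by
  induction p using MvPolynomial.induction_on with
  | C a => simp [sphereRestriction, polyFun]
  | add p q hp hq => simp [polyFun_add, hp, hq]
  | mul_X p j hp =>
    rw [map_mul, ContinuousMap.mul_apply, hp, polyFun_mul, polyFun_X]
    simp [sphereRestriction]

/-- There is a finite family of polynomials of degree at most `L`, orthonormal on the unit sphere,
that spans the polynomials of degree at most `L` on the unit sphere. -/
lemma exists_orthonormal_polynomials (hd : 1 ≤ d) (L : ℕ) :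
    ∃ (N : ℕ) (e : Fin N → MvPolynomial (Fin d) ℝ), (∀ j, (e j).totalDegree ≤ L) ∧
      ∀ q : MvPolynomial (Fin d) ℝ, q.totalDegree ≤ L →
        ∀ θ : Metric.sphere (0 : Euc d) 1, polyFun q θ = ∑ j,
          (∫ η : Metric.sphere (0 : Euc d) 1, polyFun (e j) η * polyFun q η ∂(surfaceMeasure d)) *
            polyFun (e j) θ := by
  have : Nonempty (Fin d) := ⟨⟨0, hd⟩⟩
  let T : MvPolynomial (Fin d) ℝ →ₗ[ℝ] Lp ℝ 2 (surfaceMeasure d) :=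
    (ContinuousMap.toLp (E := ℝ) 2 (surfaceMeasure d) ℝ).toLinearMap ∘ₗ
      (sphereRestriction d).toLinearMap
  have hT : ∀ p, T p = ContinuousMap.toLp (E := ℝ) 2 (surfaceMeasure d) ℝ (sphereRestriction d p) :=
    fun _ => rfl
  let W := (MvPolynomial.restrictTotalDegree (Fin d) ℝ L).map T
  let b := stdOrthonormalBasis ℝ W
  have hb : ∀ j, ∃ p : MvPolynomial (Fin d) ℝ, p.totalDegree ≤ L ∧ T p = b j := by
    intro j
    obtain ⟨p, hp, e⟩ := Submodule.mem_map.1 (b j).2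
    exact ⟨p, (MvPolynomial.mem_restrictTotalDegree _ _ _).1 hp, e⟩
  choose e he heT using hb
  refine ⟨_, e, he, fun q hq θ => ?_⟩
  let w : W := ⟨T q, Submodule.mem_map_of_mem ((MvPolynomial.mem_restrictTotalDegree _ _ _).2 hq)⟩
  have hin : ∀ j, inner ℝ (b j) w =
      ∫ η : Metric.sphere (0 : Euc d) 1, polyFun (e j) η * polyFun q η ∂(surfaceMeasure d) := by
    intro j
    have h1 : inner ℝ (b j) w = inner ℝ (T (e j)) (T q) := by rw [heT j]; rfl
    rw [h1, hT, hT, ContinuousMap.inner_toLp]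
    refine integral_congr_ae (Eventually.of_forall fun η => ?_)
    simp [sphereRestriction_apply, mul_comm]
  have h2 := b.sum_repr' w
  have h3 : T q = T (∑ j, inner ℝ (b j) w • e j) := by
    have := congrArg (Subtype.val) h2
    rw [map_sum]
    simp only [map_smul, heT]
    rw [← show (w : Lp ℝ 2 (surfaceMeasure d)) = T q from rfl, ← this]
    simp
  -- The orthonormal expansion is an equality in `L²`; continuous functions equal in `L²` of the
  -- sphere agree at every point.
  have h4 := ContinuousMap.toLp_injective (E := ℝ) (p := 2) (𝕜 := ℝ) (surfaceMeasure d) h3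
  have h5 := congrArg (fun f : C(Metric.sphere (0 : Euc d) 1, ℝ) => f θ) h4
  rw [← sphereRestriction_apply]
  refine h5.trans ?_
  simp only [← hin, AlgHom.toLinearMap_apply, map_sum, map_smul, ContinuousMap.coe_sum,
    Finset.sum_apply, ContinuousMap.coe_smul, Pi.smul_apply, smul_eq_mul, sphereRestriction_apply]

/-! ### Density of products of radial bumps and harmonic polynomials -/

lemma IsCoreFunction.integrable_smul {g : Euc d → ℝ} (hg : IsCoreFunction g) {z : Euc d → 𝕜}
    (hz : LocallyIntegrableOn z {0}ᶜ) : Integrable fun x => g x • z x := by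
  have hK : tsupport g ⊆ {0}ᶜ := fun x hx h0 => hg.away (by rwa [mem_singleton_iff.1 h0] at hx)
  have h1 : IntegrableOn z (tsupport g) := hz.integrableOn_compact_subset hK hg.compact
  have h2 : IntegrableOn (fun x => g x • z x) (tsupport g) :=
    h1.continuousOn_smul hg.continuous.continuousOn hg.compact
  refine (integrableOn_iff_integrable_of_support_subset fun x hx => ?_).1 h2
  exact subset_tsupport _ fun h0 => hx (by simp [h0])

/-- Polynomials as continuous functions on `ℝ^d`. -/
def polyContinuousMap (d : ℕ) : MvPolynomial (Fin d) ℝ →ₐ[ℝ] C(Euc d, ℝ) :=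
  MvPolynomial.aeval fun i => ⟨fun x => x i, by fun_prop⟩

lemma polyContinuousMap_apply (p : MvPolynomial (Fin d) ℝ) (x : Euc d) :
    polyContinuousMap d p x = polyFun p x := by
  induction p using MvPolynomial.induction_on with
  | C a => simp [polyContinuousMap, polyFun]
  | add p q hp hq => simp [polyFun_add, hp, hq]
  | mul_X p j hp =>
    rw [map_mul, ContinuousMap.mul_apply, hp, polyFun_mul, polyFun_X]
    simp [polyContinuousMap]

lemma exists_polyFun_near {g : Euc d → ℝ} (hg : Continuous g) (b : ℝ) {ε : ℝ} (hε : 0 < ε) :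
    ∃ q : MvPolynomial (Fin d) ℝ, ∀ x : Euc d, ‖x‖ ≤ b → |polyFun q x - g x| < ε := by
  have hsep : (polyContinuousMap d).range.SeparatesPoints := by
    intro x y hxy
    obtain ⟨i, hi⟩ : ∃ i, x i ≠ y i := by
      by_contra! h
      exact hxy (PiLp.ext h)
    refine ⟨fun x => x i, ⟨polyContinuousMap d (MvPolynomial.X i), ⟨_, rfl⟩, ?_⟩, hi⟩
    ext x
    change polyContinuousMap d (MvPolynomial.X i) x = x i
    rw [polyContinuousMap_apply, polyFun_X]
  obtain ⟨_, ⟨q, rfl⟩, hq⟩ :=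
    ContinuousMap.exists_mem_subalgebra_near_continuous_of_isCompact_of_separatesPoints hsep ⟨g, hg⟩
      (isCompact_closedBall (0 : Euc d) b) hε
  refine ⟨q, fun x hx => ?_⟩
  have := hq x (by simpa using hx)
  have e := polyContinuousMap_apply q x
  simpa [← e] using this

lemma exists_isRadialBump_eq_one {a : ℝ} (ha : 0 < a) (b : ℝ) :
    ∃ G : ℝ → ℝ, IsRadialBump G ∧ ∀ r, a ≤ r → r ≤ b → G r = 1 := by
  rcases lt_or_ge b a with hab | hab
  · exact ⟨fun _ => 0, ⟨contDiffOn_const, 1, 1, one_pos, fun _ _ _ => rfl⟩,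
      fun r h1 h2 => absurd (h1.trans h2) (not_le.2 hab)⟩
  let f : ContDiffBump ((a + b) / 2) :=
    ⟨(b - a) / 2 + a / 4, (b - a) / 2 + a / 2, by linarith, by linarith⟩
  refine ⟨f, ⟨f.contDiff.contDiffOn, a / 2, b + a / 2, by linarith, fun r _ hr => ?_⟩,
    fun r h1 h2 => f.one_of_mem_closedBall ?_⟩
  · apply f.zero_of_le_dist
    change (b - a) / 2 + a / 2 ≤ _
    rw [Real.dist_eq]
    rcases hr with hr | hr
    · rw [abs_of_neg (by linarith)]
      linarith
    · rw [abs_of_pos (by linarith)]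
      linarith
  · change r ∈ Metric.closedBall _ ((b - a) / 2 + a / 4)
    rw [Real.closedBall_eq_Icc]
    constructor <;> linarith

/-- A test function `g` equals `G g` for a radial bump `G` that is `1` on its support. If a
polynomial `q` is uniformly close to `g` on the support of `G`, then `∫ g z = ∫ G (g - q) z` is
small. -/
lemma ae_eq_zero_of_integral_radialExt_mul_polyFun {z : Euc d → 𝕜}
    (hz : LocallyIntegrableOn z {0}ᶜ)
    (h : ∀ (G : ℝ → ℝ), IsRadialBump G → ∀ q : MvPolynomial (Fin d) ℝ,
      ∫ x, (radialExt G x * polyFun q x) • z x = 0) : ∀ᵐ x, x ∈ ({0}ᶜ : Set (Euc d)) → z x = 0 := by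
  refine isOpen_compl_singleton.ae_eq_zero_of_integral_contDiff_smul_eq_zero hz
    fun g hgs hgc hgt => ?_
  have hg : IsCoreFunction g := ⟨hgs, hgc, fun h0 => hgt h0 rfl⟩
  obtain ⟨-, a, b, ha, hab⟩ := isCoreFunction_iff.1 hg
  obtain ⟨G, hG, hG1⟩ := exists_isRadialBump_eq_one ha b
  have hGc := hG.isCoreFunction (d := d)
  obtain ⟨-, a', b', -, hab'⟩ := isCoreFunction_iff.1 hGc
  have hgG : ∀ x, g x = radialExt G x * g x := by
    intro x
    by_cases hx : ‖x‖ < a ∨ b < ‖x‖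
    · rw [hab x hx, mul_zero]
    · push Not at hx
      rw [radialExt_of_ne (norm_pos_iff.1 (ha.trans_le hx.1)), hG1 _ hx.1 hx.2, one_mul]
  have hGz := hGc.integrable_smul hz
  set I := ∫ x, ‖radialExt G x • z x‖
  have hI : 0 ≤ I := integral_nonneg fun _ => norm_nonneg _
  have hbound : ∀ ε, 0 < ε → ‖∫ x, g x • z x‖ ≤ ε * I := by
    intro ε hε
    -- The radius is that of the support of `G`, larger than that of `g`, since `G q` does not
    -- vanish where `g` does.
    obtain ⟨q, hq⟩ := exists_polyFun_near hgs.continuous b' hε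
    have i1 : Integrable fun x => (radialExt G x * polyFun q x) • z x :=
      (hGc.mul_polyFun q).integrable_smul hz
    rw [← sub_zero (∫ x, g x • z x), ← h G hG q, ← integral_sub (hg.integrable_smul hz) i1,
      ← integral_const_mul]
    refine (norm_integral_le_integral_norm _).trans
      (integral_mono ((hg.integrable_smul hz).sub i1).norm (hGz.norm.const_mul ε) fun x => ?_)
    simp only
    rw [hgG x, ← sub_smul, ← mul_sub, mul_comm, mul_smul, norm_smul]
    by_cases hx : b' < ‖x‖
    · simp [hab' x (Or.inr hx)]
    · refine mul_le_mul_of_nonneg_right ?_ (norm_nonneg _)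
      rw [Real.norm_eq_abs, abs_sub_comm]
      exact (hq x (not_lt.1 hx)).le
  rw [← norm_le_zero_iff]
  refine le_of_forall_pos_le_add fun δ hδ => ?_
  refine (hbound (δ / (I + 1)) (by positivity)).trans ?_
  rw [zero_add, div_mul_eq_mul_div, div_le_iff₀ (by positivity)]
  nlinarith

lemma ae_eq_zero_of_integral_harmonic (hd : 1 ≤ d) {z : Euc d → 𝕜}
    (hz : LocallyIntegrableOn z {0}ᶜ)
    (h : ∀ (G : ℝ → ℝ), IsRadialBump G → ∀ (n : ℕ) (q : MvPolynomial (Fin d) ℝ),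
      IsHarmonicPoly n q → ∫ x, (radialExt G x * polyFun q x) • z x = 0) :
    ∀ᵐ x, x ∈ ({0}ᶜ : Set (Euc d)) → z x = 0 := by
  refine ae_eq_zero_of_integral_radialExt_mul_polyFun hz fun G hG q => ?_
  have hint : ∀ (G : ℝ → ℝ), IsRadialBump G → ∀ q : MvPolynomial (Fin d) ℝ,
      Integrable fun x => (radialExt G x * polyFun q x) • z x := fun G hG q =>
    (hG.isCoreFunction.mul_polyFun q).integrable_smul hz
  let Z : Submodule ℝ (MvPolynomial (Fin d) ℝ) :=
    { carrier := {p | ∫ x, (radialExt G x * polyFun p x) • z x = 0}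
      add_mem' := by
        intro p q hp hq
        simp only [mem_ofPred] at hp hq ⊢
        simp only [polyFun_add, mul_add, add_smul]
        rw [integral_add (hint G hG p) (hint G hG q), hp, hq, add_zero]
      zero_mem' := by simp [polyFun]
      smul_mem' := by
        intro c p hp
        simp only [mem_ofPred] at hp ⊢
        simp only [MvPolynomial.smul_eq_C_mul, polyFun_mul, polyFun_C, mul_left_comm _ c]
        simp only [mul_smul c]
        rw [integral_smul, hp, smul_zero] }
  have hspan : ∀ k, harmonicSpan d k ≤ Z := by
    intro k
    refine Submodule.span_le.2 ?_
    rintro _ ⟨i, m, g, -, hg, rfl⟩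
    change ∫ x, (radialExt G x * polyFun (sqNormPoly d ^ i * g) x) • z x = 0
    -- The powers of `|x|²` are radial and are absorbed into the bump, which leaves a purely
    -- harmonic factor.
    have hG' : IsRadialBump (fun r : ℝ => (r ^ 2) ^ i * G r) :=
      hG.mul_left ((contDiff_id.pow 2).pow i).contDiffOn
    rw [← h _ hG' m g hg]
    refine integral_congr_ae (Eventually.of_forall fun x => ?_)
    have : polyFun (sqNormPoly d ^ i) x = (‖x‖ ^ 2) ^ i := by
      rw [← polyFun_sqNormPoly x]
      simp [polyFun]
    simp only [polyFun_mul, this, radialExt]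
    split_ifs
    · simp
    · congr 1
      ring
  change q ∈ Z
  rw [← q.sum_homogeneousComponent]
  exact Submodule.sum_mem _ fun k _ => hspan k
    (mem_harmonicSpan hd k (MvPolynomial.homogeneousComponent_isHomogeneous k q))

/-! ### The potential -/

/-- The half line splits into a neighbourhood of `0`, a compact interval and a neighbourhood of
infinity, where `v > lam`. The exponent is normalized to `s ≥ 1`, as the form bound requires. -/
lemma IsAdmissibleProfile.exists_lower_bound {v : ℝ → ℝ} (hv : IsAdmissibleProfile v) {lam : ℝ}
    (hlam : ∀ᶠ r in atTop, lam < v r) : ∃ s K : ℝ, 1 ≤ s ∧ s < 2 ∧ 0 < K ∧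
      ∀ r, 0 < r → -(K * (1 + r ^ (-s))) ≤ v r := by
  obtain ⟨R, hR⟩ := eventually_atTop.1 hlam
  have hnear : ∃ s ε K : ℝ, 1 ≤ s ∧ s < 2 ∧ 0 < ε ∧ ∀ r, 0 < r → r < ε →
      -(K * (1 + r ^ (-s))) ≤ v r := by
    rcases hv.origin with hc | ⟨s, hs0, hs2, C, hC0, hC⟩
    · obtain ⟨m, hm⟩ := (isCompact_Icc (a := (0 : ℝ)) (b := 1)).bddBelow_image
        (hc.mono Icc_subset_Ici_self)
      refine ⟨1, 1, |m|, le_rfl, one_lt_two, one_pos, fun r h0 h1 => ?_⟩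
      have h2 : m ≤ v r := hm ⟨r, ⟨h0.le, h1.le⟩, rfl⟩
      have h3 : 0 ≤ r ^ (-(1 : ℝ)) := by positivity
      nlinarith [abs_nonneg m, neg_abs_le m, mul_nonneg (abs_nonneg m) h3]
    · obtain ⟨ε, hε, hεC⟩ := mem_nhdsGT_iff_exists_Ioo_subset.1 hC
      -- For `r < 1` a larger exponent only weakens the lower bound, so `s` may be raised to at
      -- least `1`.
      refine ⟨max s 1, min ε 1, C, le_max_right _ _, max_lt hs2 one_lt_two,
        lt_min hε one_pos, fun r h0 h1 => ?_⟩
      have h2 := (hεC ⟨h0, h1.trans_le (min_le_left _ _)⟩).2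
      have hp : 0 < r ^ (-s) := by positivity
      rw [div_neg, neg_le, le_div_iff₀ hp] at h2
      have h3 : r ^ (-s) ≤ r ^ (-max s 1) :=
        Real.rpow_le_rpow_of_exponent_ge h0 (h1.le.trans (min_le_right _ _))
          (neg_le_neg (le_max_left _ _))
      nlinarith [mul_le_mul_of_nonneg_left h3 hC0.le]
  obtain ⟨s, ε, K, hs1, hs2, hε, hK⟩ := hnear
  obtain ⟨m, hm⟩ := (isCompact_Icc (a := ε) (b := R)).bddBelow_image
    (hv.contDiffOn.continuousOn.mono fun r hr => hε.trans_le hr.1)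
  refine ⟨s, |K| + |m| + |lam| + 1, hs1, hs2, by positivity, fun r hr => ?_⟩
  have hp : 0 < r ^ (-s) := by positivity
  have h1 : ∀ t : ℝ, t ≤ |K| + |m| + |lam| + 1 →
      -((|K| + |m| + |lam| + 1) * (1 + r ^ (-s))) ≤ -(t * (1 + r ^ (-s))) := by
    intro t ht
    have := mul_le_mul_of_nonneg_right ht (by positivity : 0 ≤ 1 + r ^ (-s))
    linarith
  have h2 : ∀ t : ℝ, -(|t| * (1 + r ^ (-s))) ≤ t := by
    intro t
    nlinarith [mul_nonneg (abs_nonneg t) hp.le, neg_abs_le t]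
  have hKa := abs_nonneg K
  have hma := abs_nonneg m
  have hla := abs_nonneg lam
  rcases lt_or_ge r ε with h | h
  · exact (h1 K (by linarith [le_abs_self K])).trans (hK r hr h)
  rcases le_or_gt r R with h' | h'
  · exact ((h1 |m| (by linarith)).trans (h2 m)).trans (hm ⟨r, ⟨h, h'⟩, rfl⟩)
  · exact ((h1 |lam| (by linarith)).trans (h2 lam)).trans (hR r h'.le).le

lemma mem_angularSet_iff {v : ℝ → ℝ} {lam : ℝ} {l : ℕ} : l ∈ angularSet d v lam ↔
    1 ≤ l ∧ ∃ r : ℝ, 0 < r ∧ v r + l * ((l : ℝ) + d - 2) / r ^ 2 < lam := by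
  simp only [angularSet, mem_ofPred, iInf_lt_iff, EReal.coe_lt_coe_iff, mem_Ioi, exists_prop]

/-- A radius `r` witnessing membership satisfies `r ≤ R`, since `v > lam` beyond `R`. Multiplying by
`r²` then bounds `l(l+d-2)` by `R²(|lam| + K) + K R ^ (2-s)`, finite because `s < 2`; and `l ≤
l(l+d-2)` for `l ≥ 1`, `d ≥ 2`. -/
lemma angularSet_finite (hd : 2 ≤ d) {v : ℝ → ℝ} {lam s K : ℝ}
    (hlam : ∀ᶠ r in atTop, lam < v r) (hs2 : s < 2) (hK : 0 < K)
    (hvK : ∀ r, 0 < r → -(K * (1 + r ^ (-s))) ≤ v r) : (angularSet d v lam).Finite := by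
  obtain ⟨R, hR⟩ := eventually_atTop.1 hlam
  obtain ⟨M, hM⟩ := exists_nat_ge (R ^ 2 * (|lam| + K) + K * R ^ (2 - s))
  refine (Set.finite_le_nat M).subset fun l hl => ?_
  obtain ⟨hl1, r, hr, hlt⟩ := mem_angularSet_iff.1 hl
  have hl1' : (1 : ℝ) ≤ l := by exact_mod_cast hl1
  have hd' : (2 : ℝ) ≤ d := by exact_mod_cast hd
  set c : ℝ := l * ((l : ℝ) + d - 2) with hc
  have hcl : (l : ℝ) ≤ c := by nlinarith
  have hrR : r ≤ R := by
    by_contra! h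
    have h1 := hR r h.le
    have h2 : 0 ≤ c / r ^ 2 := div_nonneg (by linarith) (by positivity)
    linarith
  have h1 : c / r ^ 2 < |lam| + K * (1 + r ^ (-s)) := by
    linarith [hvK r hr, le_abs_self lam]
  rw [div_lt_iff₀ (by positivity)] at h1
  have h2 : r ^ (-s) * r ^ 2 = r ^ (2 - s) := by
    rw [← Real.rpow_natCast r 2, ← Real.rpow_add hr]
    congr 1
    push_cast
    ring
  have h3 : r ^ (2 - s) ≤ R ^ (2 - s) := Real.rpow_le_rpow hr.le hrR (by linarith)
  have h4 : r ^ 2 ≤ R ^ 2 := by gcongr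
  have h5 : (l : ℝ) ≤ M := by
    have h6 : (|lam| + K * (1 + r ^ (-s))) * r ^ 2 = r ^ 2 * (|lam| + K) + K * r ^ (2 - s) := by
      rw [← h2]
      ring
    have h7 := mul_le_mul_of_nonneg_right h4 (by positivity : 0 ≤ |lam| + K)
    have h8 := mul_le_mul_of_nonneg_left h3 hK.le
    linarith
  exact_mod_cast h5

/-! ### Rescaled polynomials -/

/-- Used with `c = r⁻¹`: on the sphere of radius `r`, a polynomial in `x/|x|` is a polynomial in `x`
of no larger degree, with coefficients in `𝕜`. -/
lemma exists_mvPolynomial_eval_eq (p : MvPolynomial (Fin d) ℝ) (c : ℝ) :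
    ∃ P : MvPolynomial (Fin d) 𝕜, P.totalDegree ≤ p.totalDegree ∧ ∀ x : Euc d,
      MvPolynomial.eval (fun i => (x i : 𝕜)) P = (polyFun p (c • x) : 𝕜) := by
  refine ⟨∑ m ∈ p.support, MvPolynomial.monomial m ((p.coeff m * c ^ m.degree : ℝ) : 𝕜), ?_, ?_⟩
  · refine MvPolynomial.totalDegree_finsetSum_le fun m hm => ?_
    exact (MvPolynomial.totalDegree_monomial_le _ _).trans (MvPolynomial.le_totalDegree hm)
  · intro x
    simp only [polyFun, PiLp.smul_apply, smul_eq_mul, map_sum, MvPolynomial.eval_monomial]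
    rw [MvPolynomial.eval_eq, RCLike.ofReal_sum]
    refine Finset.sum_congr rfl fun m _ => ?_
    simp_rw [mul_pow, Finset.prod_mul_distrib, Finset.prod_pow_eq_pow_sum]
    rw [Finsupp.degree_apply, Finsupp.prod]
    push_cast
    ring

/-! ### Expansion of an eigenfunction in polynomials on spheres -/

/-- The function `∑ⱼ fⱼ(|x|) eⱼ(x / |x|)`. -/
def angularSynthesis {N : ℕ} (e : Fin N → MvPolynomial (Fin d) ℝ) (f : Fin N → ℝ → 𝕜)
    (x : Euc d) : 𝕜 :=
  ∑ j, f j ‖x‖ * (polyFun (e j) (‖x‖⁻¹ • x) : 𝕜)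

lemma continuousOn_angularSynthesis {N : ℕ} (e : Fin N → MvPolynomial (Fin d) ℝ)
    {f : Fin N → ℝ → 𝕜} (hf : ∀ j, ContinuousOn (f j) (Ioi 0)) :
    ContinuousOn (angularSynthesis e f) {0}ᶜ := by
  refine continuousOn_finsetSum _ fun j _ => ContinuousOn.mul ?_ ?_
  · exact (hf j).comp continuous_norm.continuousOn fun x hx => norm_pos_iff.2 hx
  · have h1 : ContinuousOn (fun x : Euc d => ‖x‖⁻¹ • x) {0}ᶜ :=
      (continuous_norm.continuousOn.inv₀ fun x hx => norm_ne_zero_iff.2 hx).smul continuousOn_id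
    exact (RCLike.continuous_ofReal.comp (continuous_polyFun (e j))).comp_continuousOn h1

lemma sphMean_angularSynthesis {N : ℕ} (e : Fin N → MvPolynomial (Fin d) ℝ) (f : Fin N → ℝ → 𝕜)
    (h : MvPolynomial (Fin d) ℝ) {r : ℝ} (hr : 0 < r) :
    sphMean (angularSynthesis e f) (polyFun h) r = ∑ j, f j r *
      ((∫ θ : Metric.sphere (0 : Euc d) 1, polyFun (e j) θ * polyFun h θ
        ∂(surfaceMeasure d) : ℝ) : 𝕜) := by
  have h1 : ∀ θ : Metric.sphere (0 : Euc d) 1,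
      angularSynthesis e f (r • (θ : Euc d)) * (polyFun h θ : 𝕜) =
        ∑ j, f j r * ((polyFun (e j) θ * polyFun h θ : ℝ) : 𝕜) := fun θ => by
    have h2 : ‖r • (θ : Euc d)‖ = r := norm_smul_sphere hr θ
    rw [angularSynthesis, h2, Finset.sum_mul]
    refine Finset.sum_congr rfl fun j _ => ?_
    rw [smul_smul, inv_mul_cancel₀ hr.ne', one_smul]
    push_cast
    ring
  simp only [sphMean, h1]
  rw [integral_finsetSum _ fun j _ => ((integrable_polyFun_mul (e j) h).ofReal).const_mul _]
  refine Finset.sum_congr rfl fun j _ => ?_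
  rw [integral_const_mul, integral_ofReal]

lemma sphMean_eq_sum {φ : Euc d → 𝕜} (hφ : Continuous φ) {N : ℕ}
    (e : Fin N → MvPolynomial (Fin d) ℝ) (c : Fin N → ℝ) {q : Euc d → ℝ}
    (hq : ∀ θ : Metric.sphere (0 : Euc d) 1, q θ = ∑ j, c j * polyFun (e j) θ) (r : ℝ) :
    sphMean φ q r = ∑ j, sphMean φ (polyFun (e j)) r * (c j : 𝕜) := by
  simp only [sphMean, ← integral_mul_const]
  rw [← integral_finsetSum _ fun j _ =>
    (integrable_sphMean_integrand hφ (continuous_polyFun (e j)) r).mul_const _]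
  refine integral_congr_ae (Eventually.of_forall fun θ => ?_)
  simp only [hq θ]
  push_cast
  rw [Finset.mul_sum]
  exact Finset.sum_congr rfl fun j _ => by ring

lemma IsHarmonicPoly.C_mul {n : ℕ} {h : MvPolynomial (Fin d) ℝ} (hh : IsHarmonicPoly n h) (c : ℝ) :
    IsHarmonicPoly n (MvPolynomial.C c * h) := by
  refine ⟨?_, ?_⟩
  · simpa using (MvPolynomial.isHomogeneous_C (Fin d) c).mul hh.homogeneous
  · rw [← MvPolynomial.smul_eq_C_mul, map_smul, hh.laplacian_eq_zero, smul_zero]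

/-- Extension of a limit statement from normalized to arbitrary harmonic polynomials. -/
lemma tendsto_sphMean_zero_of_normalized {φ : ℕ → Euc d → 𝕜} {r : ℝ} {n : ℕ}
    (H : ∀ h : MvPolynomial (Fin d) ℝ, IsHarmonicPoly n h →
      ∫ θ : Metric.sphere (0 : Euc d) 1, polyFun h θ * polyFun h θ ∂(surfaceMeasure d) = 1 →
        Tendsto (fun m => sphMean (φ m) (polyFun h) r) atTop (𝓝 0))
    {h : MvPolynomial (Fin d) ℝ} (hh : IsHarmonicPoly n h) :
    Tendsto (fun m => sphMean (φ m) (polyFun h) r) atTop (𝓝 0) := by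
  set c := ∫ θ : Metric.sphere (0 : Euc d) 1, polyFun h θ * polyFun h θ ∂(surfaceMeasure d)
    with hc
  have hc0 : 0 ≤ c := integral_nonneg fun θ => mul_self_nonneg _
  rcases hc0.eq_or_lt with h0 | hpos
  · have h1 : ∀ᵐ θ : Metric.sphere (0 : Euc d) 1 ∂(surfaceMeasure d), polyFun h θ = 0 := by
      have h2 := (integral_eq_zero_iff_of_nonneg (fun θ => mul_self_nonneg _)
        (integrable_polyFun_mul h h)).1 h0.symm
      filter_upwards [h2] with θ hθ
      exact mul_self_eq_zero.1 hθ
    have h3 : ∀ m, sphMean (φ m) (polyFun h) r = 0 := fun m => by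
      refine integral_eq_zero_of_ae ?_
      filter_upwards [h1] with θ hθ
      simp [hθ]
    simp [h3]
  · have hs : √c ≠ 0 := (Real.sqrt_pos.2 hpos).ne'
    have hf : ∀ x : Euc d, polyFun (MvPolynomial.C (√c)⁻¹ * h) x = (√c)⁻¹ * polyFun h x :=
      fun x => by rw [polyFun_mul, polyFun_C]
    have h1 := H _ (hh.C_mul (√c)⁻¹) (by
      simp only [hf]
      have : ∀ θ : Metric.sphere (0 : Euc d) 1, (√c)⁻¹ * polyFun h θ * ((√c)⁻¹ * polyFun h θ) =
          c⁻¹ * (polyFun h θ * polyFun h θ) := fun θ => by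
        have h4 : (√c)⁻¹ * (√c)⁻¹ = c⁻¹ := by rw [← mul_inv, Real.mul_self_sqrt hc0]
        rw [← h4]
        ring
      simp only [this]
      rw [integral_const_mul, ← hc, inv_mul_cancel₀ hpos.ne'])
    have h2 : ∀ m, sphMean (φ m) (polyFun h) r =
        (√c : 𝕜) * sphMean (φ m) (polyFun (MvPolynomial.C (√c)⁻¹ * h)) r := fun m => by
      simp only [sphMean, ← integral_const_mul]
      refine integral_congr_ae (Eventually.of_forall fun θ => ?_)
      have hs' : (√c : 𝕜) ≠ 0 := by exact_mod_cast hs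
      simp only [hf]
      push_cast
      field_simp
    simpa [h2] using h1.const_mul (√c : 𝕜)

lemma IsRadialBump.isCoreFunction_mul_polyFun {G : ℝ → ℝ} (hG : IsRadialBump G)
    (h : MvPolynomial (Fin d) ℝ) :
    IsCoreFunction (fun x : Euc d => radialExt G x * polyFun h x) := by
  simpa using (hG.isCoreFunction (d := d)).mul_polyFun h

lemma integral_radialExt_mul_polyFun_smul (hd : 1 ≤ d) {G : ℝ → ℝ} {χ : Euc d → 𝕜} {n : ℕ}
    {h : MvPolynomial (Fin d) ℝ} (hh : h.IsHomogeneous n)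
    (hint : Integrable fun x => (radialExt G x * polyFun h x) • χ x) :
    ∫ x, (radialExt G x * polyFun h x) • χ x =
      ∫ r in Ioi (0 : ℝ), (r ^ (d - 1 + n) * G r) • sphMean χ (polyFun h) r := by
  set R : ℝ → 𝕜 := fun r => if r = 0 then 0 else (G r : 𝕜) with hR
  have h1 : (fun x : Euc d => (radialExt G x * polyFun h x) • χ x) =
      fun x => R ‖x‖ * (χ x * (polyFun h x : 𝕜)) := by
    funext x
    simp only [hR, norm_eq_zero, radialExt, RCLike.real_smul_eq_coe_mul]
    split_ifs with h0
    · simp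
    · push_cast
      ring
  rw [h1] at hint
  rw [h1, integral_radial_mul_polyFun hd hh hint]
  refine setIntegral_congr_fun measurableSet_Ioi fun r hr => ?_
  simp only [hR, (mem_Ioi.1 hr).ne', if_false, RCLike.real_smul_eq_coe_mul]
  push_cast
  ring

/-- Passage to the limit in weighted radial integrals. -/
lemma IsRadialBump.tendsto_integral_smul {G : ℝ → ℝ} (hG : IsRadialBump G) (k : ℕ)
    {F : ℕ → ℝ → 𝕜} {g : ℝ → 𝕜} (hF : ∀ m, ContinuousOn (F m) (Ioi 0))
    (hg : ContinuousOn g (Ioi 0))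
    (hlim : ∀ a, 0 < a → TendstoUniformlyOn F g atTop (Ici a)) :
    Tendsto (fun m => ∫ r in Ioi (0 : ℝ), (r ^ k * G r) • F m r) atTop
      (𝓝 (∫ r in Ioi (0 : ℝ), (r ^ k * G r) • g r)) := by
  obtain ⟨a, b, ha, hab⟩ := hG.vanish
  have hGc : ContinuousOn (fun r : ℝ => r ^ k * G r) (Ioi 0) :=
    (continuous_pow k).continuousOn.mul hG.smooth.continuousOn
  have hsub : Icc a b ⊆ Ioi 0 := fun r hr => ha.trans_le hr.1
  obtain ⟨M, hM⟩ := isCompact_Icc.exists_bound_of_continuousOn (hg.mono hsub)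
  obtain ⟨M', hM'⟩ := isCompact_Icc.exists_bound_of_continuousOn (hGc.mono hsub)
  refine tendsto_integral_filter_of_dominated_convergence
    (indicator (Icc a b) fun _ => M' * (M + 1)) ?_ ?_ ?_ ?_
  · exact Eventually.of_forall fun m =>
      (hGc.smul (hF m)).aestronglyMeasurable measurableSet_Ioi
  · filter_upwards [Metric.tendstoUniformlyOn_iff.1 (hlim a ha) 1 one_pos] with m hm
    filter_upwards [ae_restrict_mem measurableSet_Ioi] with r hr
    by_cases hrab : r ∈ Icc a b
    · rw [indicator_of_mem hrab, norm_smul]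
      have h1 : ‖F m r‖ ≤ M + 1 := by
        have h2 := hm r hrab.1
        rw [dist_eq_norm] at h2
        have h3 := norm_sub_norm_le (F m r) (g r)
        rw [norm_sub_rev] at h3
        linarith [hM r hrab]
      exact mul_le_mul (hM' r hrab) h1 (norm_nonneg _) ((norm_nonneg _).trans (hM' r hrab))
    · rw [indicator_of_notMem hrab, hab r hr (by
        by_contra! h
        exact hrab ⟨h.1, h.2⟩)]
      simp
  · exact ((integrable_indicator_iff measurableSet_Icc).2
      (integrableOn_const (by simp))).restrict
  · filter_upwards [ae_restrict_mem measurableSet_Ioi] with r hr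
    exact ((hlim r hr).tendsto_at self_mem_Ici).const_smul _

/-- An `L²` limit of core functions coincides with a continuous function off the origin as soon
as all their spherical harmonic coefficients converge to those of the latter. -/
lemma ae_eq_of_tendsto_sphMean (hd : 1 ≤ d) {φ : ℕ → Euc d → 𝕜} (hφ : ∀ m, IsCoreFunction (φ m))
    {u w : Euc d → 𝕜} (hu : MemLp u 2 volume)
    (hφu : Tendsto (fun m => eLpNorm (φ m - u) 2 volume) atTop (𝓝 0))
    (hw : ContinuousOn w {0}ᶜ)
    (hT : Tendsto (fun p : ℕ × ℕ => gradSq (φ p.1 - φ p.2)) atTop (𝓝 0))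
    (H : ∀ (n : ℕ) (h : MvPolynomial (Fin d) ℝ), IsHarmonicPoly n h → ∀ r, 0 < r →
      Tendsto (fun m => sphMean (φ m) (polyFun h) r) atTop (𝓝 (sphMean w (polyFun h) r))) :
    u =ᵐ[volume] w := by
  have huloc : LocallyIntegrableOn u {0}ᶜ :=
    (hu.locallyIntegrable (by norm_num)).locallyIntegrableOn _
  have hwloc : LocallyIntegrableOn w ({0}ᶜ : Set (Euc d)) :=
    hw.locallyIntegrableOn isOpen_compl_singleton.measurableSet
  have hz := ae_eq_zero_of_integral_harmonic hd (huloc.sub hwloc) fun G hG n h hh => by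
    have hcore := hG.isCoreFunction_mul_polyFun h
    have hiu := hcore.integrable_smul huloc
    have hiw := hcore.integrable_smul hwloc
    have hiφ : ∀ m, Integrable fun x => (radialExt G x * polyFun h x) • φ m x := fun m =>
      hcore.integrable_smul ((hφ m).continuous.locallyIntegrable.locallyIntegrableOn _)
    simp only [Pi.sub_apply, smul_sub]
    rw [integral_sub hiu hiw, sub_eq_zero]
    -- Pointwise convergence of the coefficients does not pass through the radial integral; the
    -- energy bound supplies a locally uniform limit `g`, identified with the mean of `w` by
    -- uniqueness of limits.
    obtain ⟨g, hg, hgu⟩ := exists_tendstoUniformlyOn_sphMean hφ (tendsto_l2Sq_sub hφ hu hφu) hd hT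
      (continuous_polyFun h)
    have h1 := hG.tendsto_integral_smul (d - 1 + n)
      (fun m => ((hφ m).isRadialBump_sphMean (continuous_polyFun h)).continuousOn) hg hgu
    have h2 : ∫ r in Ioi (0 : ℝ), (r ^ (d - 1 + n) * G r) • g r =
        ∫ x, (radialExt G x * polyFun h x) • w x := by
      rw [integral_radialExt_mul_polyFun_smul hd hh.homogeneous hiw]
      refine setIntegral_congr_fun measurableSet_Ioi fun r hr => ?_
      have := tendsto_nhds_unique ((hgu r hr).tendsto_at self_mem_Ici) (H n h hh r hr)
      simp only [this]
    rw [h2] at h1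
    simp only [← integral_radialExt_mul_polyFun_smul hd hh.homogeneous (hiφ _)] at h1
    have hcomm : ∀ f : Euc d → 𝕜, ∫ x, (radialExt G x * polyFun h x) • f x =
        ∫ x, f x * ((radialExt G x * polyFun h x : ℝ) : 𝕜) := fun f => by
      simp only [RCLike.real_smul_eq_coe_mul, mul_comm]
    have h3 := tendsto_integral_mul_of_eLpNorm (fun m => (hφ m).memLp) hu hφu
      (hcore.memLp.ofReal (K := 𝕜))
    simp only [hcomm] at h1 ⊢
    exact tendsto_nhds_unique h3 h1
  have h0 : ∀ᵐ x : Euc d, x ∈ ({0}ᶜ : Set (Euc d)) := by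
    have : Nonempty (Fin d) := ⟨⟨0, hd⟩⟩
    exact compl_mem_ae_iff.2 (measure_singleton 0)
  filter_upwards [hz, h0] with x hx hx0
  exact sub_eq_zero.1 (hx hx0)

/-- The coefficients `f j` are the limits of the spherical means of the approximating sequence
against `e j`. It remains to compare harmonic coefficients of every degree, with the barrier
hypothesis `hL` in charge of degrees above `L`. -/
lemma exists_angularSynthesis_ae_eq (hd : 2 ≤ d) {v : ℝ → ℝ} (hv : ContinuousOn v (Ioi 0))
    {lam C : ℝ} (hC : ∀ χ : Euc d → 𝕜, IsCoreFunction χ →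
      gradSq χ ≤ 2 * RCLike.re (schroedingerForm (radialPotential v) χ χ) + C * l2Sq χ)
    {L : ℕ} (hL : ∀ n : ℕ, L < n → ∀ r, 0 < r → lam ≤ v r + n * ((n : ℝ) + d - 2) / r ^ 2)
    {N : ℕ} {e : Fin N → MvPolynomial (Fin d) ℝ} (he : ∀ j, (e j).totalDegree ≤ L)
    (hexp : ∀ q : MvPolynomial (Fin d) ℝ, q.totalDegree ≤ L →
        ∀ θ : Metric.sphere (0 : Euc d) 1, polyFun q θ = ∑ j,
          (∫ η : Metric.sphere (0 : Euc d) 1, polyFun (e j) η * polyFun q η ∂(surfaceMeasure d)) *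
            polyFun (e j) θ)
    {u : Euc d → 𝕜} (hu : FriedrichsGraph (radialPotential v) u fun x => (lam : 𝕜) * u x) :
    ∃ f : Fin N → ℝ → 𝕜, (∀ j, ContinuousOn (f j) (Ioi 0)) ∧
      u =ᵐ[volume] angularSynthesis e f := by
  obtain ⟨hu2, -, φ, hconv, hlim⟩ := hu
  have hφ := hconv.core
  have hN := tendsto_l2Sq_sub hφ hu2 hconv.tendsto_L2
  have hQ : Tendsto (fun p : ℕ × ℕ => RCLike.re (schroedingerForm (radialPotential v)
      (φ p.1 - φ p.2) (φ p.1 - φ p.2))) atTop (𝓝 0) := by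
    simpa [Function.comp_def] using (RCLike.continuous_re.tendsto (0 : 𝕜)).comp hconv.cauchy
  -- The form norm controls the gradient, so a sequence that is Cauchy for the form and in `L²` is
  -- Cauchy in `H¹`.
  have hT : Tendsto (fun p : ℕ × ℕ => gradSq (φ p.1 - φ p.2)) atTop (𝓝 0) :=
    squeeze_zero (fun _ => gradSq_nonneg _) (fun p => hC _ ((hφ p.1).sub (hφ p.2)))
      (by simpa using (hQ.const_mul 2).add (hN.const_mul C))
  have hweak : ∀ ψ : Euc d → 𝕜, IsCoreFunction ψ → Tendsto (fun n =>
      schroedingerForm (radialPotential fun r => v r - lam) (φ n) ψ) atTop (𝓝 0) := fun ψ hψ => by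
    have h1 := tendsto_integral_mul_of_eLpNorm (fun m => (hφ m).memLp) hu2 hconv.tendsto_L2
      hψ.conjugate.memLp
    have h2 := (hlim ψ hψ).sub (h1.const_mul (lam : 𝕜))
    simp only [mul_assoc, integral_const_mul, sub_self] at h2
    simpa only [schroedingerForm_sub_const (hφ _) hψ hv] using h2
  choose f hf hfu using fun j =>
    exists_tendstoUniformlyOn_sphMean hφ hN (by omega) hT (continuous_polyFun (e j))
  refine ⟨f, hf, ae_eq_of_tendsto_sphMean (by omega) hφ hu2 hconv.tendsto_L2
    (continuousOn_angularSynthesis e hf) hT fun n h hh r hr => ?_⟩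
  rw [sphMean_angularSynthesis e f h hr]
  -- In degrees up to `L`, `h` expands in the `e j` on the sphere and both sides have the same
  -- coefficients. Above `L`, the synthesis is orthogonal to `h` and the means of the sequence tend
  -- to zero.
  rcases le_or_gt n L with hn | hn
  · simp only [sphMean_eq_sum (hφ _).continuous e _
      (hexp h (hh.homogeneous.totalDegree_le.trans hn))]
    exact tendsto_finsetSum _ fun j _ => ((hfu j r hr).tendsto_at self_mem_Ici).mul_const _
  · rw [Finset.sum_eq_zero fun j _ => by
      rw [hh.integral_mul_eq_zero_of_totalDegree_lt hd ((he j).trans_lt hn)]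
      simp]
    exact tendsto_sphMean_zero_of_normalized (fun q hq h1 =>
      tendsto_sphMean_zero hφ hN hd hv hC hQ hweak hq h1 (hL n hn) hr) hh

end

/-- Eigenfunctions for an eigenvalue below the limit of the potential at infinity agree on every
sphere with a polynomial whose degree is bounded in terms of the effective potentials. -/
theorem proposition3p6 (𝕜 : Type*) [RCLike 𝕜] (d : ℕ) (hd : 2 ≤ d) (v : ℝ → ℝ)
    (hv : IsCaseA v ∨ IsCaseB v) (lam : ℝ)
    (hlam : ∃ u : EuclideanSpace ℝ (Fin d) → 𝕜, IsEigenfunction (radialPotential v) lam u)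
    (hlt : (lam : EReal) < liminf (fun r : ℝ => (v r : EReal)) atTop) :
    ∃ p : ℕ,
      (∀ u : EuclideanSpace ℝ (Fin d) → 𝕜, IsEigenfunction (radialPotential v) lam u →
        ∃ w : EuclideanSpace ℝ (Fin d) → 𝕜, u =ᵐ[volume] w ∧ ContinuousOn w {0}ᶜ ∧
          ∀ τ : ℝ, τ ≤ lam → ∀ r : ℝ, 0 < r →
            Metric.sphere (0 : EuclideanSpace ℝ (Fin d)) r ⊆ radialPotential v ⁻¹' {τ} →
              ∃ P : MvPolynomial (Fin d) 𝕜, P.totalDegree ≤ p ∧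
                ∀ x ∈ Metric.sphere (0 : EuclideanSpace ℝ (Fin d)) r,
                  w x = MvPolynomial.eval (fun i => (x i : 𝕜)) P) ∧
      (angularSet d v lam).Finite ∧ p ≤ sSup (angularSet d v lam) := by
  have hadm : IsAdmissibleProfile v := hv.elim And.left And.left
  have hvc : ContinuousOn v (Ioi 0) := hadm.contDiffOn.continuousOn
  have hev : ∀ᶠ r in atTop, lam < v r :=
    (eventually_lt_of_lt_liminf hlt).mono fun r hr => EReal.coe_lt_coe_iff.1 hr
  obtain ⟨s, K, hs1, hs2, hK, hvK⟩ := hadm.exists_lower_bound hev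
  have hfin := angularSet_finite hd hev hs2 hK hvK
  obtain ⟨C, -, hC⟩ := gradSq_le_form (𝕜 := 𝕜) hd hvc hs1 hs2 hK hvK
  -- An `n` above the supremum is at least `1`, so a radius violating the inequality would place it
  -- in the angular set. For an empty set the supremum in `ℕ` is `0`, and only the radial component
  -- survives.
  have hL : ∀ n : ℕ, sSup (angularSet d v lam) < n → ∀ r, 0 < r →
      lam ≤ v r + n * ((n : ℝ) + d - 2) / r ^ 2 := fun n hn r hr => by
    by_contra! h
    exact hn.not_ge (le_csSup hfin.bddAbove (mem_angularSet_iff.2 ⟨by omega, r, hr, h⟩))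
  obtain ⟨N, e, he, hexp⟩ := exists_orthonormal_polynomials (d := d) (by omega)
    (sSup (angularSet d v lam))
  refine ⟨sSup (angularSet d v lam), fun u hu => ?_, hfin, le_rfl⟩
  obtain ⟨f, hf, huf⟩ := exists_angularSynthesis_ae_eq hd hvc hC hL he hexp hu.2
  refine ⟨angularSynthesis e f, huf, continuousOn_angularSynthesis e hf, fun τ _ r hr _ => ?_⟩
  -- On the sphere of radius `r` the factors `f j r` are constants and `‖x‖⁻¹ = r⁻¹`, so each
  -- summand is a rescaled `e j`.
  choose P hP hPe using fun j => exists_mvPolynomial_eval_eq (𝕜 := 𝕜) (e j) r⁻¹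
  refine ⟨∑ j, MvPolynomial.C (f j r) * P j, ?_, fun x hx => ?_⟩
  · refine MvPolynomial.totalDegree_finsetSum_le fun j _ => ?_
    refine (MvPolynomial.totalDegree_mul _ _).trans ?_
    rw [MvPolynomial.totalDegree_C, zero_add]
    exact (hP j).trans (he j)
  · rw [mem_sphere_zero_iff_norm] at hx
    simp [angularSynthesis, hx, hPe]
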